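/- **Setting.** Consider the class of equations $$f(x)u_t=(g(x)u_x)_x+h(x)u^m,\qquad m\in\mathbb R\setminus\{0,1\},\tag{1}$$ where $f,g,h$ are smooth nonvanishing functions on an open interval (the interval being part of the data), and $u^m$ is read as $|u|^m$ if $m$ is not an even integer (for $m=2$ it is $u^2$; for $m<0$ only $u\ne0$ is considered). The subclass $m=2$ is $$f(x)u_t=(g(x)u_x)_x+h(x)u^2.\tag{2}$$ Write $\theta=(f,g,h,m)$ for the tuple of arbitrary elements and $\mathcal L_\theta$ for the corresponding equation, viewed as a submanifold of the second-order jet space. A (local) *generalized extended equivalence transformation* of a class, near a point $z$ of the space of $(t,x,u)$, assigns to every $\theta$ of the class on a given interval a nondegenerate smooth point transformation $\varphi_\theta\colon(t,x,u)\mapsto(\tilde t,\tilde x,\tilde u)$ near $z$ and a tuple $\tilde\theta$ of the same class, both determined by $\theta$ in an arbitrary, possibly nonlocal way, such that the second prolongation of $\varphi_\theta$ maps $\mathcal L_\theta$ onto $\mathcal L_{\tilde\theta}$; along every smooth one-parameter family $\theta_\varepsilon$ in the class the domain of definition is open in $(\varepsilon,t,x,u)$ and $\varphi_{\theta_\varepsilon}(t,x,u)$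 is continuous in $(\varepsilon,t,x,u)$. The *generalized extended equivalence group* of the class is the (pseudo)group of all transformations $(\theta,\tilde\theta,\varphi_\theta)$ obtained in this way. Let $\hat G^\sim$ be this group for class (1), $\hat G^\sim|_{m=2}$ its restriction to $m=2$, and $\hat G^\sim_{m=2}$ the group for class (2). **Theorem.** The generalized extended equivalence group $\hat G^\sim_{m=2}$ of class (2) consists exactly of the transformations $$\tilde t=\delta_1t+\delta_2,\quad \tilde x=\varphi(x),\quad \tilde u=\psi(x)u+\chi(x),$$ $$\tilde f=\frac{\delta_0\delta_1}{\varphi_x\psi^2}f,\quad \tilde g=\frac{\delta_0\varphi_x}{\psi^2}g,\quad \tilde h=\frac{\delta_0}{\varphi_x\psi^3}h,$$ where $\delta_0,\delta_1,\delta_2$ are arbitrary constants with $\delta_0\delta_1\ne0$, $\varphi$ is an arbitrary smooth function of $x$ with $\varphi_x\neq0$, $\psi=\psi(x)$ is a nonvanishing smooth solution of the fourth-order nonlinear ODE $$\left[\frac g{\psi^2}\left(\frac{\psi^2}{2h}\left(\frac{g\psi_x}{\psi^2}\right)_x\right)_x\right]_x=\frac{\psi}{4h}\left[\left(\frac{g\psi_x}{\psi^2}\right)_x\right]^2,$$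 and $\chi=-\dfrac{\psi^2}{2h}\left(\dfrac{g\psi_x}{\psi^2}\right)_x$. This holds both locally near any point and on every open box in the space of $(t,x,u)$. These transformations contain the identity and are closed under composition and inversion. Moreover $\hat G^\sim|_{m=2}\varsubsetneq\hat G^\sim_{m=2}$. -/

import Mathlib

open scoped ContDiff Topology
open Filter

/-- A tuple of arbitrary elements `(f, g, h, m)` of the class `f u_t = (g u_x)_x + h u ^ m`:
smooth nonvanishing functions of `x` on a nonempty open interval `dom` (their values outside `dom`
carry no meaning) and a real exponent. -/
structure ArbElt where
  dom : Set ℝ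
  f : ℝ → ℝ
  g : ℝ → ℝ
  h : ℝ → ℝ
  m : ℝ
  isOpen_dom : IsOpen dom
  ordConnected_dom : dom.OrdConnected
  nonempty_dom : dom.Nonempty
  smooth_f : ContDiffOn ℝ ∞ f dom
  smooth_g : ContDiffOn ℝ ∞ g dom
  smooth_h : ContDiffOn ℝ ∞ h dom
  f_ne_zero : ∀ x ∈ dom, f x ≠ 0
  g_ne_zero : ∀ x ∈ dom, g x ≠ 0
  h_ne_zero : ∀ x ∈ dom, h x ≠ 0

/-- Points `(t, x, u)`. -/
abbrev Pt := ℝ × ℝ × ℝ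

/-- The function `v` of `(t, x)` satisfies `f u_t = (g u_x)_x + h |u| ^ m` at the point `p = (t, x)`
(for twice differentiable `v` this is a condition on the second-order jet of `v` at `p`).
For negative `m` the equation is considered only where `u ≠ 0`. -/
def SatisfiesAt (θ : ArbElt) (v : ℝ × ℝ → ℝ) (p : ℝ × ℝ) : Prop :=
  (θ.m < 0 → v p ≠ 0) ∧
    θ.f p.2 * deriv (fun s => v (s, p.2)) p.1 =
      deriv (fun y => θ.g y * deriv (fun y' => v (p.1, y')) y) p.2 + θ.h p.2 * |v p| ^ θ.m

/-- For `m = 2` the equation is `f u_t = (g u_x)_x + h u ^ 2`. -/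
theorem satisfiesAt_iff_of_m_eq_two (θ : ArbElt) (hm : θ.m = 2) (v : ℝ × ℝ → ℝ) (p : ℝ × ℝ) :
    SatisfiesAt θ v p ↔
      θ.f p.2 * deriv (fun s => v (s, p.2)) p.1 =
        deriv (fun y => θ.g y * deriv (fun y' => v (p.1, y')) y) p.2 + θ.h p.2 * v p ^ 2 := by
  have h2 : ¬ ((2 : ℝ) < 0) := by norm_num
  simp [SatisfiesAt, hm, h2]

/-- `φ = (T, X, U)` is near `z = (t, x, u)` a nondegenerate smooth point transformation and over `z`
its second prolongation maps the equation with arbitrary elements `θ` to the one with `θ'`: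
if a function `v` passes through `z`, its graph is mapped by `φ` near `z` to the graph of a function
`v'`, then `v` satisfies the equation `θ` at `(t, x)` iff `v'` satisfies the equation `θ'` at the
image point. All 2-jets over `z` whose prolongation is defined are represented by such `v`. -/
def AdmissibleAt (θ θ' : ArbElt) (φ : Pt → Pt) (z : Pt) : Prop :=
  z.2.1 ∈ θ.dom ∧ (φ z).2.1 ∈ θ'.dom ∧
  ContDiffAt ℝ ∞ φ z ∧ Function.Bijective (fderiv ℝ φ z) ∧
  ∀ v v' : ℝ × ℝ → ℝ,
    ContDiffAt ℝ 2 v (z.1, z.2.1) → v (z.1, z.2.1) = z.2.2 →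
    Function.Bijective (fderiv ℝ
      (fun p : ℝ × ℝ => ((φ (p.1, p.2, v p)).1, (φ (p.1, p.2, v p)).2.1)) (z.1, z.2.1)) →
    ContDiffAt ℝ 2 v' ((φ z).1, (φ z).2.1) →
    (∀ᶠ p in 𝓝 (z.1, z.2.1),
      v' ((φ (p.1, p.2, v p)).1, (φ (p.1, p.2, v p)).2.1) = (φ (p.1, p.2, v p)).2.2) →
    (SatisfiesAt θ v (z.1, z.2.1) ↔ SatisfiesAt θ' v' ((φ z).1, (φ z).2.1))

/-- A smooth one-parameter family `ε ↦ θ ε` of arbitrary elements on the interval `I` in the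
subclass of equations with exponents in `M`. -/
structure IsSmoothFamily (M : Set ℝ) (I : Set ℝ) (θ : ℝ → ArbElt) : Prop where
  dom_eq : ∀ ε, (θ ε).dom = I
  m_mem : ∀ ε, (θ ε).m ∈ M
  smooth_f : ContDiffOn ℝ ∞ (fun p : ℝ × ℝ => (θ p.1).f p.2) (Set.univ ×ˢ I)
  smooth_g : ContDiffOn ℝ ∞ (fun p : ℝ × ℝ => (θ p.1).g p.2) (Set.univ ×ˢ I)
  smooth_h : ContDiffOn ℝ ∞ (fun p : ℝ × ℝ => (θ p.1).h p.2) (Set.univ ×ˢ I)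
  smooth_m : ContDiff ℝ ∞ (fun ε => (θ ε).m)

/-- A (local) generalized extended equivalence transformation, near `z`, of the class of equations
on the interval `I` with exponents in `M`. To *every* tuple `θ` of arbitrary elements it assigns
a point transformation `φ θ` of `(t, x, u)`, which may depend on `θ` in a nonlocal way, and new
arbitrary elements `Φ θ` from the same class, determined by `θ` in an arbitrary way, such that
`φ θ` maps the equation of `θ` to the equation of `Φ θ`. The transformation is defined on an open
set of `(θ, (t, x, u))` and depends continuously on the arbitrary elements, openness and continuity
being tested along smooth families. -/
structure IsGenExtTransformation (M : Set ℝ) (I : Set ℝ) (z : Pt)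
    (Φ : ArbElt → ArbElt) (φ : ArbElt → Pt → Pt) : Prop where
  m_mem : ∀ θ : ArbElt, θ.dom = I → θ.m ∈ M → (Φ θ).m ∈ M
  admissible : ∀ θ : ℝ → ArbElt, IsSmoothFamily M I θ → ∀ ε₀ : ℝ,
    ∀ᶠ q in 𝓝 (ε₀, z), AdmissibleAt (θ q.1) (Φ (θ q.1)) (φ (θ q.1)) q.2
  continuous : ∀ θ : ℝ → ArbElt, IsSmoothFamily M I θ → ∀ ε₀ : ℝ,
    ∀ᶠ q in 𝓝 (ε₀, z), ContinuousAt (fun r : ℝ × Pt => φ (θ r.1) r.2) q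

/-- The generalized extended equivalence group of the class of equations with exponents in `M`,
as a set of transformations `(θ, θ', z, φ)`: near `z`, the point transformation `φ` from the
equation of `θ` to the equation of `θ'` is the value at `θ` of a generalized extended equivalence
transformation of the class. -/
def genExtEquivGroup (M : Set ℝ) : Set (ArbElt × ArbElt × Pt × (Pt → Pt)) :=
  {e | e.1.m ∈ M ∧ ∃ (Φ : ArbElt → ArbElt) (φ : ArbElt → Pt → Pt),
    IsGenExtTransformation M e.1.dom e.2.2.1 Φ φ ∧
      Φ e.1 = e.2.1 ∧ φ e.1 =ᶠ[𝓝 e.2.2.1] e.2.2.2}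

/-- The exponents `m ≠ 0, 1` of the whole (nonlinear) class. -/
def nonlinearExponents : Set ℝ := {m | m ≠ 0 ∧ m ≠ 1}

/-- The restriction of the equivalence group of the whole class to the value `m = 2`. -/
def restrictedGroup : Set (ArbElt × ArbElt × Pt × (Pt → Pt)) :=
  {e | e ∈ genExtEquivGroup nonlinearExponents ∧ e.1.m = 2 ∧ e.2.1.m = 2}

/-- The generalized extended equivalence group of the subclass `m = 2`. -/
def conditionalGroup : Set (ArbElt × ArbElt × Pt × (Pt → Pt)) :=
  genExtEquivGroup {2}

/-- Nonempty open boxes in the space of `(t, x, u)`. -/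
structure Box where
  J : Set ℝ
  I : Set ℝ
  K : Set ℝ
  isOpen_J : IsOpen J
  isOpen_I : IsOpen I
  isOpen_K : IsOpen K
  ordConnected_J : J.OrdConnected
  ordConnected_I : I.OrdConnected
  ordConnected_K : K.OrdConnected
  nonempty_J : J.Nonempty
  nonempty_I : I.Nonempty
  nonempty_K : K.Nonempty

/-- The box as a set of points. -/
def Box.pts (D : Box) : Set Pt := D.J ×ˢ (D.I ×ˢ D.K)

/-- The expression `(g ψ_x / ψ ^ 2)_x`. -/
noncomputable def Qexpr (g ψ : ℝ → ℝ) (x : ℝ) : ℝ :=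
  deriv (fun y => g y * deriv ψ y / ψ y ^ 2) x

/-- The fourth-order nonlinear ordinary differential equation for `ψ`, at the point `x`. -/
def FourthOrderODE (g h ψ : ℝ → ℝ) (x : ℝ) : Prop :=
  deriv (fun y => g y / ψ y ^ 2 *
      deriv (fun w => ψ w ^ 2 / (2 * h w) * Qexpr g ψ w) y) x =
    ψ x / (4 * h x) * Qexpr g ψ x ^ 2

/-- On the box `D` the transformation `φ` and the new arbitrary elements `θ'` have the explicit form
`t' = δ₁ t + δ₂`, `x' = ξ x`, `u' = ψ x * u + χ x`, `f' = δ₀ δ₁ / (ξ_x ψ ^ 2) f`,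
`g' = δ₀ ξ_x / ψ ^ 2 g`, `h' = δ₀ / (ξ_x ψ ^ 3) h`
with `ψ` a solution of the fourth-order equation and `χ` determined by `ψ`. -/
def HasExplicitForm (θ θ' : ArbElt) (φ : Pt → Pt) (D : Box) : Prop :=
  θ.m = 2 ∧ θ'.m = 2 ∧ D.I ⊆ θ.dom ∧
  ∃ (δ₀ δ₁ δ₂ : ℝ) (ξ ψ χ : ℝ → ℝ),
    δ₀ * δ₁ ≠ 0 ∧
    ContDiffOn ℝ ∞ ξ D.I ∧ (∀ x ∈ D.I, deriv ξ x ≠ 0) ∧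
    ContDiffOn ℝ ∞ ψ D.I ∧ (∀ x ∈ D.I, ψ x ≠ 0) ∧
    (∀ x ∈ D.I, FourthOrderODE θ.g θ.h ψ x) ∧
    (∀ x ∈ D.I, χ x = -(ψ x ^ 2 / (2 * θ.h x)) * Qexpr θ.g ψ x) ∧
    (∀ z ∈ D.pts, φ z = (δ₁ * z.1 + δ₂, ξ z.2.1, ψ z.2.1 * z.2.2 + χ z.2.1)) ∧
    ∀ x ∈ D.I, ξ x ∈ θ'.dom ∧
      θ'.f (ξ x) = δ₀ * δ₁ / (deriv ξ x * ψ x ^ 2) * θ.f x ∧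
      θ'.g (ξ x) = δ₀ * deriv ξ x / ψ x ^ 2 * θ.g x ∧
      θ'.h (ξ x) = δ₀ / (deriv ξ x * ψ x ^ 3) * θ.h x

/-! Necessity. Suppose a point transformation `(T, X, U)` maps one equation to another. Its second
prolongation sends every jet with `f u_t = g u_xx + g_x u_x + h |u|^m` to a jet of the target
equation, so the target equation becomes an identity in the remaining jet coordinates. The absence
of `u_tt` forces `T_x = T_u = 0`. The coefficient of `u_xx` cannot depend on `u_x`, which forces
`X_u = 0`. The term quadratic in `u_x` forces `U_uu = 0`. Hence `T = T(t)`, `X = X(t, x)`, `U = A(t,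
x) u + B(t, x)`, with the determining equations collected in `IsTriangular`; for `m = 2` the last of
them splits further by powers of `u`.

The crux is `X_t = 0`, which is false for a single equation: the shift `x' = x + c t` maps `u_t =
u_xx + u^2` to an equation of the class with all three coefficients equal to `exp (-c x)`. What
excludes such maps is that the transformation must be defined for all arbitrary elements and be
continuous along families. Eliminating `A_x` and `X_xx` gives a relation between `X_t` and a
logarithmic derivative `logInvariant` of the coefficients (`IsTriangular.drift`). In the coordinate
`S` with `S_x = √|f/g|` the map `X` is affine in `S` for each `t`, and `X_t ≠ 0` at some point
forces `logInvariant / S_x` to be a quadratic over a nonzero affine function of `S`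
(`IsTriangular.rational_of_dt_ne_zero`). Multiplying `h` by `exp (ε S^5)` adds `10 ε S^4` to this
quotient, so the rational form is possible for at most one `ε` (`IsTriangular.perturb_unique`). Thus
`X_t = 0` for small `ε ≠ 0`, and continuity carries this to `ε = 0`.

Once `X_t = 0`, the remaining equations successively give `T` affine, `A = ψ(x)`, `B = χ(x)`, the
constant `δ₀`, and the system `(g ψ_x/ψ^2)_x = -2 h χ/ψ^2`, `(g χ_x/ψ^2)_x = -h χ^2/ψ^3`.
Eliminating `χ` yields the fourth-order equation, so `HasReducedForm` is equivalent to
`HasExplicitForm`.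

Sufficiency. Direct computation shows that an explicit transformation maps one equation to the other
(`HasReducedForm.satisfiesAt_iff`). To embed it into a transformation of the whole subclass, the
system for `(ψ, χ)` is solved for every other tuple with the same Cauchy data at the base point;
smooth dependence of ODEs on parameters supplies openness and continuity
(`HasReducedForm.mem_conditionalGroup`).

The transformation data are determined by `φ` and the two tuples, so local forms glue on boxes, and
the explicit form is stable under composition and inversion. Strictness comes from the same
continuity principle: for `m ≠ 2` the determining equations force `B = 0`, so a transformation of
the whole class has `B = 0` at `m = 2` along a family crossing it, whereas `ψ = x^3`, `χ = 6 x` is a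
solution for `u_t = u_xx + u^2`. -/

theorem two_le_infty : (2 : WithTop ℕ∞) ≤ ∞ :=
  ENat.LEInfty.out

/-! ### Second prolongation of a point transformation -/

/-- The chain rule of second order along a curve. -/
theorem hasDerivAt_fderiv_comp_curve {E F : Type*} [NormedAddCommGroup E] [NormedSpace ℝ E]
    [NormedAddCommGroup F] [NormedSpace ℝ F] {G : E → F} {c c₁ : ℝ → E} {c₂ : E}
    (hG : ContDiffAt ℝ 2 G (c 0)) (hc : ∀ᶠ r in 𝓝 (0 : ℝ), HasDerivAt c (c₁ r) r)
    (hc₁ : HasDerivAt c₁ c₂ 0) :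
    (∀ᶠ r in 𝓝 (0 : ℝ), HasDerivAt (fun r => G (c r)) (fderiv ℝ G (c r) (c₁ r)) r) ∧
      HasDerivAt (fun r => fderiv ℝ G (c r) (c₁ r))
        (fderiv ℝ (fderiv ℝ G) (c 0) (c₁ 0) (c₁ 0) + fderiv ℝ G (c 0) c₂) 0 := by
  have hc0 := hc.self_of_nhds
  constructor
  · have h1 : ∀ᶠ y in 𝓝 (c 0), DifferentiableAt ℝ G y := by
      filter_upwards [hG.eventually (by simp)] with y hy
      exact hy.differentiableAt (by simp)
    filter_upwards [hc, hc0.continuousAt.eventually h1] with r h2 h3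
    exact h3.hasFDerivAt.comp_hasDerivAt r h2
  · have h1 : DifferentiableAt ℝ (fderiv ℝ G) (c 0) :=
      (hG.fderiv_right (m := 1) (by norm_num)).differentiableAt (by simp)
    exact (h1.hasFDerivAt.comp_hasDerivAt (0 : ℝ) hc0).clm_apply hc₁

theorem HasDerivAt.fst_comp {E F : Type*} [NormedAddCommGroup E] [NormedSpace ℝ E]
    [NormedAddCommGroup F] [NormedSpace ℝ F] {c : ℝ → E × F} {c' : E × F} {r : ℝ}
    (h : HasDerivAt c c' r) : HasDerivAt (fun s => (c s).1) c'.1 r :=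
  (hasFDerivAt_fst (𝕜 := ℝ) (E := E) (F := F)).comp_hasDerivAt r h

theorem HasDerivAt.snd_comp {E F : Type*} [NormedAddCommGroup E] [NormedSpace ℝ E]
    [NormedAddCommGroup F] [NormedSpace ℝ F] {c : ℝ → E × F} {c' : E × F} {r : ℝ}
    (h : HasDerivAt c c' r) : HasDerivAt (fun s => (c s).2) c'.2 r :=
  (hasFDerivAt_snd (𝕜 := ℝ) (E := E) (F := F)).comp_hasDerivAt r h

/-- The polynomial with the 2-jet `(u, a, b; d, 0, c)` at the point `(t, x)`. -/
noncomputable def jetPolynomial (z : Pt) (a b c d : ℝ) (p : ℝ × ℝ) : ℝ :=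
  z.2.2 + a * (p.1 - z.1) + b * (p.2 - z.2.1) + c / 2 * (p.2 - z.2.1) ^ 2 +
    d / 2 * (p.1 - z.1) ^ 2

theorem contDiff_jetPolynomial (z : Pt) (a b c d : ℝ) : ContDiff ℝ ∞ (jetPolynomial z a b c d) := by
  unfold jetPolynomial
  fun_prop

theorem jetPolynomial_self (z : Pt) (a b c d : ℝ) :
    jetPolynomial z a b c d (z.1, z.2.1) = z.2.2 := by
  simp [jetPolynomial]

theorem hasFDerivAt_jetPolynomial (z : Pt) (a b c d : ℝ) :
    HasFDerivAt (jetPolynomial z a b c d)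
      (a • ContinuousLinearMap.fst ℝ ℝ ℝ + b • ContinuousLinearMap.snd ℝ ℝ ℝ) (z.1, z.2.1) := by
  have h1 : HasFDerivAt (fun p : ℝ × ℝ => p.1 - z.1) (ContinuousLinearMap.fst ℝ ℝ ℝ)
      (z.1, z.2.1) := hasFDerivAt_fst.sub_const _
  have h2 : HasFDerivAt (fun p : ℝ × ℝ => p.2 - z.2.1) (ContinuousLinearMap.snd ℝ ℝ ℝ)
      (z.1, z.2.1) := hasFDerivAt_snd.sub_const _
  have h := ((((h1.const_mul a).const_add z.2.2).add (h2.const_mul b)).add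
    ((h2.pow 2).const_mul (c / 2))).add ((h1.pow 2).const_mul (d / 2))
  refine h.congr_fderiv ?_
  ext <;> simp

theorem deriv_jetPolynomial_fst (z : Pt) (a b c d : ℝ) :
    deriv (fun s => jetPolynomial z a b c d (s, z.2.1)) z.1 = a := by
  have h := (hasFDerivAt_jetPolynomial z a b c d).comp_hasDerivAt z.1
    ((hasDerivAt_id z.1).prodMk (hasDerivAt_const z.1 z.2.1))
  refine h.deriv.trans ?_
  simp

theorem deriv_jetPolynomial_snd (z : Pt) (a b c d y : ℝ) :
    deriv (fun y => jetPolynomial z a b c d (z.1, y)) y = b + c * (y - z.2.1) := by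
  have h1 : HasDerivAt (fun y => y - z.2.1) 1 y := (hasDerivAt_id y).sub_const _
  have h := ((h1.const_mul b).const_add z.2.2).add ((h1.pow 2).const_mul (c / 2))
  have h2 : (fun y => jetPolynomial z a b c d (z.1, y)) =
      fun y => z.2.2 + b * (y - z.2.1) + c / 2 * (y - z.2.1) ^ 2 := by
    funext y; simp [jetPolynomial]
  rw [h2]
  refine h.deriv.trans ?_
  simp
  ring

/-- The equation constrains only `u_t`, `u_x`, `u_xx` and `u`; the value `d` of `u_tt` stays free.
This freedom later shows that the new time depends on `t` alone. -/
theorem satisfiesAt_jetPolynomial {θ : ArbElt} {z : Pt} (hz : z.2.1 ∈ θ.dom) (hm : 0 ≤ θ.m)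
    {a b c : ℝ} (d : ℝ)
    (h : θ.f z.2.1 * a = θ.g z.2.1 * c + deriv θ.g z.2.1 * b + θ.h z.2.1 * |z.2.2| ^ θ.m) :
    SatisfiesAt θ (jetPolynomial z a b c d) (z.1, z.2.1) := by
  refine ⟨fun h => absurd h hm.not_gt, ?_⟩
  simp only [deriv_jetPolynomial_fst, deriv_jetPolynomial_snd, jetPolynomial_self]
  have hg : DifferentiableAt ℝ θ.g z.2.1 :=
    (θ.smooth_g.contDiffAt (θ.isOpen_dom.mem_nhds hz)).differentiableAt (by simp)
  have h1 : HasDerivAt (fun y => b + c * (y - z.2.1)) (c * 1) z.2.1 :=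
    (((hasDerivAt_id z.2.1).sub_const z.2.1).const_mul c).const_add b
  have h2 := (hg.hasDerivAt.mul h1).deriv
  simp only [sub_self, mul_zero, add_zero, mul_one, Pi.mul_def] at h2
  rw [h, h2]
  ring

/-- The expression for `(g v_x)_x` at a point in terms of the total derivatives of `v`. -/
theorem deriv_mul_deriv_snd {g : ℝ → ℝ} {v : ℝ × ℝ → ℝ} {p : ℝ × ℝ}
    (hg : DifferentiableAt ℝ g p.2) (hv : ContDiffAt ℝ 2 v p) :
    deriv (fun y => g y * deriv (fun y' => v (p.1, y')) y) p.2 =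
      deriv g p.2 * fderiv ℝ v p (0, 1) +
        g p.2 * fderiv ℝ (fderiv ℝ v) p (0, 1) (0, 1) := by
  have hc : ∀ y, HasDerivAt (fun y : ℝ => (p.1, y)) ((0 : ℝ), (1 : ℝ)) y := fun y =>
    (hasDerivAt_const y p.1).prodMk (hasDerivAt_id y)
  have h1 : ∀ᶠ y in 𝓝 p.2, deriv (fun y' => v (p.1, y')) y = fderiv ℝ v (p.1, y) (0, 1) := by
    have h2 : ∀ᶠ w in 𝓝 (p.1, p.2), DifferentiableAt ℝ v w := by
      filter_upwards [hv.eventually (by simp)] with y hy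
      exact hy.differentiableAt (by simp)
    filter_upwards [(hc p.2).continuousAt.eventually h2] with y hy
    exact (hy.hasFDerivAt.comp_hasDerivAt y (hc y)).deriv
  have h3 : DifferentiableAt ℝ (fderiv ℝ v) (p.1, p.2) :=
    (hv.fderiv_right (m := 1) (by norm_num)).differentiableAt (by simp)
  have h4 := (h3.hasFDerivAt.comp_hasDerivAt p.2 (hc p.2)).clm_apply
    (hasDerivAt_const p.2 ((0 : ℝ), (1 : ℝ)))
  have h5 := hg.hasDerivAt.mul h4
  have h6 : (fun y => g y * deriv (fun y' => v (p.1, y')) y) =ᶠ[𝓝 p.2]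
      fun y => g y * fderiv ℝ v (p.1, y) (0, 1) := by
    filter_upwards [h1] with y hy
    rw [hy]
  rw [h6.deriv_eq]
  refine h5.deriv.trans ?_
  simp

theorem deriv_fst_eq_fderiv {v : ℝ × ℝ → ℝ} {p : ℝ × ℝ} (hv : DifferentiableAt ℝ v p) :
    deriv (fun s => v (s, p.2)) p.1 = fderiv ℝ v p (1, 0) :=
  (HasFDerivAt.comp_hasDerivAt (f := fun s : ℝ => (s, p.2)) p.1 hv.hasFDerivAt
    ((hasDerivAt_id p.1).prodMk (hasDerivAt_const p.1 p.2))).deriv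

/-- The prolongation of an admissible point transformation to the second-order jets `(a, b; d, 0, c)`
over `z`: the first-order part `(p, q)` of the image jet and the image equation. -/
theorem AdmissibleAt.prolongation {θ θ' : ArbElt} {φ : Pt → Pt} {z : Pt}
    (h : AdmissibleAt θ θ' φ z) (hm : 0 ≤ θ.m) {a b : ℝ} {e₁ e₂ : Pt}
    (he₁ : e₁ = (1, 0, a)) (he₂ : e₂ = (0, 1, b))
    {J : ℝ} (hJ : J ≠ 0)
    (hJ' : J = (fderiv ℝ φ z e₁).1 * (fderiv ℝ φ z e₂).2.1 -
      (fderiv ℝ φ z e₂).1 * (fderiv ℝ φ z e₁).2.1) :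
    ∃ p q : ℝ,
      (fderiv ℝ φ z e₁).2.2 = p * (fderiv ℝ φ z e₁).1 + q * (fderiv ℝ φ z e₁).2.1 ∧
      (fderiv ℝ φ z e₂).2.2 = p * (fderiv ℝ φ z e₂).1 + q * (fderiv ℝ φ z e₂).2.1 ∧
      ∀ c d : ℝ, ∀ η B : Pt,
        η = (-(fderiv ℝ φ z e₂).1 / J) • e₁ + ((fderiv ℝ φ z e₁).1 / J) • e₂ →
        B = fderiv ℝ (fderiv ℝ φ) z η η + (c * ((fderiv ℝ φ z e₁).1 / J) ^ 2 +
          d * (-(fderiv ℝ φ z e₂).1 / J) ^ 2) • fderiv ℝ φ z (0, 0, 1) →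
        θ.f z.2.1 * a = θ.g z.2.1 * c + deriv θ.g z.2.1 * b + θ.h z.2.1 * |z.2.2| ^ θ.m →
        (θ'.m < 0 → (φ z).2.2 ≠ 0) ∧
        θ'.f (φ z).2.1 * p = deriv θ'.g (φ z).2.1 * q +
          θ'.g (φ z).2.1 * (B.2.2 - p * B.1 - q * B.2.1) +
          θ'.h (φ z).2.1 * |(φ z).2.2| ^ θ'.m := by
  obtain ⟨hdom, hdom', hφ, -, hsat⟩ := h
  set D := fderiv ℝ φ z with hD
  have hφd : HasFDerivAt φ D z := (hφ.differentiableAt (by simp)).hasFDerivAt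
  have hDlin : ∀ w : ℝ × ℝ, D (w.1, w.2, a * w.1 + b * w.2) = w.1 • D e₁ + w.2 • D e₂ := by
    intro w
    rw [← map_smul, ← map_smul, ← map_add]
    congr 1
    rw [he₁, he₂]
    ext <;> simp [mul_comm]
  -- for every choice of `c` and `d` there are `p`, `q`, which in fact depend on `a` and `b` only
  have key : ∀ c d : ℝ, ∃ p q : ℝ,
      (D e₁).2.2 = p * (D e₁).1 + q * (D e₁).2.1 ∧
      (D e₂).2.2 = p * (D e₂).1 + q * (D e₂).2.1 ∧
      ∀ η B : Pt, η = (-(D e₂).1 / J) • e₁ + ((D e₁).1 / J) • e₂ →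
        B = fderiv ℝ (fderiv ℝ φ) z η η + (c * ((D e₁).1 / J) ^ 2 +
          d * (-(D e₂).1 / J) ^ 2) • D (0, 0, 1) →
        θ.f z.2.1 * a = θ.g z.2.1 * c + deriv θ.g z.2.1 * b + θ.h z.2.1 * |z.2.2| ^ θ.m →
        (θ'.m < 0 → (φ z).2.2 ≠ 0) ∧
        θ'.f (φ z).2.1 * p = deriv θ'.g (φ z).2.1 * q +
          θ'.g (φ z).2.1 * (B.2.2 - p * B.1 - q * B.2.1) +
          θ'.h (φ z).2.1 * |(φ z).2.2| ^ θ'.m := by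
    intro c d
    set v := jetPolynomial z a b c d with hv
    set p₀ : ℝ × ℝ := (z.1, z.2.1) with hp₀
    have hvp₀ : v p₀ = z.2.2 := jetPolynomial_self z a b c d
    set Γ : ℝ × ℝ → Pt := fun p => (p.1, p.2, v p) with hΓ
    have hΓ₀ : Γ p₀ = z := by rw [hΓ]; simp only [hvp₀]; rfl
    have hΓs : ContDiff ℝ ∞ Γ :=
      contDiff_fst.prodMk (contDiff_snd.prodMk (contDiff_jetPolynomial z a b c d))
    have hφΓ : ContDiffAt ℝ ∞ (fun p => φ (Γ p)) p₀ := by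
      refine ContDiffAt.comp p₀ ?_ hΓs.contDiffAt
      rwa [hΓ₀]
    set F : ℝ × ℝ → ℝ × ℝ := fun p => ((φ (Γ p)).1, (φ (Γ p)).2.1) with hF
    have hFs : ContDiffAt ℝ ∞ F p₀ := hφΓ.fst.prodMk hφΓ.snd.fst
    have hF₀ : F p₀ = ((φ z).1, (φ z).2.1) := by simp [hF, hΓ₀]
    have hΓd : HasFDerivAt Γ ((ContinuousLinearMap.fst ℝ ℝ ℝ).prod
        ((ContinuousLinearMap.snd ℝ ℝ ℝ).prod
          (a • ContinuousLinearMap.fst ℝ ℝ ℝ + b • ContinuousLinearMap.snd ℝ ℝ ℝ))) p₀ :=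
      hasFDerivAt_fst.prodMk (hasFDerivAt_snd.prodMk (hasFDerivAt_jetPolynomial z a b c d))
    have hφΓd : ∀ w : ℝ × ℝ, fderiv ℝ (fun p => φ (Γ p)) p₀ w = w.1 • D e₁ + w.2 • D e₂ := by
      intro w
      have h1 := HasFDerivAt.comp p₀ (g := φ) (by rw [hΓ₀]; exact hφd) hΓd
      refine (congrArg (fun A => A w) h1.fderiv).trans ?_
      rw [← hDlin w]
      simp
    have hFd : ∀ w : ℝ × ℝ, fderiv ℝ F p₀ w =
        (w.1 * (D e₁).1 + w.2 * (D e₂).1, w.1 * (D e₁).2.1 + w.2 * (D e₂).2.1) := by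
      intro w
      have h0 := (hφΓ.differentiableAt (by simp)).hasFDerivAt
      have h1 : HasFDerivAt F _ p₀ := h0.fst.prodMk h0.snd.fst
      rw [h1.fderiv]
      simp [hφΓd]
    have hFbij : Function.Bijective (fderiv ℝ F p₀) := by
      have hinj : Function.Injective (fderiv ℝ F p₀) := by
        rw [injective_iff_map_eq_zero]
        intro w hw
        rw [hFd, Prod.mk_eq_zero] at hw
        have h1 : J * w.1 = 0 := by
          rw [hJ']; linear_combination (D e₂).2.1 * hw.1 - (D e₂).1 * hw.2
        have h2 : J * w.2 = 0 := by
          rw [hJ']; linear_combination (D e₁).1 * hw.2 - (D e₁).2.1 * hw.1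
        ext
        · simpa [hJ] using h1
        · simpa [hJ] using h2
      exact ⟨hinj, (LinearMap.injective_iff_surjective (f := (fderiv ℝ F p₀ : ℝ × ℝ →ₗ[ℝ] ℝ × ℝ))).1
        hinj⟩
    let FL : (ℝ × ℝ) ≃L[ℝ] (ℝ × ℝ) := (LinearEquiv.ofBijective
      (fderiv ℝ F p₀ : ℝ × ℝ →ₗ[ℝ] ℝ × ℝ) hFbij).toContinuousLinearEquiv
    have hFL : HasFDerivAt F (FL : ℝ × ℝ →L[ℝ] ℝ × ℝ) p₀ := by
      refine (hFs.differentiableAt (by simp)).hasFDerivAt.congr_fderiv ?_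
      ext <;> rfl
    -- The image function is forced: `F` is the base part of `φ` along the graph of `v`, and `v'`
    -- must be the `u`-component of `φ` along that graph composed with the local inverse of `F`.
    set G := hFs.localInverse hFL (by simp) with hG
    have hGs : ContDiffAt ℝ ∞ G (F p₀) := hFs.to_localInverse hFL (by simp)
    have hGF : ∀ᶠ p in 𝓝 p₀, G (F p) = p :=
      (hFs.hasStrictFDerivAt' hFL (by simp)).eventually_left_inverse
    have hG₀ : G (F p₀) = p₀ := hGF.self_of_nhds
    set v' : ℝ × ℝ → ℝ := fun y => (φ (Γ (G y))).2.2 with hv'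
    have hv's : ContDiffAt ℝ ∞ v' (F p₀) := by
      refine ContDiffAt.comp (F p₀) (g := fun p => (φ (Γ p)).2.2) ?_ hGs
      rw [hG₀]
      exact hφΓ.snd.snd
    have hv'2 : ContDiffAt ℝ 2 v' (F p₀) := hv's.of_le two_le_infty
    have hv'F : ∀ᶠ p in 𝓝 p₀, v' (F p) = (φ (Γ p)).2.2 := by
      filter_upwards [hGF] with p hp
      simp only [hv', hp]
    have hsat' := hsat v v' ((contDiff_jetPolynomial z a b c d).contDiffAt.of_le
      two_le_infty) hvp₀ hFbij (hF₀ ▸ hv'2) hv'F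
    set L := fderiv ℝ v' (F p₀) with hL
    have hLd : HasFDerivAt v' L (F p₀) := (hv's.differentiableAt (by simp)).hasFDerivAt
    have hLlin : ∀ w : ℝ × ℝ, L w = L (1, 0) * w.1 + L (0, 1) * w.2 := by
      intro w
      have : w = w.1 • ((1 : ℝ), (0 : ℝ)) + w.2 • ((0 : ℝ), (1 : ℝ)) := by ext <;> simp
      conv_lhs => rw [this]
      rw [map_add, map_smul, map_smul]
      simp [mul_comm]
    have hL' : ∀ w : ℝ × ℝ, L (fderiv ℝ F p₀ w) = w.1 * (D e₁).2.2 + w.2 * (D e₂).2.2 := by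
      intro w
      have h1 := hLd.comp p₀ (hFs.differentiableAt (by simp)).hasFDerivAt
      have h2 := ((hφΓ.differentiableAt (by simp)).hasFDerivAt.snd.snd).congr_of_eventuallyEq hv'F
      have h3 := congrArg (fun A => A w) (h1.unique h2)
      simpa [hφΓd] using h3
    refine ⟨L (1, 0), L (0, 1), ?_, ?_, ?_⟩
    · have := hL' (1, 0)
      rw [hFd, hLlin] at this
      simpa using this.symm
    · have := hL' (0, 1)
      rw [hFd, hLlin] at this
      simpa using this.symm
    · intro η B hη hB hE
      obtain ⟨hne, hE'⟩ := hsat'.1 (satisfiesAt_jetPolynomial hdom hm d hE)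
      have hv'z : v' ((φ z).1, (φ z).2.1) = (φ z).2.2 := by
        rw [← hF₀, hv'F.self_of_nhds, hΓ₀]
      rw [hv'z] at hne hE'
      refine ⟨hne, ?_⟩
      have hg' : DifferentiableAt ℝ θ'.g (φ z).2.1 :=
        (θ'.smooth_g.contDiffAt (θ'.isOpen_dom.mem_nhds hdom')).differentiableAt (by simp)
      have e1 := deriv_fst_eq_fderiv (p := ((φ z).1, (φ z).2.1)) (hF₀ ▸ hLd.differentiableAt)
      have e2 := deriv_mul_deriv_snd (p := ((φ z).1, (φ z).2.1)) (g := θ'.g) hg' (hF₀ ▸ hv'2)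
      simp only at e1 e2
      rw [e1, e2, ← hF₀, ← hL] at hE'
      -- the second derivative of `v'` in the direction `(0, 1)`
      set νt := -(D e₂).1 / J with hνt
      set νx := (D e₁).1 / J with hνx
      set k := c * νx ^ 2 + d * νt ^ 2 with hk
      have hηc : η = (νt, νx, a * νt + b * νx) := by
        rw [hη, he₁, he₂]; ext <;> simp [mul_comm]
      -- The vector `(νt, νx)` is the preimage of `(0, 1)` under the derivative of `F`. The base
      -- projection of the image of `γ` therefore starts with velocity `(0, 1)`, and differentiating
      -- `v'` twice along it isolates its second derivative in the new `x`, up to first-order terms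
      -- coming from the acceleration `B`.
      set γ : ℝ → Pt := fun r => Γ (z.1 + r * νt, z.2.1 + r * νx) with hγ
      have hγ₀ : γ 0 = z := by simp only [hγ, zero_mul, add_zero]; exact hΓ₀
      have hγd : ∀ r, HasDerivAt γ (νt, νx, a * νt + b * νx + r * k) r := by
        intro r
        have i1 : HasDerivAt (fun r => z.1 + r * νt) νt r := by
          simpa using ((hasDerivAt_id r).mul_const νt).const_add z.1
        have i2 : HasDerivAt (fun r => z.2.1 + r * νx) νx r := by
          simpa using ((hasDerivAt_id r).mul_const νx).const_add z.2.1
        have i3 : HasDerivAt (fun r => z.2.2 + (a * νt + b * νx) * r + k / 2 * r ^ 2)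
            (a * νt + b * νx + r * k) r := by
          refine ((((hasDerivAt_id r).const_mul (a * νt + b * νx)).const_add z.2.2).add
            (((hasDerivAt_id r).pow 2).const_mul (k / 2))).congr_deriv ?_
          simp; ring
        refine (i1.prodMk (i2.prodMk i3)).congr_of_eventuallyEq (Eventually.of_forall fun r => ?_)
        simp only [hγ, hΓ, hv, jetPolynomial]
        ext <;> simp
        rw [hk]; ring
      have hγ₁ : HasDerivAt (fun r : ℝ => ((νt, νx, a * νt + b * νx + r * k) : Pt)) (0, 0, k) 0 := by
        refine (hasDerivAt_const _ _).prodMk ((hasDerivAt_const _ _).prodMk ?_)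
        simpa using ((hasDerivAt_id (0 : ℝ)).mul_const k).const_add (a * νt + b * νx)
      obtain ⟨hβ, hβ₁⟩ := hasDerivAt_fderiv_comp_curve (G := φ) (c := γ)
        (hγ₀ ▸ hφ.of_le two_le_infty) (Eventually.of_forall hγd) hγ₁
      have hBe : fderiv ℝ (fderiv ℝ φ) (γ 0) (νt, νx, a * νt + b * νx + 0 * k)
          (νt, νx, a * νt + b * νx + 0 * k) + fderiv ℝ φ (γ 0) (0, 0, k) = B := by
        rw [hB, hηc, hγ₀, ← hD, ← map_smul]
        simp
      rw [hBe] at hβ₁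
      set β : ℝ → Pt := fun r => fderiv ℝ φ (γ r) (νt, νx, a * νt + b * νx + r * k) with hβdef
      have hC : ∀ᶠ r in 𝓝 (0 : ℝ), HasDerivAt (fun r => ((φ (γ r)).1, (φ (γ r)).2.1))
          ((β r).1, (β r).2.1) r := by
        filter_upwards [hβ] with r hr
        exact hr.fst_comp.prodMk hr.snd_comp.fst_comp
      have hC₁ : HasDerivAt (fun r => ((β r).1, (β r).2.1)) (B.1, B.2.1) 0 :=
        hβ₁.fst_comp.prodMk hβ₁.snd_comp.fst_comp
      have hC0 : ((φ (γ 0)).1, (φ (γ 0)).2.1) = F p₀ := by rw [hγ₀, hF₀]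
      obtain ⟨hκ, hκ₁⟩ := hasDerivAt_fderiv_comp_curve (G := v') (hC0 ▸ hv'2) hC hC₁
      have hβ0 : ((β 0).1, (β 0).2.1) = ((0 : ℝ), (1 : ℝ)) := by
        have h1 : β 0 = νt • D e₁ + νx • D e₂ := by
          rw [← hDlin (νt, νx)]
          simp only [hβdef, hγ₀, zero_mul, add_zero, hD]
        rw [h1, hνt, hνx]
        ext
        · simp; field_simp; ring
        · simp; field_simp; rw [hJ']; ring
      have hev : (fun r => fderiv ℝ v' ((φ (γ r)).1, (φ (γ r)).2.1) ((β r).1, (β r).2.1)) =ᶠ[𝓝 0]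
          fun r => (β r).2.2 := by
        have hcont : ContinuousAt (fun r : ℝ => (z.1 + r * νt, z.2.1 + r * νx)) 0 := by fun_prop
        have hto : Tendsto (fun r : ℝ => (z.1 + r * νt, z.2.1 + r * νx)) (𝓝 0) (𝓝 p₀) := by
          have := hcont.tendsto
          simpa using this
        have h1 := (hto.eventually hv'F.eventually_nhds)
        have hcont' : ∀ r, ContinuousAt (fun r : ℝ => (z.1 + r * νt, z.2.1 + r * νx)) r := by
          intro r; fun_prop
        filter_upwards [h1, hκ, hβ] with r h2 h3 h4
        have h5 := (hcont' r).tendsto.eventually h2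
        refine h3.unique ((h4.snd_comp.snd_comp).congr_of_eventuallyEq ?_)
        filter_upwards [h5] with s hs
        exact hs
      have hfin := hκ₁.unique ((hβ₁.snd_comp.snd_comp).congr_of_eventuallyEq hev)
      rw [hβ0, hC0, ← hL, hLlin (B.1, B.2.1)] at hfin
      have hfin' : fderiv ℝ (fderiv ℝ v') (F p₀) (0, 1) (0, 1) =
          B.2.2 - L (1, 0) * B.1 - L (0, 1) * B.2.1 := by
        linear_combination hfin
      rw [hfin'] at hE'
      rwa [congrArg Prod.snd hF₀] at hE'
  obtain ⟨p, q, hp, hq, -⟩ := key 0 0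
  refine ⟨p, q, hp, hq, fun c d η B hη hB hE => ?_⟩
  obtain ⟨p', q', hp', hq', hpq⟩ := key c d
  -- Both pairs solve the same linear system of determinant `J`, in which `c` and `d` do not occur.
  have h1 : J * (p' - p) = 0 := by
    rw [hJ']; linear_combination (D e₂).2.1 * (hp - hp') - (D e₁).2.1 * (hq - hq')
  have h2 : J * (q' - q) = 0 := by
    rw [hJ']; linear_combination (D e₁).1 * (hq - hq') - (D e₂).1 * (hp - hp')
  have h1' : p' = p := by simpa [hJ, sub_eq_zero] using h1
  have h2' : q' = q := by simpa [hJ, sub_eq_zero] using h2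
  subst h1' h2'
  exact hpq η B hη hB hE

/-! ### Splitting the determining identity with respect to the jet variables -/

theorem ArbElt.differentiableAt_f (θ : ArbElt) {x : ℝ} (hx : x ∈ θ.dom) :
    DifferentiableAt ℝ θ.f x :=
  (θ.smooth_f.contDiffAt (θ.isOpen_dom.mem_nhds hx)).differentiableAt (by simp)

theorem ArbElt.differentiableAt_g (θ : ArbElt) {x : ℝ} (hx : x ∈ θ.dom) :
    DifferentiableAt ℝ θ.g x :=
  (θ.smooth_g.contDiffAt (θ.isOpen_dom.mem_nhds hx)).differentiableAt (by simp)

theorem ArbElt.differentiableAt_h (θ : ArbElt) {x : ℝ} (hx : x ∈ θ.dom) :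
    DifferentiableAt ℝ θ.h x :=
  (θ.smooth_h.contDiffAt (θ.isOpen_dom.mem_nhds hx)).differentiableAt (by simp)

/-- A covector that annihilates `(1, 0, a)`, `(0, 1, b)` and `(0, 0, 1)` after a surjective linear
map cannot have a nonzero last coordinate. -/
theorem transversal_ne_zero {D : Pt →L[ℝ] Pt} (hD : Function.Surjective D) {a b p q : ℝ}
    (h₁ : (D (1, 0, a)).2.2 = p * (D (1, 0, a)).1 + q * (D (1, 0, a)).2.1)
    (h₂ : (D (0, 1, b)).2.2 = p * (D (0, 1, b)).1 + q * (D (0, 1, b)).2.1) :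
    (D (0, 0, 1)).2.2 - p * (D (0, 0, 1)).1 - q * (D (0, 0, 1)).2.1 ≠ 0 := by
  intro h₃
  obtain ⟨w, hw⟩ := hD (0, 0, 1)
  have e : w = w.1 • ((1, 0, a) : Pt) + w.2.1 • ((0, 1, b) : Pt) +
      (w.2.2 - a * w.1 - b * w.2.1) • ((0, 0, 1) : Pt) := by
    ext <;> simp
    ring
  rw [e, map_add, map_add, map_smul, map_smul, map_smul] at hw
  simp only [Prod.ext_iff, Prod.fst_add, Prod.snd_add, Prod.smul_fst, Prod.smul_snd,
    smul_eq_mul] at hw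
  obtain ⟨i1, i2, i3⟩ := hw
  have : (0 : ℝ) = 1 := by
    linear_combination i3 - p * i1 - q * i2 - w.1 * h₁ - w.2.1 * h₂ -
      (w.2.2 - a * w.1 - b * w.2.1) * h₃
  norm_num at this

theorem map_jet_vectors (D : Pt →L[ℝ] Pt) (a b : ℝ) :
    D (1, 0, a) = D (1, 0, 0) + a • D (0, 0, 1) ∧ D (0, 1, b) = D (0, 1, 0) + b • D (0, 0, 1) := by
  rw [← map_smul, ← map_add, ← map_smul, ← map_add]
  simp

/-- An admissible transformation maps `t` to a function of `t` only. -/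
theorem AdmissibleAt.fderiv_time {θ θ' : ArbElt} {φ : Pt → Pt} {z : Pt}
    (h : AdmissibleAt θ θ' φ z) (hm : 0 ≤ θ.m) :
    (fderiv ℝ φ z (0, 1, 0)).1 = 0 ∧ (fderiv ℝ φ z (0, 0, 1)).1 = 0 := by
  have hK := fun {a b J : ℝ} => h.prolongation hm (a := a) (b := b) rfl rfl (J := J)
  obtain ⟨hdom, hdom', -, hbij, -⟩ := h
  have hg := θ.g_ne_zero _ hdom
  have hg' := θ'.g_ne_zero _ hdom'
  set D := fderiv ℝ φ z with hD
  have hJ0 : ∀ a b : ℝ, (D (1, 0, a)).1 * (D (0, 1, b)).2.1 -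
      (D (0, 1, b)).1 * (D (1, 0, a)).2.1 ≠ 0 → (D (0, 1, b)).1 = 0 := by
    intro a b hJ
    obtain ⟨p, q, hp, hq, hpq⟩ := hK hJ rfl
    have hE : θ.f z.2.1 * a = θ.g z.2.1 * ((θ.f z.2.1 * a - deriv θ.g z.2.1 * b -
        θ.h z.2.1 * |z.2.2| ^ θ.m) / θ.g z.2.1) + deriv θ.g z.2.1 * b +
        θ.h z.2.1 * |z.2.2| ^ θ.m := by field_simp; ring
    -- Here `u_xx` has been solved for from the equation. The choices `u_tt = 0` and `u_tt = 1`
    -- leave everything else unchanged, so the difference isolates the coefficient of `u_tt`: the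
    -- nonzero factor `g'` times the square of the multiple of `T_x + b T_u` times the nonzero
    -- transversality factor.
    have h0 := (hpq _ 0 _ _ rfl rfl hE).2
    have h1 := (hpq _ 1 _ _ rfl rfl hE).2
    have htr := transversal_ne_zero hbij.2 hp hq
    simp only [Prod.fst_add, Prod.snd_add, Prod.smul_fst, Prod.smul_snd, smul_eq_mul] at h0 h1
    have h2 : θ'.g (φ z).2.1 * (-(D (0, 1, b)).1 / ((D (1, 0, a)).1 * (D (0, 1, b)).2.1 -
      (D (0, 1, b)).1 * (D (1, 0, a)).2.1)) ^ 2 * ((D (0, 0, 1)).2.2 - p * (D (0, 0, 1)).1 -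
        q * (D (0, 0, 1)).2.1) = 0 := by
      linear_combination h0 - h1
    simpa [hg', htr, hJ] using h2
  replace hJ0 := fun a b => (map_jet_vectors D a b).1 ▸ (map_jet_vectors D a b).2 ▸ hJ0 a b
  simp only [Prod.fst_add, Prod.snd_add, Prod.smul_fst, Prod.smul_snd, smul_eq_mul] at hJ0
  by_cases hall : ∀ b : ℝ, (D (0, 1, 0)).1 + b * (D (0, 0, 1)).1 = 0
  · have h0 := hall 0
    have h1 := hall 1
    constructor <;> linarith
  exfalso
  push Not at hall
  obtain ⟨b, hb⟩ := hall
  have hzero : ∀ a b : ℝ, (D (0, 1, 0)).1 + b * (D (0, 0, 1)).1 ≠ 0 →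
      ((D (1, 0, 0)).1 + a * (D (0, 0, 1)).1) * ((D (0, 1, 0)).2.1 + b * (D (0, 0, 1)).2.1) -
      ((D (0, 1, 0)).1 + b * (D (0, 0, 1)).1) * ((D (1, 0, 0)).2.1 + a * (D (0, 0, 1)).2.1) = 0 :=
    fun a b hb => by
      by_contra hne
      exact hb (hJ0 a b hne)
  obtain ⟨b', hbb, hb'⟩ : ∃ b', b' ≠ b ∧ (D (0, 1, 0)).1 + b' * (D (0, 0, 1)).1 ≠ 0 := by
    by_contra hcon
    push Not at hcon
    have h1 := hcon (b + 1) (by linarith)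
    have h2 := hcon (b + 2) (by linarith)
    exact hb (by linarith)
  have e1 := hzero 0 b hb
  have e2 := hzero 1 b hb
  have e3 := hzero 0 b' hb'
  -- The Jacobian of the base map is affine in `a` for each fixed `b`. Its vanishing for all `a` and
  -- for two values of `b` annihilates all three 2×2 minors of the first two rows of `D`.
  have m2 : (D (0, 0, 1)).1 * (D (0, 1, 0)).2.1 - (D (0, 1, 0)).1 * (D (0, 0, 1)).2.1 = 0 := by
    linear_combination e2 - e1
  have m3 : (D (1, 0, 0)).1 * (D (0, 0, 1)).2.1 - (D (0, 0, 1)).1 * (D (1, 0, 0)).2.1 = 0 := by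
    have : (b' - b) * ((D (1, 0, 0)).1 * (D (0, 0, 1)).2.1 -
        (D (0, 0, 1)).1 * (D (1, 0, 0)).2.1) = 0 := by linear_combination e3 - e1
    simpa [sub_ne_zero.2 hbb] using this
  have m1 : (D (1, 0, 0)).1 * (D (0, 1, 0)).2.1 - (D (0, 1, 0)).1 * (D (1, 0, 0)).2.1 = 0 := by
    linear_combination e1 - b * m3
  have hlin : ∀ w : Pt, D w = w.1 • D (1, 0, 0) + w.2.1 • D (0, 1, 0) + w.2.2 • D (0, 0, 1) := by
    intro w
    rw [← map_smul, ← map_smul, ← map_smul, ← map_add, ← map_add]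
    simp
  obtain ⟨w₁, hw₁⟩ := hbij.2 (1, 0, 0)
  obtain ⟨w₂, hw₂⟩ := hbij.2 (0, 1, 0)
  rw [hlin] at hw₁ hw₂
  simp only [Prod.ext_iff, Prod.fst_add, Prod.snd_add, Prod.smul_fst, Prod.smul_snd,
    smul_eq_mul] at hw₁ hw₂
  obtain ⟨i1, i2, -⟩ := hw₁
  obtain ⟨j1, j2, -⟩ := hw₂
  -- Cauchy–Binet: the identity matrix of the pairs `(1, 0)`, `(0, 1)` is the product of two rows of
  -- `D` with the columns `w₁`, `w₂`, so its determinant is a combination of the vanishing minors.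
  have : (1 : ℝ) = 0 := by
    linear_combination (w₁.1 * w₂.2.1 - w₁.2.1 * w₂.1) * m1 +
      (w₁.1 * w₂.2.2 - w₁.2.2 * w₂.1) * m3 + (w₁.2.2 * w₂.2.1 - w₁.2.1 * w₂.2.2) * m2 -
      i1 * (w₂.1 * (D (1, 0, 0)).2.1 + w₂.2.1 * (D (0, 1, 0)).2.1 +
        w₂.2.2 * (D (0, 0, 1)).2.1) - j2 +
      i2 * (w₂.1 * (D (1, 0, 0)).1 + w₂.2.1 * (D (0, 1, 0)).1 + w₂.2.2 * (D (0, 0, 1)).1)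
  norm_num at this

theorem eventually_fderiv_apply {φ : Pt → Pt} {z : Pt} (hφ : ContDiffAt ℝ ∞ φ z) (w e : Pt) :
    (fderiv ℝ (fderiv ℝ φ) z w e).1 = fderiv ℝ (fun y => (fderiv ℝ φ y e).1) z w ∧
    (fderiv ℝ (fderiv ℝ φ) z w e).2.1 = fderiv ℝ (fun y => (fderiv ℝ φ y e).2.1) z w ∧
    (fderiv ℝ (fderiv ℝ φ) z w e).2.2 = fderiv ℝ (fun y => (fderiv ℝ φ y e).2.2) z w := by
  have h1 : DifferentiableAt ℝ (fderiv ℝ φ) z :=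
    ((hφ.of_le two_le_infty).fderiv_right (m := 1) (by norm_num)).differentiableAt (by simp)
  have h2 := h1.hasFDerivAt.clm_apply (hasFDerivAt_const e z)
  have h3 := h2.fst.fderiv
  have h4 := h2.snd.fst.fderiv
  have h5 := h2.snd.snd.fderiv
  rw [h3, h4, h5]
  simp

theorem fderiv_components {φ : Pt → Pt} {z : Pt} (hφ : DifferentiableAt ℝ φ z) (w : Pt) :
    (fderiv ℝ φ z w).1 = fderiv ℝ (fun y => (φ y).1) z w ∧
    (fderiv ℝ φ z w).2.1 = fderiv ℝ (fun y => (φ y).2.1) z w ∧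
    (fderiv ℝ φ z w).2.2 = fderiv ℝ (fun y => (φ y).2.2) z w := by
  have h3 := hφ.hasFDerivAt.fst.fderiv
  have h4 := hφ.hasFDerivAt.snd.fst.fderiv
  have h5 := hφ.hasFDerivAt.snd.snd.fderiv
  rw [h3, h4, h5]
  simp

theorem fderiv_eq_zero_of_eventually {ψ : Pt → ℝ} {z : Pt} (h : ∀ᶠ y in 𝓝 z, ψ y = 0) (w : Pt) :
    fderiv ℝ ψ z w = 0 := by
  have : ψ =ᶠ[𝓝 z] fun _ => 0 := h
  rw [this.fderiv_eq]
  simp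

/-- The prolongation formula if `t' = T(t)`. -/
theorem AdmissibleAt.prolongation_of_time {θ θ' : ArbElt} {φ : Pt → Pt} {z : Pt}
    (h : ∀ᶠ y in 𝓝 z, AdmissibleAt θ θ' φ y) (hm : 0 ≤ θ.m) :
    (fderiv ℝ φ z (1, 0, 0)).1 ≠ 0 ∧
    ∀ a b c : ℝ, (fderiv ℝ φ z (0, 1, b)).2.1 ≠ 0 →
      θ.f z.2.1 * a = θ.g z.2.1 * c + deriv θ.g z.2.1 * b + θ.h z.2.1 * |z.2.2| ^ θ.m →
      ∃ p q : ℝ,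
        (fderiv ℝ φ z (1, 0, a)).2.2 =
          p * (fderiv ℝ φ z (1, 0, 0)).1 + q * (fderiv ℝ φ z (1, 0, a)).2.1 ∧
        (fderiv ℝ φ z (0, 1, b)).2.2 = q * (fderiv ℝ φ z (0, 1, b)).2.1 ∧
        (fderiv ℝ φ z (0, 0, 1)).2.2 - q * (fderiv ℝ φ z (0, 0, 1)).2.1 ≠ 0 ∧
        (θ'.m < 0 → (φ z).2.2 ≠ 0) ∧
        θ'.f (φ z).2.1 * p = deriv θ'.g (φ z).2.1 * q +
          θ'.g (φ z).2.1 / (fderiv ℝ φ z (0, 1, b)).2.1 ^ 2 *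
            ((fderiv ℝ (fderiv ℝ φ) z (0, 1, b) (0, 1, b)).2.2 + c * (fderiv ℝ φ z (0, 0, 1)).2.2
             - q * ((fderiv ℝ (fderiv ℝ φ) z (0, 1, b) (0, 1, b)).2.1 +
                c * (fderiv ℝ φ z (0, 0, 1)).2.1)) +
          θ'.h (φ z).2.1 * |(φ z).2.2| ^ θ'.m := by
  have hz := h.self_of_nhds
  have hK := fun {a b J : ℝ} => hz.prolongation hm (a := a) (b := b) rfl rfl (J := J)
  have hφ := hz.2.2.1
  have hbij := hz.2.2.2.1
  obtain ⟨hx, hu⟩ := hz.fderiv_time hm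
  -- `T_x = T_u = 0` holds on a whole neighbourhood and may be differentiated once more; this is why
  -- admissibility is assumed at all nearby points.
  have h2 : ∀ b : ℝ, (fderiv ℝ (fderiv ℝ φ) z (0, 1, b) (0, 1, b)).1 = 0 := by
    intro b
    rw [(eventually_fderiv_apply hφ _ _).1]
    refine fderiv_eq_zero_of_eventually ?_ _
    filter_upwards [h] with y hy
    obtain ⟨i1, i2⟩ := hy.fderiv_time hm
    rw [(map_jet_vectors _ 0 b).2]
    simp [i1, i2]
  set D := fderiv ℝ φ z with hD
  have hb1 : ∀ b : ℝ, (D (0, 1, b)).1 = 0 := by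
    intro b
    rw [(map_jet_vectors _ 0 b).2]
    simp [hx, hu]
  have ha1 : ∀ a : ℝ, (D (1, 0, a)).1 = (D (1, 0, 0)).1 := by
    intro a
    rw [(map_jet_vectors _ a 0).1]
    simp [hu]
  have hT : (D (1, 0, 0)).1 ≠ 0 := by
    intro hT
    obtain ⟨w, hw⟩ := hbij.2 (1, 0, 0)
    have : w = w.1 • ((1, 0, 0) : Pt) + w.2.1 • ((0, 1, 0) : Pt) + w.2.2 • ((0, 0, 1) : Pt) := by
      simp
    rw [this, map_add, map_add, map_smul, map_smul, map_smul] at hw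
    have := congrArg Prod.fst hw
    simp [hT, hx, hu] at this
  refine ⟨hT, fun a b c hX hE => ?_⟩
  have hJ : (D (1, 0, a)).1 * (D (0, 1, b)).2.1 - (D (0, 1, b)).1 * (D (1, 0, a)).2.1 ≠ 0 := by
    rw [hb1, ha1]
    simp [hT, hX]
  obtain ⟨p, q, hp, hq, hpq⟩ := hK hJ rfl
  have htr := transversal_ne_zero hbij.2 hp hq
  obtain ⟨hne, h3⟩ := hpq c 0 _ _ rfl rfl hE
  rw [ha1] at hp
  rw [hb1] at hq
  rw [hu] at htr
  refine ⟨p, q, hp, by linarith, by simpa using htr, hne, ?_⟩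
  rw [hb1, ha1] at h3
  have e : (-0 / ((D (1, 0, 0)).1 * (D (0, 1, b)).2.1 - 0 * (D (1, 0, a)).2.1)) • ((1, 0, a) : Pt) +
      ((D (1, 0, 0)).1 / ((D (1, 0, 0)).1 * (D (0, 1, b)).2.1 - 0 * (D (1, 0, a)).2.1)) •
        ((0, 1, b) : Pt) = (1 / (D (0, 1, b)).2.1) • ((0, 1, b) : Pt) := by
    rw [neg_zero, zero_div, zero_smul, zero_add]
    congr 1
    field_simp
    simp
  rw [e] at h3
  simp only [map_smul, smul_apply, Prod.fst_add, Prod.snd_add,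
    Prod.smul_fst, Prod.smul_snd, smul_eq_mul, h2, hu] at h3
  rw [h3]
  field_simp
  ring

/-- An admissible transformation maps `x` to a function of `t` and `x` only. -/
theorem AdmissibleAt.fderiv_space {θ θ' : ArbElt} {φ : Pt → Pt} {z : Pt}
    (h : ∀ᶠ y in 𝓝 z, AdmissibleAt θ θ' φ y) (hm : 0 ≤ θ.m) :
    (fderiv ℝ φ z (0, 0, 1)).2.1 = 0 := by
  obtain ⟨hT, hK⟩ := AdmissibleAt.prolongation_of_time h hm
  have hz := h.self_of_nhds
  have hf := θ.f_ne_zero _ hz.1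
  have hg' := θ'.g_ne_zero _ hz.2.1
  set D := fderiv ℝ φ z with hD
  have key : ∀ b : ℝ, (D (0, 1, b)).2.1 ≠ 0 →
      θ'.f (φ z).2.1 * θ.g z.2.1 / (θ.f z.2.1 * (D (1, 0, 0)).1) =
        θ'.g (φ z).2.1 / (D (0, 1, b)).2.1 ^ 2 := by
    intro b hb
    -- Now `u_t` is solved for from the equation while `u_x = b` is kept; comparing `u_xx = 0` with
    -- `u_xx = 1` extracts the coefficient of `u_xx`.
    obtain ⟨p, q, hp, hq, htr, -, h1⟩ := hK ((θ.g z.2.1 * 0 + deriv θ.g z.2.1 * b +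
      θ.h z.2.1 * |z.2.2| ^ θ.m) / θ.f z.2.1) b 0 hb (by field_simp)
    obtain ⟨p', q', hp', hq', htr', -, h2⟩ := hK ((θ.g z.2.1 * 1 + deriv θ.g z.2.1 * b +
      θ.h z.2.1 * |z.2.2| ^ θ.m) / θ.f z.2.1) b 1 hb (by field_simp)
    have hqq : q' = q := by
      have : (q' - q) * (D (0, 1, b)).2.1 = 0 := by linear_combination hq - hq'
      simpa [hb, sub_eq_zero] using this
    subst hqq
    rw [(map_jet_vectors _ _ 0).1] at hp hp'
    simp only [Prod.snd_add, Prod.fst_add, Prod.smul_snd, Prod.smul_fst, smul_eq_mul] at hp hp'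
    have hpp : p' = p + θ.g z.2.1 / (θ.f z.2.1 * (D (1, 0, 0)).1) *
        ((D (0, 0, 1)).2.2 - q' * (D (0, 0, 1)).2.1) := by
      field_simp at hp hp' ⊢
      linear_combination hp - hp'
    rw [hpp] at h2
    refine mul_right_cancel₀ htr ?_
    linear_combination h2 - h1
  by_contra hXu
  -- If `X_u ≠ 0`, the total derivative `X_x + b X_u` takes every value. The left side of `key` does
  -- not depend on `b`, so the values `1` and `2` would give `g' = g'/4`.
  have hex : ∀ r : ℝ, ∃ b, (D (0, 1, b)).2.1 = r := by
    intro r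
    refine ⟨(r - (D (0, 1, 0)).2.1) / (D (0, 0, 1)).2.1, ?_⟩
    rw [(map_jet_vectors _ 0 _).2]
    simp only [Prod.snd_add, Prod.fst_add, Prod.smul_snd, Prod.smul_fst, smul_eq_mul]
    field_simp
    ring
  obtain ⟨b₁, hb₁⟩ := hex 1
  obtain ⟨b₂, hb₂⟩ := hex 2
  have k1 := key b₁ (by rw [hb₁]; norm_num)
  have k2 := key b₂ (by rw [hb₂]; norm_num)
  rw [hb₁] at k1
  rw [hb₂] at k2
  apply hg'
  linarith

/-- The determining equations for an admissible transformation, at a point, in terms of its partial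
derivatives. -/
theorem AdmissibleAt.determining_equations {θ θ' : ArbElt} {φ : Pt → Pt} {z : Pt}
    (h : ∀ᶠ y in 𝓝 z, AdmissibleAt θ θ' φ y) (hm : 0 ≤ θ.m)
    {Tt Xt Xx Xxx Ut Ux Uu Uxx Uxu : ℝ}
    (hTt : Tt = (fderiv ℝ φ z (1, 0, 0)).1) (hXt : Xt = (fderiv ℝ φ z (1, 0, 0)).2.1)
    (hXx : Xx = (fderiv ℝ φ z (0, 1, 0)).2.1)
    (hXxx : Xxx = (fderiv ℝ (fderiv ℝ φ) z (0, 1, 0) (0, 1, 0)).2.1)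
    (hUt : Ut = (fderiv ℝ φ z (1, 0, 0)).2.2) (hUx : Ux = (fderiv ℝ φ z (0, 1, 0)).2.2)
    (hUu : Uu = (fderiv ℝ φ z (0, 0, 1)).2.2)
    (hUxx : Uxx = (fderiv ℝ (fderiv ℝ φ) z (0, 1, 0) (0, 1, 0)).2.2)
    (hUxu : Uxu = (fderiv ℝ (fderiv ℝ φ) z (0, 0, 1) (0, 1, 0)).2.2) :
    Tt ≠ 0 ∧ Xx ≠ 0 ∧ Uu ≠ 0 ∧ (fderiv ℝ (fderiv ℝ φ) z (0, 0, 1) (0, 0, 1)).2.2 = 0 ∧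
    θ'.f (φ z).2.1 * θ.g z.2.1 / (θ.f z.2.1 * Tt) = θ'.g (φ z).2.1 / Xx ^ 2 ∧
    θ'.f (φ z).2.1 / Tt * (deriv θ.g z.2.1 * Uu / θ.f z.2.1 - Uu * Xt / Xx) =
      deriv θ'.g (φ z).2.1 * Uu / Xx + θ'.g (φ z).2.1 / Xx ^ 2 * (2 * Uxu - Uu * Xxx / Xx) ∧
    θ'.f (φ z).2.1 / Tt * (Ut + Uu * θ.h z.2.1 * |z.2.2| ^ θ.m / θ.f z.2.1 - Ux * Xt / Xx) =
      deriv θ'.g (φ z).2.1 * Ux / Xx + θ'.g (φ z).2.1 / Xx ^ 2 * (Uxx - Ux * Xxx / Xx) +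
        θ'.h (φ z).2.1 * |(φ z).2.2| ^ θ'.m ∧
    (θ'.m < 0 → (φ z).2.2 ≠ 0) := by
  obtain ⟨hT, hK⟩ := AdmissibleAt.prolongation_of_time h hm
  have hz := h.self_of_nhds
  have hφ := hz.2.2.1
  have hf := θ.f_ne_zero _ hz.1
  have hg' := θ'.g_ne_zero _ hz.2.1
  have hXu := AdmissibleAt.fderiv_space h hm
  obtain ⟨hTx, hTu⟩ := hz.fderiv_time hm
  have hbij := hz.2.2.2.1
  have hsymm : fderiv ℝ (fderiv ℝ φ) z (0, 1, 0) (0, 0, 1) =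
      fderiv ℝ (fderiv ℝ φ) z (0, 0, 1) (0, 1, 0) :=
    (hφ.of_le two_le_infty).isSymmSndFDerivAt (by simp) _ _
  have hXu2 : ∀ w, (fderiv ℝ (fderiv ℝ φ) z w (0, 0, 1)).2.1 = 0 := by
    intro w
    rw [(eventually_fderiv_apply hφ _ _).2.1]
    refine fderiv_eq_zero_of_eventually ?_ _
    filter_upwards [h.eventually_nhds] with y hy
    exact AdmissibleAt.fderiv_space hy hm
  have hexp : ∀ b : ℝ, fderiv ℝ (fderiv ℝ φ) z (0, 1, b) (0, 1, b) =
      fderiv ℝ (fderiv ℝ φ) z (0, 1, 0) (0, 1, 0) +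
      (2 * b) • fderiv ℝ (fderiv ℝ φ) z (0, 0, 1) (0, 1, 0) +
      b ^ 2 • fderiv ℝ (fderiv ℝ φ) z (0, 0, 1) (0, 0, 1) := by
    intro b
    have : ((0, 1, b) : Pt) = (0, 1, 0) + b • (0, 0, 1) := by simp
    rw [this]
    simp only [map_add, map_smul, add_apply, smul_apply, hsymm]
    module
  have hX2 : ∀ b : ℝ, (fderiv ℝ (fderiv ℝ φ) z (0, 1, b) (0, 1, b)).2.1 = Xxx := by
    intro b
    rw [hexp]
    simp [hXu2, ← hsymm, hXxx]
  set D := fderiv ℝ φ z with hD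
  have hXx0 : Xx ≠ 0 := by
    intro h0
    obtain ⟨w, hw⟩ := hbij.2 (0, 1, 0)
    have : w = w.1 • ((1, 0, 0) : Pt) + w.2.1 • ((0, 1, 0) : Pt) + w.2.2 • ((0, 0, 1) : Pt) := by
      simp
    rw [this, map_add, map_add, map_smul, map_smul, map_smul] at hw
    have i1 := congrArg Prod.fst hw
    have i2 := congrArg (fun p => p.2.1) hw
    simp only [Prod.snd_add, Prod.fst_add, Prod.smul_snd, Prod.smul_fst, smul_eq_mul, hTx, hTu,
      hXu, ← hXx, h0] at i1 i2
    have : w.1 = 0 := by simpa [hT] using i1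
    simp [this] at i2
  rw [← hTt] at hT
  have hXb : ∀ b : ℝ, (D (0, 1, b)).2.1 = Xx := by
    intro b
    rw [(map_jet_vectors _ 0 b).2]
    simp [hXu, hXx]
  have hU2 : ∀ b : ℝ, (fderiv ℝ (fderiv ℝ φ) z (0, 1, b) (0, 1, b)).2.2 =
      Uxx + 2 * b * Uxu + b ^ 2 * (fderiv ℝ (fderiv ℝ φ) z (0, 0, 1) (0, 0, 1)).2.2 := by
    intro b
    rw [hexp, hUxx, hUxu]
    simp
  set Uuu := (fderiv ℝ (fderiv ℝ φ) z (0, 0, 1) (0, 0, 1)).2.2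
  have hKu : (θ'.m < 0 → (φ z).2.2 ≠ 0) ∧ Uu ≠ 0 ∧ ∀ b c : ℝ,
      θ'.f (φ z).2.1 / Tt * (Ut + Uu * ((θ.g z.2.1 * c + deriv θ.g z.2.1 * b +
        θ.h z.2.1 * |z.2.2| ^ θ.m) / θ.f z.2.1) - (Ux + b * Uu) / Xx * Xt) =
      deriv θ'.g (φ z).2.1 * ((Ux + b * Uu) / Xx) + θ'.g (φ z).2.1 / Xx ^ 2 *
        (Uxx + 2 * b * Uxu + b ^ 2 * Uuu + c * Uu - (Ux + b * Uu) / Xx * Xxx) +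
        θ'.h (φ z).2.1 * |(φ z).2.2| ^ θ'.m := by
    have hall : ∀ b c : ℝ, (θ'.m < 0 → (φ z).2.2 ≠ 0) ∧ Uu ≠ 0 ∧
        θ'.f (φ z).2.1 / Tt * (Ut + Uu * ((θ.g z.2.1 * c + deriv θ.g z.2.1 * b +
        θ.h z.2.1 * |z.2.2| ^ θ.m) / θ.f z.2.1) - (Ux + b * Uu) / Xx * Xt) =
      deriv θ'.g (φ z).2.1 * ((Ux + b * Uu) / Xx) + θ'.g (φ z).2.1 / Xx ^ 2 *
        (Uxx + 2 * b * Uxu + b ^ 2 * Uuu + c * Uu - (Ux + b * Uu) / Xx * Xxx) +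
        θ'.h (φ z).2.1 * |(φ z).2.2| ^ θ'.m := by
      intro b c
      obtain ⟨p, q, hp, hq, htr, hne, h1⟩ := hK ((θ.g z.2.1 * c + deriv θ.g z.2.1 * b +
        θ.h z.2.1 * |z.2.2| ^ θ.m) / θ.f z.2.1) b c (by rwa [hXb]) (by field_simp)
      rw [(map_jet_vectors _ _ 0).1] at hp
      rw [hXb, (map_jet_vectors _ 0 b).2] at hq
      simp only [Prod.snd_add, Prod.fst_add, Prod.smul_snd, Prod.smul_fst, smul_eq_mul,
        ← hTt, ← hXt, ← hUt, ← hUu, ← hUx, hXu, mul_zero, add_zero, sub_zero] at hp hq htr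
      rw [hXb, hX2, hU2, hXu, ← hUu, mul_zero, add_zero] at h1
      have hq' : q = (Ux + b * Uu) / Xx := by field_simp; linarith
      have hp' : p = (Ut + Uu * ((θ.g z.2.1 * c + deriv θ.g z.2.1 * b +
        θ.h z.2.1 * |z.2.2| ^ θ.m) / θ.f z.2.1) - q * Xt) / Tt := by
        rw [eq_div_iff hT]; linarith
      refine ⟨hne, htr, ?_⟩
      rw [hp', hq'] at h1
      rw [← h1]
      ring
    exact ⟨(hall 0 0).1, (hall 0 0).2.1, fun b c => (hall b c).2.2⟩
  obtain ⟨hne, hUu0, hE⟩ := hKu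
  -- The identity is affine in `c` and quadratic in `b`. Its second difference in `b` gives `U_uu =
  -- 0`; then the first differences in `c` and `b` and the constant term give the three determining
  -- equations.
  have e00 := hE 0 0
  have e01 := hE 0 1
  have e10 := hE 1 0
  have e20 := hE (-1) 0
  have hUuu : Uuu = 0 := by
    have : θ'.g (φ z).2.1 / Xx ^ 2 * Uuu = 0 := by linear_combination e00 - (e10 + e20) / 2
    simpa [hg', hXx0] using this
  rw [hUuu] at e10
  refine ⟨hT, hXx0, hUu0, hUuu, ?_, ?_, ?_, hne⟩
  · refine mul_right_cancel₀ hUu0 ?_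
    rw [div_mul_eq_mul_div, ← sub_eq_zero]
    have : θ'.f (φ z).2.1 / Tt * (Uu * (θ.g z.2.1 / θ.f z.2.1)) = θ'.g (φ z).2.1 / Xx ^ 2 * Uu := by
      linear_combination e01 - e00
    rw [← this]
    field_simp
    ring
  · linear_combination e10 - e00
  · linear_combination e00

/-! ### Triangular form of admissible transformations on boxes -/

/-- The partial derivatives of a function of `(t, x)`. -/
noncomputable def dt (F : ℝ × ℝ → ℝ) (p : ℝ × ℝ) : ℝ := fderiv ℝ F p (1, 0)

noncomputable def dx (F : ℝ × ℝ → ℝ) (p : ℝ × ℝ) : ℝ := fderiv ℝ F p (0, 1)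

theorem fderiv_affine_fiber {ψ : Pt → ℝ} {A B : ℝ × ℝ → ℝ} {z : Pt}
    (hA : DifferentiableAt ℝ A (z.1, z.2.1)) (hB : DifferentiableAt ℝ B (z.1, z.2.1))
    (h : ∀ᶠ w in 𝓝 z, ψ w = A (w.1, w.2.1) * w.2.2 + B (w.1, w.2.1)) :
    fderiv ℝ ψ z (1, 0, 0) = dt A (z.1, z.2.1) * z.2.2 + dt B (z.1, z.2.1) ∧
    fderiv ℝ ψ z (0, 1, 0) = dx A (z.1, z.2.1) * z.2.2 + dx B (z.1, z.2.1) ∧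
    fderiv ℝ ψ z (0, 0, 1) = A (z.1, z.2.1) := by
  have hπ : HasFDerivAt (fun w : Pt => (w.1, w.2.1))
      ((ContinuousLinearMap.fst ℝ ℝ (ℝ × ℝ)).prod
        ((ContinuousLinearMap.fst ℝ ℝ ℝ).comp (ContinuousLinearMap.snd ℝ ℝ (ℝ × ℝ)))) z :=
    hasFDerivAt_fst.prodMk (hasFDerivAt_fst.comp z hasFDerivAt_snd)
  have hA' := HasFDerivAt.comp (g := A) z hA.hasFDerivAt hπ
  have hB' := HasFDerivAt.comp (g := B) z hB.hasFDerivAt hπ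
  have hu : HasFDerivAt (fun w : Pt => w.2.2)
    ((ContinuousLinearMap.snd ℝ ℝ ℝ).comp (ContinuousLinearMap.snd ℝ ℝ (ℝ × ℝ))) z :=
    hasFDerivAt_snd.comp z hasFDerivAt_snd
  have h1 := ((hA'.mul hu).add hB').congr_of_eventuallyEq h
  have h0 : ((0 : ℝ), (0 : ℝ)) = 0 := rfl
  rw [h1.fderiv]
  simp [dt, dx, mul_comm, h0]

theorem eq_of_fderiv_fiber_eq_zero {ψ : Pt → ℝ} {J I K : Set ℝ} (hK : IsOpen K)
    (hK' : IsPreconnected K) (hd : ∀ z ∈ J ×ˢ (I ×ˢ K), DifferentiableAt ℝ ψ z)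
    (h : ∀ z ∈ J ×ˢ (I ×ˢ K), fderiv ℝ ψ z (0, 0, 1) = 0) {t x u u' : ℝ} (ht : t ∈ J)
    (hx : x ∈ I) (hu : u ∈ K) (hu' : u' ∈ K) : ψ (t, x, u) = ψ (t, x, u') := by
  have hder : ∀ y ∈ K, HasDerivAt (fun y => ψ (t, x, y)) 0 y := by
    intro y hy
    have hz : ((t, x, y) : Pt) ∈ J ×ˢ (I ×ˢ K) := ⟨ht, hx, hy⟩
    have h1 := (hd _ hz).hasFDerivAt.comp_hasDerivAt y
      ((hasDerivAt_const y t).prodMk ((hasDerivAt_const y x).prodMk (hasDerivAt_id y)))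
    rw [h _ hz] at h1
    exact h1
  exact hK.is_const_of_deriv_eq_zero hK'
    (fun y hy => (hder y hy).differentiableAt.differentiableWithinAt)
    (fun y hy => (hder y hy).deriv) hu hu'

theorem eq_of_fderiv_space_eq_zero {ψ : Pt → ℝ} {J I K : Set ℝ} (hI : IsOpen I)
    (hI' : IsPreconnected I) (hd : ∀ z ∈ J ×ˢ (I ×ˢ K), DifferentiableAt ℝ ψ z)
    (h : ∀ z ∈ J ×ˢ (I ×ˢ K), fderiv ℝ ψ z (0, 1, 0) = 0) {t x x' u : ℝ} (ht : t ∈ J)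
    (hx : x ∈ I) (hx' : x' ∈ I) (hu : u ∈ K) : ψ (t, x, u) = ψ (t, x', u) := by
  have hder : ∀ y ∈ I, HasDerivAt (fun y => ψ (t, y, u)) 0 y := by
    intro y hy
    have hz : ((t, y, u) : Pt) ∈ J ×ˢ (I ×ˢ K) := ⟨ht, hy, hu⟩
    have h1 := (hd _ hz).hasFDerivAt.comp_hasDerivAt y
      ((hasDerivAt_const y t).prodMk ((hasDerivAt_id y).prodMk (hasDerivAt_const y u)))
    rw [h _ hz] at h1
    exact h1
  exact hI.is_const_of_deriv_eq_zero hI'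
    (fun y hy => (hder y hy).differentiableAt.differentiableWithinAt)
    (fun y hy => (hder y hy).deriv) hx hx'

theorem ContDiffOn.differentiableAt_of_isOpen {E F : Type*} [NormedAddCommGroup E]
    [NormedSpace ℝ E] [NormedAddCommGroup F] [NormedSpace ℝ F] {f : E → F} {s : Set E}
    (hf : ContDiffOn ℝ ∞ f s) (hs : IsOpen s) {x : E} (hx : x ∈ s) : DifferentiableAt ℝ f x :=
  (hf.contDiffAt (hs.mem_nhds hx)).differentiableAt (by simp)

theorem ContDiffOn.dx {F : ℝ × ℝ → ℝ} {s : Set (ℝ × ℝ)} (hF : ContDiffOn ℝ ∞ F s)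
    (hs : IsOpen s) : ContDiffOn ℝ ∞ (dx F) s :=
  (hF.fderiv_of_isOpen hs (m := ∞) (by simp)).clm_apply contDiffOn_const

/-- The data of a transformation `t' = T(t)`, `x' = X(t, x)`, `u' = A(t, x) u + B(t, x)` that maps
the equation `θ` to the equation `θ'`, together with the determining equations. -/
structure IsTriangular (θ θ' : ArbElt) (J I K : Set ℝ) (T : ℝ → ℝ) (X A B : ℝ × ℝ → ℝ) : Prop where
  isOpen_J : IsOpen J
  isOpen_I : IsOpen I
  isOpen_K : IsOpen K
  isPreconnected_J : IsPreconnected J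
  isPreconnected_I : IsPreconnected I
  subset_dom : I ⊆ θ.dom
  smooth_T : ContDiffOn ℝ ∞ T J
  smooth_X : ContDiffOn ℝ ∞ X (J ×ˢ I)
  smooth_A : ContDiffOn ℝ ∞ A (J ×ˢ I)
  smooth_B : ContDiffOn ℝ ∞ B (J ×ˢ I)
  mem_dom : ∀ p ∈ J ×ˢ I, X p ∈ θ'.dom
  T_ne : ∀ p ∈ J ×ˢ I, deriv T p.1 ≠ 0
  X_ne : ∀ p ∈ J ×ˢ I, dx X p ≠ 0
  A_ne : ∀ p ∈ J ×ˢ I, A p ≠ 0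
  eq_X : ∀ p ∈ J ×ˢ I,
    θ'.f (X p) * θ.g p.2 / (θ.f p.2 * deriv T p.1) = θ'.g (X p) / dx X p ^ 2
  eq_A : ∀ p ∈ J ×ˢ I,
    θ'.f (X p) / deriv T p.1 * (deriv θ.g p.2 * A p / θ.f p.2 - A p * dt X p / dx X p) =
      deriv θ'.g (X p) * A p / dx X p +
        θ'.g (X p) / dx X p ^ 2 * (2 * dx A p - A p * dx (dx X) p / dx X p)
  eq_U : ∀ p ∈ J ×ˢ I, ∀ u ∈ K,
    θ'.f (X p) / deriv T p.1 * (dt A p * u + dt B p + A p * θ.h p.2 * |u| ^ θ.m / θ.f p.2 -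
        (dx A p * u + dx B p) * dt X p / dx X p) =
      deriv θ'.g (X p) * (dx A p * u + dx B p) / dx X p +
        θ'.g (X p) / dx X p ^ 2 * (dx (dx A) p * u + dx (dx B) p -
          (dx A p * u + dx B p) * dx (dx X) p / dx X p) +
        θ'.h (X p) * |A p * u + B p| ^ θ'.m
  U_ne : ∀ p ∈ J ×ˢ I, ∀ u ∈ K, θ'.m < 0 → A p * u + B p ≠ 0

/-- Every admissible transformation is of triangular form. -/
theorem AdmissibleAt.exists_isTriangular {θ θ' : ArbElt} {φ : Pt → Pt} {J I K : Set ℝ}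
    (hJ : IsOpen J) (hI : IsOpen I) (hK : IsOpen K) (hJ' : IsPreconnected J)
    (hI' : IsPreconnected I) (hK' : IsPreconnected K) {x₀ u₀ : ℝ} (hx₀ : x₀ ∈ I) (hu₀ : u₀ ∈ K)
    (hJne : J.Nonempty) (hm : 0 ≤ θ.m)
    (h : ∀ z ∈ J ×ˢ (I ×ˢ K), AdmissibleAt θ θ' φ z) :
    ∃ (T : ℝ → ℝ) (X A B : ℝ × ℝ → ℝ), IsTriangular θ θ' J I K T X A B ∧
      ∀ z ∈ J ×ˢ (I ×ˢ K), φ z = (T z.1, X (z.1, z.2.1), A (z.1, z.2.1) * z.2.2 +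
        B (z.1, z.2.1)) := by
  have hopen : IsOpen (J ×ˢ (I ×ˢ K)) := hJ.prod (hI.prod hK)
  have hev : ∀ z ∈ J ×ˢ (I ×ˢ K), ∀ᶠ y in 𝓝 z, AdmissibleAt θ θ' φ y := fun z hz => by
    filter_upwards [hopen.mem_nhds hz] with y hy using h y hy
  have hd : ∀ z ∈ J ×ˢ (I ×ˢ K), DifferentiableAt ℝ φ z :=
    fun z hz => (h z hz).2.2.1.differentiableAt (by simp)
  have hd1 : ∀ z ∈ J ×ˢ (I ×ˢ K), DifferentiableAt ℝ (fun y => (φ y).1) z :=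
    fun z hz => (hd z hz).fst
  have hd2 : ∀ z ∈ J ×ˢ (I ×ˢ K), DifferentiableAt ℝ (fun y => (φ y).2.1) z :=
    fun z hz => (hd z hz).snd.fst
  have hd3 : ∀ z ∈ J ×ˢ (I ×ˢ K), DifferentiableAt ℝ (fun y => (φ y).2.2) z :=
    fun z hz => (hd z hz).snd.snd
  have hφ : ContDiffOn ℝ ∞ φ (J ×ˢ (I ×ˢ K)) := fun z hz => (h z hz).2.2.1.contDiffWithinAt
  have hφd : ContDiffOn ℝ ∞ (fun z => (fderiv ℝ φ z (0, 0, 1)).2.2) (J ×ˢ (I ×ˢ K)) :=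
    ((hφ.fderiv_of_isOpen hopen (m := ∞) (by simp)).clm_apply contDiffOn_const).snd.snd
  have hdu : ∀ z ∈ J ×ˢ (I ×ˢ K),
      DifferentiableAt ℝ (fun y => (fderiv ℝ φ y (0, 0, 1)).2.2) z :=
    fun z hz => hφd.differentiableAt_of_isOpen hopen hz
  -- The components are read off on the slice through `(x₀, u₀)`. The pointwise equations `T_x = T_u
  -- = X_u = U_uu = 0` and connectedness of the intervals then show that these slices describe `φ`
  -- on the whole box.
  set T : ℝ → ℝ := fun t => (φ (t, x₀, u₀)).1 with hT
  set X : ℝ × ℝ → ℝ := fun p => (φ (p.1, p.2, u₀)).2.1 with hX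
  set A : ℝ × ℝ → ℝ := fun p => (fderiv ℝ φ (p.1, p.2, u₀) (0, 0, 1)).2.2 with hA
  set B : ℝ × ℝ → ℝ := fun p => (φ (p.1, p.2, u₀)).2.2 - A p * u₀ with hB
  have hmaps : Set.MapsTo (fun p : ℝ × ℝ => ((p.1, p.2, u₀) : Pt)) (J ×ˢ I) (J ×ˢ (I ×ˢ K)) :=
    fun p hp => ⟨hp.1, hp.2, hu₀⟩
  have hcd : ContDiffOn ℝ ∞ (fun p : ℝ × ℝ => ((p.1, p.2, u₀) : Pt)) (J ×ˢ I) :=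
    (contDiff_fst.prodMk (contDiff_snd.prodMk contDiff_const)).contDiffOn
  have hTs : ContDiffOn ℝ ∞ T J := hφ.fst.comp
    (contDiff_id.prodMk (contDiff_const (c := ((x₀, u₀) : ℝ × ℝ)))).contDiffOn
    (fun t ht => ⟨ht, hx₀, hu₀⟩)
  have hXs : ContDiffOn ℝ ∞ X (J ×ˢ I) := hφ.snd.fst.comp hcd hmaps
  have hAs : ContDiffOn ℝ ∞ A (J ×ˢ I) := hφd.comp hcd hmaps
  have hBs : ContDiffOn ℝ ∞ B (J ×ˢ I) :=
    (hφ.snd.snd.comp hcd hmaps).sub (hAs.mul contDiffOn_const)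
  have hTeq : ∀ z ∈ J ×ˢ (I ×ˢ K), (φ z).1 = T z.1 := by
    rintro ⟨t, x, u⟩ ⟨ht, hx, hu⟩
    refine (eq_of_fderiv_space_eq_zero hI hI' hd1 (fun z hz => ?_) ht hx hx₀ hu).trans
      (eq_of_fderiv_fiber_eq_zero hK hK' hd1 (fun z hz => ?_) ht hx₀ hu hu₀)
    · rw [← (fderiv_components (hd z hz) _).1]
      exact ((h z hz).fderiv_time hm).1
    · rw [← (fderiv_components (hd z hz) _).1]
      exact ((h z hz).fderiv_time hm).2
  have hXeq : ∀ z ∈ J ×ˢ (I ×ˢ K), (φ z).2.1 = X (z.1, z.2.1) := by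
    rintro ⟨t, x, u⟩ ⟨ht, hx, hu⟩
    refine (eq_of_fderiv_fiber_eq_zero hK hK' hd2 (fun z hz => ?_) ht hx hu hu₀)
    rw [← (fderiv_components (hd z hz) _).2.1]
    exact AdmissibleAt.fderiv_space (hev z hz) hm
  have hAeq : ∀ z ∈ J ×ˢ (I ×ˢ K), (fderiv ℝ φ z (0, 0, 1)).2.2 = A (z.1, z.2.1) := by
    rintro ⟨t, x, u⟩ ⟨ht, hx, hu⟩
    refine (eq_of_fderiv_fiber_eq_zero hK hK' hdu (fun z hz => ?_) ht hx hu hu₀)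
    rw [← (eventually_fderiv_apply (h z hz).2.2.1 _ _).2.2]
    exact (AdmissibleAt.determining_equations (hev z hz) hm rfl rfl rfl rfl rfl rfl rfl rfl
      rfl).2.2.2.1
  have hUeq : ∀ z ∈ J ×ˢ (I ×ˢ K),
      (φ z).2.2 = A (z.1, z.2.1) * z.2.2 + B (z.1, z.2.1) := by
    rintro ⟨t, x, u⟩ ⟨ht, hx, hu⟩
    have hlin : ∀ z : Pt, HasFDerivAt (fun y : Pt => A (t, x) * y.2.2)
        (A (t, x) • ((ContinuousLinearMap.snd ℝ ℝ ℝ).comp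
          (ContinuousLinearMap.snd ℝ ℝ (ℝ × ℝ)))) z := fun z =>
      (hasFDerivAt_snd.comp z hasFDerivAt_snd).const_mul _
    have h1 := eq_of_fderiv_fiber_eq_zero (J := {t}) (I := {x})
      (ψ := fun y => (φ y).2.2 - A (t, x) * y.2.2) hK hK'
      (fun z hz => ?_) (fun z hz => ?_) rfl rfl hu hu₀
    · simp only [hB]
      simp only at h1
      linarith
    · have hz' : z ∈ J ×ˢ (I ×ˢ K) := by
        obtain ⟨h1, h2, h3⟩ := hz
        exact ⟨by rw [h1]; exact ht, by rw [h2]; exact hx, h3⟩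
      exact (hd3 z hz').sub (hlin z).differentiableAt
    · have hz' : z ∈ J ×ˢ (I ×ˢ K) := by
        obtain ⟨h1, h2, h3⟩ := hz
        exact ⟨by rw [h1]; exact ht, by rw [h2]; exact hx, h3⟩
      have h2 := ((hd3 z hz').hasFDerivAt.sub (hlin z)).fderiv
      have h3 : fderiv ℝ (fun y => (φ y).2.2 - A (t, x) * y.2.2) z = _ := h2
      have e : (z.1, z.2.1) = (t, x) := Prod.ext hz.1 hz.2.1
      rw [h3, sub_apply, ← (fderiv_components (hd z hz') _).2.2, hAeq z hz', e]
      simp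
  have hbase : IsOpen (J ×ˢ I) := hJ.prod hI
  have hTe : ∀ z ∈ J ×ˢ (I ×ˢ K), (fderiv ℝ φ z (1, 0, 0)).1 = deriv T z.1 := by
    intro z hz
    have h1 : (fun y => (φ y).1) =ᶠ[𝓝 z] fun y => T y.1 := by
      filter_upwards [hopen.mem_nhds hz] with y hy using hTeq y hy
    have h2 := HasFDerivAt.comp (g := T) z
      (hTs.differentiableAt_of_isOpen hJ hz.1).hasFDerivAt (hasFDerivAt_fst (E := ℝ) (F := ℝ × ℝ))
    rw [(fderiv_components (hd z hz) _).1, h1.fderiv_eq]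
    refine (congrArg (fun L => L ((1, 0, 0) : Pt)) h2.fderiv).trans ?_
    simp
  have hXe : ∀ z ∈ J ×ˢ (I ×ˢ K), (fderiv ℝ φ z (1, 0, 0)).2.1 = dt X (z.1, z.2.1) ∧
      (fderiv ℝ φ z (0, 1, 0)).2.1 = dx X (z.1, z.2.1) := by
    intro z hz
    have hzb : (z.1, z.2.1) ∈ J ×ˢ I := ⟨hz.1, hz.2.1⟩
    rw [(fderiv_components (hd z hz) _).2.1, (fderiv_components (hd z hz) _).2.1]
    have h1 := fderiv_affine_fiber (ψ := fun y => (φ y).2.1) (A := fun _ => 0) (B := X) (z := z)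
      (differentiableAt_const _) (hXs.differentiableAt_of_isOpen hbase hzb)
      (by filter_upwards [hopen.mem_nhds hz] with y hy; rw [hXeq y hy]; simp)
    rw [h1.1, h1.2.1]
    simp [dt, dx]
  have hUe : ∀ z ∈ J ×ˢ (I ×ˢ K),
      (fderiv ℝ φ z (1, 0, 0)).2.2 = dt A (z.1, z.2.1) * z.2.2 + dt B (z.1, z.2.1) ∧
      (fderiv ℝ φ z (0, 1, 0)).2.2 = dx A (z.1, z.2.1) * z.2.2 + dx B (z.1, z.2.1) := by
    intro z hz
    have hzb : (z.1, z.2.1) ∈ J ×ˢ I := ⟨hz.1, hz.2.1⟩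
    rw [(fderiv_components (hd z hz) _).2.2, (fderiv_components (hd z hz) _).2.2]
    have h1 := fderiv_affine_fiber (ψ := fun y => (φ y).2.2) (A := A) (B := B) (z := z)
      (hAs.differentiableAt_of_isOpen hbase hzb) (hBs.differentiableAt_of_isOpen hbase hzb)
      (by filter_upwards [hopen.mem_nhds hz] with y hy; rw [hUeq y hy])
    exact ⟨h1.1, h1.2.1⟩
  have hXxe : ∀ z ∈ J ×ˢ (I ×ˢ K), (fderiv ℝ (fderiv ℝ φ) z (0, 1, 0) (0, 1, 0)).2.1 =
      dx (dx X) (z.1, z.2.1) := by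
    intro z hz
    have hzb : (z.1, z.2.1) ∈ J ×ˢ I := ⟨hz.1, hz.2.1⟩
    rw [(eventually_fderiv_apply (h z hz).2.2.1 _ _).2.1]
    have h1 := fderiv_affine_fiber (ψ := fun y => (fderiv ℝ φ y (0, 1, 0)).2.1) (A := fun _ => 0)
      (B := dx X) (z := z)
      (differentiableAt_const _) ((hXs.dx hbase).differentiableAt_of_isOpen hbase hzb)
      (by filter_upwards [hopen.mem_nhds hz] with y hy; rw [(hXe y hy).2]; simp)
    rw [h1.2.1]
    simp [dx]
  have hUxe : ∀ z ∈ J ×ˢ (I ×ˢ K), (fderiv ℝ (fderiv ℝ φ) z (0, 1, 0) (0, 1, 0)).2.2 =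
      dx (dx A) (z.1, z.2.1) * z.2.2 + dx (dx B) (z.1, z.2.1) ∧
      (fderiv ℝ (fderiv ℝ φ) z (0, 0, 1) (0, 1, 0)).2.2 = dx A (z.1, z.2.1) := by
    intro z hz
    have hzb : (z.1, z.2.1) ∈ J ×ˢ I := ⟨hz.1, hz.2.1⟩
    rw [(eventually_fderiv_apply (h z hz).2.2.1 _ _).2.2,
      (eventually_fderiv_apply (h z hz).2.2.1 _ _).2.2]
    have h1 := fderiv_affine_fiber (ψ := fun y => (fderiv ℝ φ y (0, 1, 0)).2.2) (A := dx A)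
      (B := dx B) (z := z) ((hAs.dx hbase).differentiableAt_of_isOpen hbase hzb)
      ((hBs.dx hbase).differentiableAt_of_isOpen hbase hzb)
      (by filter_upwards [hopen.mem_nhds hz] with y hy; rw [(hUe y hy).2])
    exact ⟨h1.2.1, h1.2.2⟩
  have hdet : ∀ p ∈ J ×ˢ I, ∀ u ∈ K, _ := fun p hp u hu =>
    have hz : ((p.1, p.2, u) : Pt) ∈ J ×ˢ (I ×ˢ K) := ⟨hp.1, hp.2, hu⟩
    AdmissibleAt.determining_equations (hev _ hz) hm (hTe _ hz).symm (hXe _ hz).1.symm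
      (hXe _ hz).2.symm (hXxe _ hz).symm (hUe _ hz).1.symm (hUe _ hz).2.symm (hAeq _ hz).symm
      (hUxe _ hz).1.symm (hUxe _ hz).2.symm
  have hXeq' : ∀ p ∈ J ×ˢ I, ∀ u ∈ K, (φ (p.1, p.2, u)).2.1 = X p :=
    fun p hp u hu => hXeq (p.1, p.2, u) ⟨hp.1, hp.2, hu⟩
  have hUeq' : ∀ p ∈ J ×ˢ I, ∀ u ∈ K, (φ (p.1, p.2, u)).2.2 = A p * u + B p :=
    fun p hp u hu => hUeq (p.1, p.2, u) ⟨hp.1, hp.2, hu⟩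
  refine ⟨T, X, A, B, ⟨hJ, hI, hK, hJ', hI', ?_, hTs, hXs, hAs, hBs, ?_, ?_, ?_, ?_, ?_, ?_, ?_,
    ?_⟩, fun z hz => Prod.ext (hTeq z hz) (Prod.ext (hXeq z hz) (hUeq z hz))⟩
  · obtain ⟨t, ht⟩ := hJne
    intro x hx
    exact (h (t, x, u₀) ⟨ht, hx, hu₀⟩).1
  · intro p hp
    exact (h (p.1, p.2, u₀) ⟨hp.1, hp.2, hu₀⟩).2.1
  · exact fun p hp => (hdet p hp u₀ hu₀).1
  · exact fun p hp => (hdet p hp u₀ hu₀).2.1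
  · exact fun p hp => (hdet p hp u₀ hu₀).2.2.1
  · intro p hp
    have h1 := (hdet p hp u₀ hu₀).2.2.2.2.1
    rwa [hXeq' p hp u₀ hu₀] at h1
  · intro p hp
    have h1 := (hdet p hp u₀ hu₀).2.2.2.2.2.1
    rwa [hXeq' p hp u₀ hu₀] at h1
  · intro p hp u hu
    have h1 := (hdet p hp u hu).2.2.2.2.2.2.1
    rwa [hXeq' p hp u hu, hUeq' p hp u hu] at h1
  · intro p hp u hu
    have h1 := (hdet p hp u hu).2.2.2.2.2.2.2
    rwa [hUeq' p hp u hu] at h1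

/-! ### Splitting with respect to `u`, and the drift relation -/

theorem HasDerivAt.eq_of_eqOn {F G : ℝ → ℝ} {F' G' x : ℝ} {s : Set ℝ} (hs : s ∈ 𝓝 x)
    (hF : HasDerivAt F F' x) (hG : HasDerivAt G G' x) (h : Set.EqOn F G s) : F' = G' :=
  hF.unique (hG.congr_of_eventuallyEq (by filter_upwards [hs] with y hy using h hy))

/-- A power of an affine function is, up to affine functions, a power of the variable only in the
obvious cases. -/
theorem rpow_affine_rigidity {α β γ k A B m m' : ℝ} {K : Set ℝ} (hK : IsOpen K)
    (hKne : K.Nonempty) (hα : α ≠ 0) (hA : A ≠ 0) (hm0 : m ≠ 0) (hm1 : m ≠ 1)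
    (h : ∀ u ∈ K, α * |u| ^ m = β * u + γ + k * |A * u + B| ^ m') :
    m = m' ∧ (m = 2 ∨ B = 0) := by
  -- The powers are smooth only away from `u = 0` and `A u + B = 0`; an open nonempty set contains
  -- points avoiding these two values.
  obtain ⟨u₁, hu₁, hu₁'⟩ : ∃ u ∈ K, u ≠ 0 ∧ A * u + B ≠ 0 := by
    by_contra hcon
    push Not at hcon
    have hsub : K ⊆ {0, -B / A} := by
      intro u hu
      by_cases h0 : u = 0
      · simp [h0]
      · right
        have := hcon u hu h0
        simp only [Set.mem_singleton_iff]
        field_simp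
        linarith
    obtain ⟨u, hu⟩ := hKne
    have hinf : K.Infinite := infinite_of_mem_nhds u (hK.mem_nhds hu)
    exact hinf (Set.Finite.subset (by simp) hsub)
  set V : Set ℝ := K ∩ {u | u ≠ 0 ∧ A * u + B ≠ 0} with hV
  have hVo : IsOpen V := by
    refine hK.inter (IsOpen.inter isOpen_ne ?_)
    exact isOpen_ne.preimage (f := fun u => A * u + B) (by fun_prop)
  have hVu : u₁ ∈ V := ⟨hu₁, hu₁'⟩
  -- Since `Real.log` is even, `exp (r log u)` equals `|u|^r` for both signs of `u ≠ 0`, and its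
  -- derivatives have a single formula.
  set E : ℝ → ℝ → ℝ := fun r u => Real.exp (r * Real.log u) with hE
  have hEabs : ∀ r u : ℝ, u ≠ 0 → |u| ^ r = E r u := by
    intro r u hu
    rw [Real.rpow_def_of_pos (abs_pos.2 hu), Real.log_abs, mul_comm]
  have hEd : ∀ r u : ℝ, u ≠ 0 → HasDerivAt (E r) (r * (E r u / u)) u := by
    intro r u hu
    refine (((Real.hasDerivAt_log hu).const_mul r).exp).congr_deriv ?_
    simp only [hE]
    field_simp
  have hEd1 : ∀ r u : ℝ, u ≠ 0 → HasDerivAt (fun u => E r u / u) ((r - 1) * (E r u / u ^ 2)) u := by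
    intro r u hu
    refine ((hEd r u hu).div (hasDerivAt_id u) hu).congr_deriv ?_
    simp only [id]
    field_simp
  have hEd2 : ∀ r u : ℝ, u ≠ 0 →
      HasDerivAt (fun u => E r u / u ^ 2) ((r - 2) * (E r u / u ^ 3)) u := by
    intro r u hu
    refine ((hEd r u hu).div (hasDerivAt_pow 2 u) (by positivity)).congr_deriv ?_
    field_simp
    norm_num
    ring
  have haff : ∀ u : ℝ, HasDerivAt (fun u => A * u + B) A u := by
    intro u
    simpa using ((hasDerivAt_id u).const_mul A).add_const B
  have e0 : Set.EqOn (fun u => α * E m u) (fun u => β * u + γ + k * E m' (A * u + B)) V := by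
    rintro u ⟨hu, hu0, hu1⟩
    have := h u hu
    rwa [hEabs _ _ hu0, hEabs _ _ hu1] at this
  have e1 : Set.EqOn (fun u => α * (m * (E m u / u)))
      (fun u => β + k * (m' * (E m' (A * u + B) / (A * u + B)) * A)) V := by
    intro u hu
    refine HasDerivAt.eq_of_eqOn (hVo.mem_nhds hu) ((hEd m u hu.2.1).const_mul α) ?_ e0
    have h1 : HasDerivAt (fun u => β * u + γ) β u := by
      simpa using ((hasDerivAt_id u).const_mul β).add_const γ
    have h2 : HasDerivAt (fun u => E m' (A * u + B)) _ u :=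
      HasDerivAt.comp (h₂ := E m') u (hEd m' _ hu.2.2) (haff u)
    exact h1.add (h2.const_mul k)
  have e2 : Set.EqOn (fun u => α * m * (m - 1) * (E m u / u ^ 2))
      (fun u => k * m' * A ^ 2 * (m' - 1) * (E m' (A * u + B) / (A * u + B) ^ 2)) V := by
    intro u hu
    refine HasDerivAt.eq_of_eqOn (hVo.mem_nhds hu)
      ((((hEd1 m u hu.2.1).const_mul m).const_mul α).congr_deriv (by ring)) ?_ e1
    have h1 := (hEd1 m' _ hu.2.2).comp u (haff u)
    exact ((((h1.const_mul m').mul_const A).const_mul k).const_add β).congr_deriv (by ring)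
  have e3 : Set.EqOn (fun u => α * m * (m - 1) * ((m - 2) * (E m u / u ^ 3)))
      (fun u => k * m' * A ^ 2 * (m' - 1) *
        ((m' - 2) * (E m' (A * u + B) / (A * u + B) ^ 3) * A)) V := by
    intro u hu
    refine HasDerivAt.eq_of_eqOn (hVo.mem_nhds hu) ((hEd2 m u hu.2.1).const_mul _) ?_ e2
    exact (((hEd2 m' _ hu.2.2).comp u (haff u)).const_mul _)
  -- Two derivatives remove the affine part. Dividing the third derivative by the second one leaves
  -- `(m - 2)/u = (m' - 2) A/(A u + B)`; evaluation at two points then gives `m = m'` and `(m - 2) B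
  -- = 0`.
  have e4 : ∀ u ∈ V, (m - 2) * (A * u + B) = (m' - 2) * A * u := by
    intro u hu
    have h2 := e2 hu
    have h3 := e3 hu
    simp only at h2 h3
    have hu0 := hu.2.1
    have hu1 := hu.2.2
    have hne : α * m * (m - 1) * (E m u / u ^ 2) ≠ 0 := by
      have : E m u ≠ 0 := (Real.exp_pos _).ne'
      have := sub_ne_zero.2 hm1
      positivity
    have h4 : (α * m * (m - 1) * (E m u / u ^ 2)) * ((m - 2) / u) =
        (α * m * (m - 1) * (E m u / u ^ 2)) * ((m' - 2) * A / (A * u + B)) := by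
      conv_rhs => rw [h2]
      have l : (α * m * (m - 1) * (E m u / u ^ 2)) * ((m - 2) / u) =
        α * m * (m - 1) * ((m - 2) * (E m u / u ^ 3)) := by field_simp
      rw [l, h3]
      field_simp
    have h5 := mul_left_cancel₀ hne h4
    rw [div_eq_div_iff hu0 hu1] at h5
    exact h5
  obtain ⟨u₂, hu₂, hne⟩ : ∃ u₂ ∈ V, u₂ ≠ u₁ := by
    have hinf : V.Infinite := infinite_of_mem_nhds u₁ (hVo.mem_nhds hVu)
    exact hinf.nontrivial.exists_ne u₁
  have i1 := e4 u₁ hVu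
  have i2 := e4 u₂ hu₂
  have i3 : (m - m') * (A * (u₂ - u₁)) = 0 := by linear_combination i2 - i1
  have i4 : m = m' := by
    have : A * (u₂ - u₁) ≠ 0 := mul_ne_zero hA (sub_ne_zero.2 hne)
    simpa [this, sub_eq_zero] using i3
  refine ⟨i4, ?_⟩
  subst i4
  have i5 : (m - 2) * B = 0 := by linear_combination i1
  rcases mul_eq_zero.1 i5 with h | h
  · left; linarith
  · right; exact h

theorem quadratic_coeffs_eq_zero {a b c : ℝ} {K : Set ℝ} (hK : IsOpen K) (hKne : K.Nonempty)
    (h : ∀ u ∈ K, a * u ^ 2 + b * u + c = 0) : a = 0 ∧ b = 0 ∧ c = 0 := by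
  obtain ⟨u, hu⟩ := hKne
  obtain ⟨r, hr, hball⟩ := Metric.isOpen_iff.1 hK u hu
  have h0 := h u hu
  have h1 := h (u + r / 2) (hball (by simp [abs_of_pos hr]; linarith))
  have h2 := h (u - r / 2) (hball (by simp [abs_of_pos hr]; linarith))
  have ha : a = 0 := by
    have : a * r ^ 2 = 0 := by linear_combination 2 * h1 + 2 * h2 - 4 * h0
    simpa [hr.ne'] using this
  subst ha
  have hb : b = 0 := by
    have : b * r = 0 := by linear_combination h1 - h2
    simpa [hr.ne'] using this
  subst hb
  exact ⟨rfl, rfl, by linarith⟩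

section

variable {θ θ' : ArbElt} {J I K : Set ℝ} {T : ℝ → ℝ} {X A B : ℝ × ℝ → ℝ}

/-- At a fixed `(t, x)` the last determining equation says that `|u|^m` is an affine function of `u`
plus a multiple of a power of `|A u + B|`, so `rpow_affine_rigidity` applies. Only `m = 2` leaves
room for `B ≠ 0`. -/
theorem IsTriangular.power (h : IsTriangular θ θ' J I K T X A B) (hK : K.Nonempty)
    (hm0 : θ.m ≠ 0) (hm1 : θ.m ≠ 1) {p : ℝ × ℝ} (hp : p ∈ J ×ˢ I) :
    θ.m = θ'.m ∧ (θ.m = 2 ∨ B p = 0) := by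
  have hf := θ.f_ne_zero _ (h.subset_dom hp.2)
  have hh := θ.h_ne_zero _ (h.subset_dom hp.2)
  have hf' := θ'.f_ne_zero _ (h.mem_dom p hp)
  have hT := h.T_ne p hp
  have hA := h.A_ne p hp
  refine rpow_affine_rigidity h.isOpen_K hK
    (α := θ'.f (X p) / deriv T p.1 * (A p * θ.h p.2 / θ.f p.2))
    (β := deriv θ'.g (X p) * dx A p / dx X p + θ'.g (X p) / dx X p ^ 2 *
      (dx (dx A) p - dx A p * dx (dx X) p / dx X p) -
      θ'.f (X p) / deriv T p.1 * (dt A p - dx A p * dt X p / dx X p))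
    (γ := deriv θ'.g (X p) * dx B p / dx X p + θ'.g (X p) / dx X p ^ 2 *
      (dx (dx B) p - dx B p * dx (dx X) p / dx X p) -
      θ'.f (X p) / deriv T p.1 * (dt B p - dx B p * dt X p / dx X p)) (k := θ'.h (X p))
    (by positivity) hA hm0 hm1 (fun u hu => ?_)
  linear_combination h.eq_U p hp u hu

/-- For `m = 2` the last determining equation is a quadratic polynomial identity in `u`; the three
conclusions are its coefficients of `u^2`, `u` and `1`. -/
theorem IsTriangular.quadratic (h : IsTriangular θ θ' J I K T X A B) (hK : K.Nonempty)
    (hm : θ.m = 2) (hm' : θ'.m = 2) {p : ℝ × ℝ} (hp : p ∈ J ×ˢ I) :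
    θ'.f (X p) * θ.h p.2 = θ'.h (X p) * (θ.f p.2 * A p * deriv T p.1) ∧
    θ'.f (X p) / deriv T p.1 * (dt A p - dx A p * dt X p / dx X p) =
      deriv θ'.g (X p) * dx A p / dx X p + θ'.g (X p) / dx X p ^ 2 *
      (dx (dx A) p - dx A p * dx (dx X) p / dx X p) + 2 * θ'.h (X p) * A p * B p ∧
    θ'.f (X p) / deriv T p.1 * (dt B p - dx B p * dt X p / dx X p) =
      deriv θ'.g (X p) * dx B p / dx X p + θ'.g (X p) / dx X p ^ 2 *
      (dx (dx B) p - dx B p * dx (dx X) p / dx X p) + θ'.h (X p) * B p ^ 2 := by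
  have hf := θ.f_ne_zero _ (h.subset_dom hp.2)
  have hT := h.T_ne p hp
  have hA := h.A_ne p hp
  obtain ⟨e1, e2, e3⟩ := quadratic_coeffs_eq_zero h.isOpen_K hK
    (a := θ'.f (X p) / deriv T p.1 * (A p * θ.h p.2 / θ.f p.2) - θ'.h (X p) * A p ^ 2)
    (b := θ'.f (X p) / deriv T p.1 * (dt A p - dx A p * dt X p / dx X p) -
      (deriv θ'.g (X p) * dx A p / dx X p + θ'.g (X p) / dx X p ^ 2 *
      (dx (dx A) p - dx A p * dx (dx X) p / dx X p) + 2 * θ'.h (X p) * A p * B p))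
    (c := θ'.f (X p) / deriv T p.1 * (dt B p - dx B p * dt X p / dx X p) -
      (deriv θ'.g (X p) * dx B p / dx X p + θ'.g (X p) / dx X p ^ 2 *
      (dx (dx B) p - dx B p * dx (dx X) p / dx X p) + θ'.h (X p) * B p ^ 2))
    (fun u hu => by
      have h1 := h.eq_U p hp u hu
      rw [hm, hm', Real.rpow_two, Real.rpow_two, sq_abs, sq_abs] at h1
      linear_combination h1)
  refine ⟨?_, by linarith, by linarith⟩
  field_simp at e1
  exact mul_left_cancel₀ hA (by linear_combination e1)

theorem hasDerivAt_slice_snd {F : ℝ × ℝ → ℝ} {p : ℝ × ℝ} (hF : DifferentiableAt ℝ F p) :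
    HasDerivAt (fun y => F (p.1, y)) (dx F p) p.2 :=
  HasFDerivAt.comp_hasDerivAt (f := fun y : ℝ => (p.1, y)) p.2 hF.hasFDerivAt
    ((hasDerivAt_const p.2 p.1).prodMk (hasDerivAt_id p.2))

theorem hasDerivAt_slice_fst {F : ℝ × ℝ → ℝ} {p : ℝ × ℝ} (hF : DifferentiableAt ℝ F p) :
    HasDerivAt (fun s => F (s, p.2)) (dt F p) p.1 :=
  HasFDerivAt.comp_hasDerivAt (f := fun s : ℝ => (s, p.2)) p.1 hF.hasFDerivAt
    ((hasDerivAt_id p.1).prodMk (hasDerivAt_const p.1 p.2))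

/-- The logarithmic derivative that is transformed by `x' = X(t, x)` up to the drift term. -/
noncomputable def ArbElt.logInvariant (θ : ArbElt) (x : ℝ) : ℝ :=
  2 * (deriv θ.h x / θ.h x) - 5 / 2 * (deriv θ.f x / θ.f x) - 1 / 2 * (deriv θ.g x / θ.g x)

/-- The logarithmic `x`-derivatives of `eq_X` and of the `u^2`-coefficient, together with `eq_A`,
are three linear relations among the logarithmic derivatives of the coefficients, `A_x/A`,
`X_xx/X_x` and `X_t/X_x`. Eliminating the first two transformation unknowns leaves this relation,
whose weights dictate the numbers in `logInvariant`. -/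
theorem IsTriangular.drift (h : IsTriangular θ θ' J I K T X A B) (hK : K.Nonempty)
    (hm : θ.m = 2) (hm' : θ'.m = 2) {p : ℝ × ℝ} (hp : p ∈ J ×ˢ I) :
    -(dt X p / dx X p) * (θ.f p.2 / θ.g p.2) =
      θ.logInvariant p.2 - dx X p * θ'.logInvariant (X p) := by
  have hbase : IsOpen (J ×ˢ I) := h.isOpen_J.prod h.isOpen_I
  have hx := h.subset_dom hp.2
  have hX := h.mem_dom p hp
  have hf := θ.f_ne_zero _ hx
  have hg := θ.g_ne_zero _ hx
  have hh := θ.h_ne_zero _ hx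
  have hf' := θ'.f_ne_zero _ hX
  have hg' := θ'.g_ne_zero _ hX
  have hh' := θ'.h_ne_zero _ hX
  have hT := h.T_ne p hp
  have hA := h.A_ne p hp
  have hXx := h.X_ne p hp
  have dX := hasDerivAt_slice_snd (h.smooth_X.differentiableAt_of_isOpen hbase hp)
  have dXx := hasDerivAt_slice_snd ((h.smooth_X.dx hbase).differentiableAt_of_isOpen hbase hp)
  have dA := hasDerivAt_slice_snd (h.smooth_A.differentiableAt_of_isOpen hbase hp)
  have df := (θ.differentiableAt_f hx).hasDerivAt
  have dg := (θ.differentiableAt_g hx).hasDerivAt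
  have dh := (θ.differentiableAt_h hx).hasDerivAt
  have df' := HasDerivAt.comp p.2 (h₂ := θ'.f) (θ'.differentiableAt_f hX).hasDerivAt dX
  have dg' := HasDerivAt.comp p.2 (h₂ := θ'.g) (θ'.differentiableAt_g hX).hasDerivAt dX
  have dh' := HasDerivAt.comp p.2 (h₂ := θ'.h) (θ'.differentiableAt_h hX).hasDerivAt dX
  have q1 := fun (y : ℝ) (hy : y ∈ I) => h.eq_X (p.1, y) ⟨hp.1, hy⟩
  have q1' : ∀ y ∈ I, θ'.f (X (p.1, y)) * θ.g y * dx X (p.1, y) ^ 2 =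
      θ'.g (X (p.1, y)) * θ.f y * deriv T p.1 := by
    intro y hy
    have i1 := q1 y hy
    have i2 := h.X_ne (p.1, y) ⟨hp.1, hy⟩
    have i3 := θ.f_ne_zero _ (h.subset_dom hy)
    simp only at i1
    field_simp at i1
    linarith
  have d1 := HasDerivAt.eq_of_eqOn (h.isOpen_I.mem_nhds hp.2)
    ((df'.mul dg).mul (dXx.pow 2)) ((dg'.mul df).mul_const (deriv T p.1)) q1'
  have d2 := HasDerivAt.eq_of_eqOn (h.isOpen_I.mem_nhds hp.2)
    (df'.mul dh) (dh'.mul ((df.mul dA).mul_const (deriv T p.1)))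
    (fun y hy => (h.quadratic hK hm hm' (p := (p.1, y)) ⟨hp.1, hy⟩).1)
  have r1 := q1' p.2 hp.2
  have r2 := (h.quadratic hK hm hm' hp).1
  have r3 := h.eq_A p hp
  have r4 := h.eq_X p hp
  simp only [Function.comp_apply, Prod.mk.eta, Pi.mul_apply, Pi.pow_apply] at d1 d2 r1
  have k1 : deriv θ'.f (X p) / θ'.f (X p) * dx X p + deriv θ.g p.2 / θ.g p.2 +
      2 * (dx (dx X) p / dx X p) =
      deriv θ'.g (X p) / θ'.g (X p) * dx X p + deriv θ.f p.2 / θ.f p.2 := by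
    have hM : θ'.f (X p) * θ.g p.2 * dx X p ^ 2 ≠ 0 := by positivity
    refine mul_left_cancel₀ hM ?_
    conv_rhs => rw [r1]
    field_simp
    norm_num at d1
    linear_combination d1
  have k2 : deriv θ'.f (X p) / θ'.f (X p) * dx X p + deriv θ.h p.2 / θ.h p.2 =
      deriv θ'.h (X p) / θ'.h (X p) * dx X p + deriv θ.f p.2 / θ.f p.2 + dx A p / A p := by
    have hM : θ'.f (X p) * θ.h p.2 ≠ 0 := by positivity
    refine mul_left_cancel₀ hM ?_
    conv_rhs => rw [r2]
    field_simp
    linear_combination d2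
  have k3 : deriv θ.g p.2 / θ.g p.2 - dt X p / dx X p * (θ.f p.2 / θ.g p.2) =
      deriv θ'.g (X p) / θ'.g (X p) * dx X p + 2 * (dx A p / A p) - dx (dx X) p / dx X p := by
    have hM : A p * (θ'.f (X p) * θ.g p.2 / (θ.f p.2 * deriv T p.1)) ≠ 0 := by positivity
    refine mul_left_cancel₀ hM ?_
    conv_rhs => rw [r4]
    have l1 : A p * (θ'.f (X p) * θ.g p.2 / (θ.f p.2 * deriv T p.1)) *
        (deriv θ.g p.2 / θ.g p.2 - dt X p / dx X p * (θ.f p.2 / θ.g p.2)) =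
        θ'.f (X p) / deriv T p.1 * (deriv θ.g p.2 * A p / θ.f p.2 - A p * dt X p / dx X p) := by
      field_simp
    rw [l1, r3]
    field_simp
    ring
  unfold ArbElt.logInvariant
  -- The unique combination in which both `A_x/A` and `X_xx/X_x` cancel.
  linear_combination k3 - k1 / 2 - 2 * k2

end

/-! ### The straightened coordinate and transformations with `X_t ≠ 0` -/

/-- A smooth function on an open interval has a smooth primitive. -/
theorem exists_smooth_primitive {s : Set ℝ} (hs : IsOpen s) (hs' : s.OrdConnected)
    (hne : s.Nonempty) {f : ℝ → ℝ} (hf : ContDiffOn ℝ ∞ f s) :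
    ∃ F : ℝ → ℝ, ContDiffOn ℝ ∞ F s ∧ ∀ x ∈ s, HasDerivAt F (f x) x := by
  obtain ⟨a, ha⟩ := hne
  have hder : ∀ x ∈ s, HasDerivAt (fun u => ∫ y in a..u, f y) (f x) x := by
    intro x hx
    refine intervalIntegral.integral_hasDerivAt_right ?_ ?_ ?_
    · refine ContinuousOn.intervalIntegrable (hf.continuousOn.mono ?_)
      exact hs'.uIcc_subset ha hx
    · exact hf.continuousOn.stronglyMeasurableAtFilter hs x hx
    · exact hf.continuousOn.continuousAt (hs.mem_nhds hx)
  refine ⟨_, (contDiffOn_infty_iff_deriv_of_isOpen hs).2 ⟨fun x hx =>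
    (hder x hx).differentiableAt.differentiableWithinAt, hf.congr fun x hx => (hder x hx).deriv⟩,
    hder⟩

/-- The derivative of the coordinate in which the principal part is `∂_t ∓ ∂_x²`. -/
noncomputable def ArbElt.speed (θ : ArbElt) (x : ℝ) : ℝ := √|θ.f x / θ.g x|

theorem ArbElt.div_ne_zero (θ : ArbElt) {x : ℝ} (hx : x ∈ θ.dom) : θ.f x / θ.g x ≠ 0 :=
  _root_.div_ne_zero (θ.f_ne_zero x hx) (θ.g_ne_zero x hx)

theorem ArbElt.contDiffOn_div (θ : ArbElt) :
    ContDiffOn ℝ ∞ (fun x => θ.f x / θ.g x) θ.dom :=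
  θ.smooth_f.div θ.smooth_g θ.g_ne_zero

theorem ArbElt.speed_pos (θ : ArbElt) {x : ℝ} (hx : x ∈ θ.dom) : 0 < θ.speed x :=
  Real.sqrt_pos.2 (abs_pos.2 (θ.div_ne_zero hx))

theorem ArbElt.speed_sq (θ : ArbElt) (x : ℝ) : θ.speed x ^ 2 = |θ.f x / θ.g x| :=
  Real.sq_sqrt (abs_nonneg _)

theorem ArbElt.contDiffOn_speed (θ : ArbElt) : ContDiffOn ℝ ∞ θ.speed θ.dom := by
  intro x hx
  have h1 := (θ.contDiffOn_div.contDiffAt (θ.isOpen_dom.mem_nhds hx)).abs (θ.div_ne_zero hx)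
  exact (h1.sqrt (abs_pos.2 (θ.div_ne_zero hx)).ne').contDiffWithinAt

theorem ArbElt.isPreconnected_dom (θ : ArbElt) : IsPreconnected θ.dom :=
  θ.ordConnected_dom.isPreconnected

theorem ArbElt.exists_coordinate (θ : ArbElt) :
    ∃ S : ℝ → ℝ, ContDiffOn ℝ ∞ S θ.dom ∧ ∀ x ∈ θ.dom, HasDerivAt S (θ.speed x) x :=
  exists_smooth_primitive θ.isOpen_dom θ.ordConnected_dom θ.nonempty_dom θ.contDiffOn_speed

/-- A continuous nonvanishing function on an interval has constant sign, so `e` is `1` or `-1`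
throughout. -/
theorem ArbElt.exists_sign (θ : ArbElt) :
    ∃ e : ℝ, ∀ x ∈ θ.dom, θ.f x / θ.g x = e * θ.speed x ^ 2 := by
  rcases θ.isPreconnected_dom.eq_or_eq_neg_of_sq_eq (f := fun x => θ.f x / θ.g x)
    (g := fun x => θ.speed x ^ 2) θ.contDiffOn_div.continuousOn
    (θ.contDiffOn_speed.pow 2).continuousOn
    (fun x _ => by simp only [Pi.pow_apply, θ.speed_sq, sq_abs])
    (fun {x} hx => (pow_pos (θ.speed_pos hx) 2).ne') with h | h
  · exact ⟨1, fun x hx => by rw [one_mul]; exact h hx⟩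
  · exact ⟨-1, fun x hx => by rw [neg_one_mul]; exact h hx⟩

theorem ArbElt.contDiffOn_logInvariant (θ : ArbElt) : ContDiffOn ℝ ∞ θ.logInvariant θ.dom := by
  have h1 := (θ.smooth_f.deriv_of_isOpen θ.isOpen_dom (m := ∞) (by simp)).div θ.smooth_f θ.f_ne_zero
  have h2 := (θ.smooth_g.deriv_of_isOpen θ.isOpen_dom (m := ∞) (by simp)).div θ.smooth_g θ.g_ne_zero
  have h3 := (θ.smooth_h.deriv_of_isOpen θ.isOpen_dom (m := ∞) (by simp)).div θ.smooth_h θ.h_ne_zero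
  exact ((contDiffOn_const.mul h3).sub (contDiffOn_const.mul h1)).sub (contDiffOn_const.mul h2)

section

variable {θ θ' : ArbElt} {J I K : Set ℝ} {T : ℝ → ℝ} {X A B : ℝ × ℝ → ℝ}

/-- If `X` depends on `t` then the logarithmic invariant of `θ` in the coordinate `S` is a ratio of
polynomials of `S`. -/
theorem IsTriangular.rational_of_dt_ne_zero (h : IsTriangular θ θ' J I K T X A B)
    (hK : K.Nonempty) (hm : θ.m = 2) (hm' : θ'.m = 2) {S : ℝ → ℝ}
    (hS : ∀ x ∈ θ.dom, HasDerivAt S (θ.speed x) x) {p₀ : ℝ × ℝ} (hp₀ : p₀ ∈ J ×ˢ I)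
    (hne : dt X p₀ ≠ 0) :
    ∃ α β c₂ c₁ c₀ : ℝ, (α ≠ 0 ∨ β ≠ 0) ∧ ∀ x ∈ I,
      (α * S x + β) * (θ.logInvariant x / θ.speed x) = c₂ * S x ^ 2 + c₁ * S x + c₀ := by
  have hbase : IsOpen (J ×ˢ I) := h.isOpen_J.prod h.isOpen_I
  obtain ⟨t₀, x₀⟩ := p₀
  have ht₀ : t₀ ∈ J := hp₀.1
  have hx₀ : x₀ ∈ I := hp₀.2
  obtain ⟨S', hS's, hS'⟩ := θ'.exists_coordinate
  obtain ⟨e, he⟩ := θ.exists_sign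
  have dX : ∀ p ∈ J ×ˢ I, DifferentiableAt ℝ X p :=
    fun p hp => h.smooth_X.differentiableAt_of_isOpen hbase hp
  -- the scaling factor
  set μ : ℝ → ℝ → ℝ := fun t x => θ'.speed (X (t, x)) * dx X (t, x) / θ.speed x with hμ
  have hμne : ∀ t ∈ J, ∀ x ∈ I, μ t x ≠ 0 := fun t ht x hx =>
    _root_.div_ne_zero (mul_ne_zero (θ'.speed_pos (h.mem_dom _ ⟨ht, hx⟩)).ne' (h.X_ne _ ⟨ht, hx⟩))
      (θ.speed_pos (h.subset_dom hx)).ne'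
  have hspeedX : ContDiffOn ℝ ∞ (fun p => θ'.speed (X p)) (J ×ˢ I) :=
    θ'.contDiffOn_speed.comp h.smooth_X h.mem_dom
  have hμs : ContDiffOn ℝ ∞ (fun p : ℝ × ℝ => μ p.1 p.2) (J ×ˢ I) :=
    (hspeedX.mul (h.smooth_X.dx hbase)).div
      (θ.contDiffOn_speed.comp contDiffOn_snd fun p hp => h.subset_dom hp.2)
      (fun p hp => (θ.speed_pos (h.subset_dom hp.2)).ne')
  have hμsq : ∀ t ∈ J, ∀ x ∈ I, μ t x ^ 2 = |deriv T t| := by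
    intro t ht x hx
    have h1 := h.eq_X (t, x) ⟨ht, hx⟩
    have i1 := θ.div_ne_zero (h.subset_dom hx)
    have i2 := h.X_ne (t, x) ⟨ht, hx⟩
    have i3 := θ'.g_ne_zero _ (h.mem_dom (t, x) ⟨ht, hx⟩)
    have i4 := θ.f_ne_zero _ (h.subset_dom hx)
    have i5 := θ.g_ne_zero _ (h.subset_dom hx)
    have i6 := h.T_ne (t, x) ⟨ht, hx⟩
    simp only at h1 i6
    have h2 : θ'.f (X (t, x)) / θ'.g (X (t, x)) * dx X (t, x) ^ 2 / (θ.f x / θ.g x) = deriv T t := by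
      field_simp at h1 ⊢
      linarith
    simp only [hμ]
    rw [div_pow, mul_pow, θ'.speed_sq, θ.speed_sq, ← h2]
    simp only [abs_div, abs_mul, abs_pow, sq_abs]
  -- By `eq_X`, `μ^2 = |T_t|` depends on `t` only, and `μ` has no zeros; hence `μ` is constant in
  -- `x`. Consequently the straightened image coordinate is the affine function `L(t) S + c(t)` of
  -- `S`.
  have hμx : ∀ t ∈ J, ∀ x ∈ I, ∀ x' ∈ I, μ t x = μ t x' := by
    intro t ht x hx x' hx'
    have hd : ∀ y ∈ I, HasDerivAt (μ t) (dx (fun p : ℝ × ℝ => μ p.1 p.2) (t, y)) y := fun y hy =>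
      hasDerivAt_slice_snd (p := (t, y)) (hμs.differentiableAt_of_isOpen hbase ⟨ht, hy⟩)
    refine h.isOpen_I.is_const_of_deriv_eq_zero h.isPreconnected_I
      (fun y hy => (hd y hy).differentiableAt.differentiableWithinAt) (fun y hy => ?_) hx hx'
    have h1 := HasDerivAt.eq_of_eqOn (h.isOpen_I.mem_nhds hy) ((hd y hy).pow 2)
      (hasDerivAt_const y |deriv T t|) (fun w hw => hμsq t ht w hw)
    rw [(hd y hy).deriv]
    simpa [hμne t ht y hy] using h1
  set L : ℝ → ℝ := fun t => μ t x₀ with hL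
  have hLs : ContDiffOn ℝ ∞ L J := hμs.comp
    (contDiff_id.prodMk contDiff_const).contDiffOn (fun t ht => ⟨ht, hx₀⟩)
  have hLne : ∀ t ∈ J, L t ≠ 0 := fun t ht => hμne t ht x₀ hx₀
  set c : ℝ → ℝ := fun t => S' (X (t, x₀)) - L t * S x₀ with hc
  have hcs : ContDiffOn ℝ ∞ c J :=
    (hS's.comp (h.smooth_X.comp (contDiff_id.prodMk contDiff_const).contDiffOn
      (fun t ht => ⟨ht, hx₀⟩)) (fun t ht => h.mem_dom (t, x₀) ⟨ht, hx₀⟩)).sub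
      (hLs.mul contDiffOn_const)
  have hYx : ∀ p ∈ J ×ˢ I, θ'.speed (X p) * dx X p = L p.1 * θ.speed p.2 := by
    intro p hp
    have i1 := (θ.speed_pos (h.subset_dom hp.2)).ne'
    have : L p.1 = μ p.1 p.2 := hμx p.1 hp.1 x₀ hx₀ p.2 hp.2
    rw [this]
    simp only [hμ, Prod.mk.eta]
    field_simp
  have hY : ∀ t ∈ J, ∀ x ∈ I, S' (X (t, x)) = L t * S x + c t := by
    intro t ht x hx
    have hd : ∀ y ∈ I, HasDerivAt (fun y => S' (X (t, y)) - L t * S y) 0 y := by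
      intro y hy
      have h1 := HasDerivAt.comp y (h₂ := S') (hS' _ (h.mem_dom (t, y) ⟨ht, hy⟩))
        (hasDerivAt_slice_snd (dX (t, y) ⟨ht, hy⟩))
      refine (h1.sub ((hS y (h.subset_dom hy)).const_mul (L t))).congr_deriv ?_
      rw [hYx (t, y) ⟨ht, hy⟩]
      simp
    have h2 := h.isOpen_I.is_const_of_deriv_eq_zero h.isPreconnected_I
      (fun y hy => (hd y hy).differentiableAt.differentiableWithinAt)
      (fun y hy => (hd y hy).deriv) hx hx₀
    simp only [hc]
    linarith
  have hLd : ∀ t ∈ J, HasDerivAt L (deriv L t) t :=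
    fun t ht => (hLs.differentiableAt_of_isOpen h.isOpen_J ht).hasDerivAt
  have hcd : ∀ t ∈ J, HasDerivAt c (deriv c t) t :=
    fun t ht => (hcs.differentiableAt_of_isOpen h.isOpen_J ht).hasDerivAt
  have hYt : ∀ p ∈ J ×ˢ I, θ'.speed (X p) * dt X p = deriv L p.1 * S p.2 + deriv c p.1 := by
    intro p hp
    have h1 := HasDerivAt.comp p.1 (h₂ := S') (hS' _ (h.mem_dom p hp))
      (hasDerivAt_slice_fst (dX p hp))
    exact HasDerivAt.eq_of_eqOn (h.isOpen_J.mem_nhds hp.1) h1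
      (((hLd p.1 hp.1).mul_const (S p.2)).add (hcd p.1 hp.1)) (fun t ht => hY t ht p.2 hp.2)
  -- the invariant
  set l : ℝ → ℝ := fun x => θ.logInvariant x / θ.speed x with hl
  set l' : ℝ → ℝ := fun x => θ'.logInvariant x / θ'.speed x with hl'
  have hl's : ContDiffOn ℝ ∞ l' θ'.dom :=
    θ'.contDiffOn_logInvariant.div θ'.contDiffOn_speed fun x hx => (θ'.speed_pos hx).ne'
  have hls : ContDiffOn ℝ ∞ l θ.dom :=
    θ.contDiffOn_logInvariant.div θ.contDiffOn_speed fun x hx => (θ.speed_pos hx).ne'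
  -- The drift relation in straightened coordinates: the dependence on `t` is explicit through `L`,
  -- `c` and their first derivatives.
  have hinv : ∀ p ∈ J ×ˢ I, l' (X p) =
      l p.2 / L p.1 + e * (deriv L p.1 / L p.1 ^ 2 * S p.2 + deriv c p.1 / L p.1 ^ 2) := by
    intro p hp
    have i1 := (θ.speed_pos (h.subset_dom hp.2)).ne'
    have i2 := (θ'.speed_pos (h.mem_dom p hp)).ne'
    have i3 := hLne p.1 hp.1
    have i4 := h.X_ne p hp
    have h1 := h.drift hK hm hm' hp
    rw [he p.2 (h.subset_dom hp.2)] at h1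
    have h2 : dt X p / dx X p = (deriv L p.1 * S p.2 + deriv c p.1) / (L p.1 * θ.speed p.2) := by
      rw [← hYt p hp, ← hYx p hp]
      field_simp
    have h3 : dx X p = L p.1 * θ.speed p.2 / θ'.speed (X p) := by
      rw [← hYx p hp]; field_simp
    rw [h2, h3] at h1
    simp only [hl, hl']
    field_simp at h1 ⊢
    linear_combination h1
  have hL2 : ContDiffOn ℝ ∞ (fun t => deriv L t / L t ^ 2) J :=
    (hLs.deriv_of_isOpen h.isOpen_J (m := ∞) (by simp)).div (hLs.pow 2)
      fun t ht => pow_ne_zero 2 (hLne t ht)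
  have hc2 : ContDiffOn ℝ ∞ (fun t => deriv c t / L t ^ 2) J :=
    (hcs.deriv_of_isOpen h.isOpen_J (m := ∞) (by simp)).div (hLs.pow 2)
      fun t ht => pow_ne_zero 2 (hLne t ht)
  set α := deriv L t₀ with hα
  set β := deriv c t₀ with hβ
  set a₂ := deriv (fun t => deriv L t / L t ^ 2) t₀ with ha₂
  set b₂ := deriv (fun t => deriv c t / L t ^ 2) t₀ with hb₂
  have hi := hLne t₀ ht₀
  have hode : ∀ x ∈ I, HasDerivAt (fun x => (α * S x + β) * l x)
      ((e * L t₀ ^ 2 * (a₂ * S x + b₂) - e * α / L t₀ * (α * S x + β)) * θ.speed x) x := by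
    intro x hx
    have hp : ((t₀, x) : ℝ × ℝ) ∈ J ×ˢ I := ⟨ht₀, hx⟩
    have hxd := h.subset_dom hx
    have i1 := (θ.speed_pos hxd).ne'
    have i2 := (θ'.speed_pos (h.mem_dom _ hp)).ne'
    have dl := (hls.differentiableAt_of_isOpen θ.isOpen_dom hxd).hasDerivAt
    have dl' := (hl's.differentiableAt_of_isOpen θ'.isOpen_dom (h.mem_dom _ hp)).hasDerivAt
    have dS := hS x hxd
    have h1 := HasDerivAt.comp t₀ (h₂ := l') dl' (hasDerivAt_slice_fst (dX _ hp))
    have h2 := HasDerivAt.comp x (h₂ := l') dl' (hasDerivAt_slice_snd (dX _ hp))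
    have dL2 := (hL2.differentiableAt_of_isOpen h.isOpen_J ht₀).hasDerivAt
    have dc2 := (hc2.differentiableAt_of_isOpen h.isOpen_J ht₀).hasDerivAt
    have e1 := HasDerivAt.eq_of_eqOn (h.isOpen_J.mem_nhds ht₀) h1
      ((((hasDerivAt_const t₀ (l x)).div (hLd t₀ ht₀) hi)).add
        (((dL2.mul_const (S x)).add dc2).const_mul e)) (fun t ht => hinv (t, x) ⟨ht, hx⟩)
    have e2 := HasDerivAt.eq_of_eqOn (h.isOpen_I.mem_nhds hx) h2
      ((dl.div_const (L t₀)).add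
        (((dS.const_mul (α / L t₀ ^ 2)).add_const (β / L t₀ ^ 2)).const_mul e))
      (fun y hy => hinv (t₀, y) ⟨ht₀, hy⟩)
    have e3 := hYx _ hp
    have e4 := hYt _ hp
    simp only [← hα, ← hβ, ← ha₂, ← hb₂] at e1 e2 e3 e4
    refine ((((dS.const_mul α).add_const β)).mul dl).congr_deriv ?_
    -- The unknown derivative of `l'` enters both the `t`- and the `x`-derivative of `hinv`.
    -- Multiplying these crosswise by the `x`- and `t`-derivatives of the straightened image
    -- coordinate eliminates it, leaving a first-order linear equation for `l` whose integral is
    -- quadratic in `S`.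
    have e5 : ((0 * L t₀ - l x * α) / L t₀ ^ 2 + e * (a₂ * S x + b₂)) * (L t₀ * θ.speed x) =
        (deriv l x / L t₀ + e * (α / L t₀ ^ 2 * θ.speed x)) * (α * S x + β) := by
      rw [← e3, ← e4, ← e1, ← e2]
      ring
    field_simp at e5 ⊢
    linear_combination -e5
  refine ⟨α, β, (e * L t₀ ^ 2 * a₂ - e * α / L t₀ * α) / 2,
    e * L t₀ ^ 2 * b₂ - e * α / L t₀ * β,
    (α * S x₀ + β) * l x₀ - (e * L t₀ ^ 2 * a₂ - e * α / L t₀ * α) / 2 * S x₀ ^ 2 -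
      (e * L t₀ ^ 2 * b₂ - e * α / L t₀ * β) * S x₀, ?_, ?_⟩
  · by_contra hcon
    push Not at hcon
    -- `α S + β` at `x₀` is a nonzero multiple of `X_t` there, so it cannot vanish identically.
    have h1 := hYt (t₀, x₀) hp₀
    have i2 := (θ'.speed_pos (h.mem_dom _ hp₀)).ne'
    simp only [← hα, ← hβ, hcon.1, hcon.2] at h1
    have : θ'.speed (X (t₀, x₀)) * dt X (t₀, x₀) ≠ 0 := mul_ne_zero i2 hne
    exact this (by simpa using h1)
  · intro x hx
    set c₂ := (e * L t₀ ^ 2 * a₂ - e * α / L t₀ * α) / 2 with hc₂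
    set c₁ := e * L t₀ ^ 2 * b₂ - e * α / L t₀ * β with hc₁
    have hd : ∀ y ∈ I, HasDerivAt (fun y => (α * S y + β) * l y - (c₂ * S y ^ 2 + c₁ * S y)) 0 y := by
      intro y hy
      have dS := hS y (h.subset_dom hy)
      refine ((hode y hy).sub (((dS.pow 2).const_mul c₂).add (dS.const_mul c₁))).congr_deriv ?_
      rw [hc₂, hc₁]
      simp
      ring
    have h2 := h.isOpen_I.is_const_of_deriv_eq_zero h.isPreconnected_I
      (fun y hy => (hd y hy).differentiableAt.differentiableWithinAt)
      (fun y hy => (hd y hy).deriv) hx hx₀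
    show (α * S x + β) * l x = _
    linarith

end

/-! ### The perturbation argument for `X_t = 0` -/

/-- The cube of radius `r` around `z`. -/
def cube (z : Pt) (r : ℝ) : Set Pt :=
  Metric.ball z.1 r ×ˢ (Metric.ball z.2.1 r ×ˢ Metric.ball z.2.2 r)

theorem exists_cube_of_eventually {P : ℝ × Pt → Prop} {ε₀ : ℝ} {z : Pt}
    (h : ∀ᶠ q in 𝓝 (ε₀, z), P q) :
    ∃ r > 0, ∀ ε ∈ Metric.ball ε₀ r, ∀ w ∈ cube z r, P (ε, w) := by
  obtain ⟨r, hr, hball⟩ := Metric.eventually_nhds_iff_ball.1 h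
  refine ⟨r, hr, fun ε hε w hw => hball _ ?_⟩
  rw [← ball_prod_same]
  refine ⟨hε, ?_⟩
  have : z = (z.1, z.2.1, z.2.2) := rfl
  rw [this, ← ball_prod_same, ← ball_prod_same]
  exact hw

theorem cube_mem_nhds (z : Pt) {r : ℝ} (hr : 0 < r) : cube z r ∈ 𝓝 z := by
  have : 𝓝 z = 𝓝 (z.1, z.2.1, z.2.2) := rfl
  rw [this, nhds_prod_eq, nhds_prod_eq]
  exact prod_mem_prod (Metric.ball_mem_nhds _ hr)
    (prod_mem_prod (Metric.ball_mem_nhds _ hr) (Metric.ball_mem_nhds _ hr))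

theorem exists_cube_subset {z : Pt} {s : Set Pt} (hs : s ∈ 𝓝 z) : ∃ r > 0, cube z r ⊆ s := by
  have h : ∀ᶠ q in 𝓝 ((0 : ℝ), z), q.2 ∈ s := continuousAt_snd.eventually hs
  obtain ⟨r, hr, h'⟩ := exists_cube_of_eventually h
  exact ⟨r, hr, fun w hw => h' 0 (Metric.mem_ball_self hr) w hw⟩

theorem isPreconnected_ball (x r : ℝ) : IsPreconnected (Metric.ball x r) :=
  (convex_ball x r).isPreconnected

/-- A polynomial with infinitely many roots is zero. Only the three top coefficients of this sextic
are needed: they come from the perturbation, the lower ones from the rational forms. -/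
theorem septic_coeffs_eq_zero {a₆ a₅ a₄ a₃ a₂ a₁ a₀ : ℝ} {s : Set ℝ} (hs : s.Infinite)
    (h : ∀ x ∈ s, a₆ * x ^ 6 + a₅ * x ^ 5 + a₄ * x ^ 4 + a₃ * x ^ 3 + a₂ * x ^ 2 + a₁ * x + a₀ = 0) :
    a₆ = 0 ∧ a₅ = 0 ∧ a₄ = 0 := by
  open Polynomial in
  set p : ℝ[X] := C a₆ * X ^ 6 + C a₅ * X ^ 5 + C a₄ * X ^ 4 + C a₃ * X ^ 3 + C a₂ * X ^ 2 +
    C a₁ * X + C a₀ with hp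
  have h0 : p = 0 := by
    refine Polynomial.eq_zero_of_infinite_isRoot p (hs.mono fun x hx => ?_)
    simp only [Set.mem_ofPred_eq, Polynomial.IsRoot, hp]
    simpa using h x hx
  refine ⟨?_, ?_, ?_⟩
  · simpa [hp, Polynomial.coeff_X, Polynomial.coeff_C, Polynomial.coeff_X_pow] using
      congrArg (fun q => Polynomial.coeff q 6) h0
  · simpa [hp, Polynomial.coeff_X, Polynomial.coeff_C, Polynomial.coeff_X_pow] using
      congrArg (fun q => Polynomial.coeff q 5) h0
  · simpa [hp, Polynomial.coeff_X, Polynomial.coeff_C, Polynomial.coeff_X_pow] using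
      congrArg (fun q => Polynomial.coeff q 4) h0

/-- The perturbation of `h` by the factor `exp (ε S ^ 5)`. -/
noncomputable def ArbElt.perturb (θ : ArbElt) (S : ℝ → ℝ) (hS : ContDiffOn ℝ ∞ S θ.dom) (ε : ℝ) :
    ArbElt :=
  { θ with
    h := fun x => θ.h x * Real.exp (ε * S x ^ 5)
    smooth_h := θ.smooth_h.mul (contDiffOn_const.mul (hS.pow 5)).exp
    h_ne_zero := fun x hx => mul_ne_zero (θ.h_ne_zero x hx) (Real.exp_pos _).ne' }

theorem ArbElt.perturb_zero (θ : ArbElt) (S : ℝ → ℝ) (hS : ContDiffOn ℝ ∞ S θ.dom) :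
    θ.perturb S hS 0 = θ := by
  cases θ
  simp [ArbElt.perturb]

theorem ArbElt.isSmoothFamily_perturb (θ : ArbElt) (S : ℝ → ℝ) (hS : ContDiffOn ℝ ∞ S θ.dom)
    {M : Set ℝ} (hM : θ.m ∈ M) : IsSmoothFamily M θ.dom (θ.perturb S hS) where
  dom_eq _ := rfl
  m_mem _ := hM
  smooth_f := θ.smooth_f.comp contDiffOn_snd fun _ hp => hp.2
  smooth_g := θ.smooth_g.comp contDiffOn_snd fun _ hp => hp.2
  smooth_h := (θ.smooth_h.comp contDiffOn_snd fun _ hp => hp.2).mul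
    (contDiffOn_fst.mul ((hS.comp contDiffOn_snd fun _ hp => hp.2).pow 5)).exp
  smooth_m := contDiff_const

/-- Only `h_x/h` changes, by `5 ε S^4 S_x`, and it has weight `2`; the coordinate speed involves
only `f` and `g`, so the same `S` serves the whole family. -/
theorem ArbElt.logInvariant_perturb (θ : ArbElt) {S : ℝ → ℝ} (hS : ContDiffOn ℝ ∞ S θ.dom)
    (hS' : ∀ x ∈ θ.dom, HasDerivAt S (θ.speed x) x) (ε : ℝ) {x : ℝ} (hx : x ∈ θ.dom) :
    (θ.perturb S hS ε).logInvariant x / (θ.perturb S hS ε).speed x =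
      θ.logInvariant x / θ.speed x + 10 * ε * S x ^ 4 := by
  have h1 := (θ.differentiableAt_h hx).hasDerivAt.mul (((hS' x hx).pow 5).const_mul ε).exp
  have h2 : deriv (θ.perturb S hS ε).h x = _ := h1.deriv
  have i1 := θ.h_ne_zero x hx
  have i2 := (θ.speed_pos hx).ne'
  have i3 := (Real.exp_pos (ε * S x ^ 5)).ne'
  have i4 : (θ.perturb S hS ε).h x = θ.h x * Real.exp (ε * S x ^ 5) := rfl
  have i5 : (θ.perturb S hS ε).speed x = θ.speed x := rfl
  have i6 : (θ.perturb S hS ε).f = θ.f := rfl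
  have i7 : (θ.perturb S hS ε).g = θ.g := rfl
  have i8 : deriv (θ.perturb S hS ε).h x / (θ.perturb S hS ε).h x =
      deriv θ.h x / θ.h x + 5 * ε * S x ^ 4 * θ.speed x := by
    rw [h2, i4]
    simp only [Pi.pow_apply]
    field_simp
    norm_num
    ring
  rw [i5]
  unfold ArbElt.logInvariant
  rw [i8, i6, i7]
  field_simp
  ring

/-- For two different values of the parameter of the family of perturbations, at most one of the
equations admits a transformation with `X` depending on `t`. -/
theorem IsTriangular.perturb_unique {θ θ₁ θ₂ : ArbElt} {J I K : Set ℝ} {S : ℝ → ℝ}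
    (hS : ContDiffOn ℝ ∞ S θ.dom) (hS' : ∀ x ∈ θ.dom, HasDerivAt S (θ.speed x) x)
    {ε₁ ε₂ : ℝ} (hε : ε₁ ≠ ε₂) {T₁ T₂ : ℝ → ℝ} {X₁ A₁ B₁ X₂ A₂ B₂ : ℝ × ℝ → ℝ} (hK : K.Nonempty)
    (hm : θ.m = 2) (hm₁ : θ₁.m = 2) (hm₂ : θ₂.m = 2)
    (h₁ : IsTriangular (θ.perturb S hS ε₁) θ₁ J I K T₁ X₁ A₁ B₁)
    (h₂ : IsTriangular (θ.perturb S hS ε₂) θ₂ J I K T₂ X₂ A₂ B₂) {p₁ p₂ : ℝ × ℝ}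
    (hp₁ : p₁ ∈ J ×ˢ I) (hp₂ : p₂ ∈ J ×ˢ I) (hne : dt X₁ p₁ ≠ 0) : dt X₂ p₂ = 0 := by
  by_contra hne₂
  obtain ⟨α, β, c₂, c₁, c₀, hαβ, e1⟩ := h₁.rational_of_dt_ne_zero hK hm hm₁ (S := S) hS' hp₁ hne
  obtain ⟨α', β', c₂', c₁', c₀', hαβ', e2⟩ :=
    h₂.rational_of_dt_ne_zero hK hm hm₂ (S := S) hS' hp₂ hne₂
  have hI : I ⊆ θ.dom := h₁.subset_dom
  have hinf : (S '' I).Infinite := by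
    refine Set.Infinite.image ?_ (infinite_of_mem_nhds p₁.2 (h₁.isOpen_I.mem_nhds hp₁.2))
    have hconv : Convex ℝ I := h₁.isPreconnected_I.ordConnected.convex
    refine (strictMonoOn_of_deriv_pos hconv (hS.continuousOn.mono hI) fun x hx => ?_).injOn
    have hx' := hI (interior_subset hx)
    rw [(hS' x hx').deriv]
    exact θ.speed_pos hx'
  have hε' : 10 * (ε₁ - ε₂) ≠ 0 := mul_ne_zero (by norm_num) (sub_ne_zero.2 hε)
  -- Cross-multiplication of the two rational forms gives `10 (ε₁ - ε₂) S^4 (α S + β)(α' S + β')`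
  -- plus a polynomial of degree at most three in `S`. The fifth power in the perturbation is what
  -- keeps the two parts in disjoint degrees.
  obtain ⟨k1, k2, k3⟩ := septic_coeffs_eq_zero hinf (a₆ := 10 * (ε₁ - ε₂) * (α * α'))
    (a₅ := 10 * (ε₁ - ε₂) * (α * β' + β * α')) (a₄ := 10 * (ε₁ - ε₂) * (β * β'))
    (a₃ := c₂' * α - c₂ * α') (a₂ := c₂' * β + c₁' * α - c₂ * β' - c₁ * α')
    (a₁ := c₁' * β + c₀' * α - c₁ * β' - c₀ * α') (a₀ := c₀' * β - c₀ * β') (by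
      rintro _ ⟨x, hx, rfl⟩
      have i1 := e1 x hx
      have i2 := e2 x hx
      rw [θ.logInvariant_perturb hS hS' _ (hI hx)] at i1 i2
      linear_combination (α' * S x + β') * i1 - (α * S x + β) * i2)
  have k1' : α * α' = 0 := by simpa [hε'] using k1
  have k2' : α * β' + β * α' = 0 := by simpa [hε'] using k2
  have k3' : β * β' = 0 := by simpa [hε'] using k3
  -- The product of the two affine polynomials vanishes, so one of them is zero, contrary to both
  -- being nontrivial.
  rcases mul_eq_zero.1 k1' with h | h <;> rcases mul_eq_zero.1 k3' with h' | h' <;>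
    subst h h' <;> simp_all

/-- In a generalized extended equivalence transformation of the class with `m = 2`, the point
transformations are of triangular form with `X` independent of `t`. -/
theorem IsGenExtTransformation.exists_isTriangular {θ : ArbElt} {z : Pt} {Φ : ArbElt → ArbElt}
    {φ : ArbElt → Pt → Pt} (h : IsGenExtTransformation {2} θ.dom z Φ φ) (hm : θ.m = 2) :
    (Φ θ).m = 2 ∧ ∃ r > 0, ∃ (T : ℝ → ℝ) (X A B : ℝ × ℝ → ℝ),
      IsTriangular θ (Φ θ) (Metric.ball z.1 r) (Metric.ball z.2.1 r) (Metric.ball z.2.2 r) T X A B ∧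
      (∀ w ∈ cube z r, φ θ w = (T w.1, X (w.1, w.2.1), A (w.1, w.2.1) * w.2.2 +
        B (w.1, w.2.1))) ∧
      ∀ p ∈ Metric.ball z.1 r ×ˢ Metric.ball z.2.1 r, dt X p = 0 := by
  have hm' : ∀ θ₁ : ArbElt, θ₁.dom = θ.dom → θ₁.m = 2 → (Φ θ₁).m = 2 :=
    fun θ₁ h1 h2 => h.m_mem θ₁ h1 h2
  refine ⟨hm' θ rfl hm, ?_⟩
  obtain ⟨S, hS, hS'⟩ := θ.exists_coordinate
  have hfam : IsSmoothFamily {2} θ.dom (θ.perturb S hS) := θ.isSmoothFamily_perturb S hS hm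
  obtain ⟨r, hr, hr'⟩ := exists_cube_of_eventually
    ((h.admissible _ hfam 0).and (h.continuous _ hfam 0))
  have hself : ∀ x : ℝ, x ∈ Metric.ball x r := fun x => Metric.mem_ball_self hr
  have htri := fun ε (hε : ε ∈ Metric.ball (0 : ℝ) r) =>
    AdmissibleAt.exists_isTriangular (θ := θ.perturb S hS ε)
      (θ' := Φ (θ.perturb S hS ε)) (φ := φ (θ.perturb S hS ε)) (J := Metric.ball z.1 r)
      (I := Metric.ball z.2.1 r)
      (K := Metric.ball z.2.2 r) Metric.isOpen_ball Metric.isOpen_ball Metric.isOpen_ball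
      (isPreconnected_ball _ _) (isPreconnected_ball _ _) (isPreconnected_ball _ _) (hself _)
      (hself _) ⟨_, hself _⟩ (by show 0 ≤ θ.m; rw [hm]; norm_num) fun w hw => (hr' ε hε w hw).1
  set good : ℝ → Prop := fun ε => ∀ t ∈ Metric.ball z.1 r, ∀ t' ∈ Metric.ball z.1 r,
    ∀ x ∈ Metric.ball z.2.1 r, ∀ u ∈ Metric.ball z.2.2 r,
    (φ (θ.perturb S hS ε) (t, x, u)).2.1 = (φ (θ.perturb S hS ε) (t', x, u)).2.1 with hgood
  have hgood_of : ∀ {ε : ℝ} {T : ℝ → ℝ} {X A B : ℝ × ℝ → ℝ}, IsTriangular (θ.perturb S hS ε)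
      (Φ (θ.perturb S hS ε)) (Metric.ball z.1 r) (Metric.ball z.2.1 r) (Metric.ball z.2.2 r)
      T X A B → (∀ w ∈ cube z r, φ (θ.perturb S hS ε) w =
        (T w.1, X (w.1, w.2.1), A (w.1, w.2.1) * w.2.2 + B (w.1, w.2.1))) →
      (∀ p ∈ Metric.ball z.1 r ×ˢ Metric.ball z.2.1 r, dt X p = 0) → good ε := by
    intro ε T X A B h1 h2 h3 t ht t' ht' x hx u hu
    rw [h2 (t, x, u) ⟨ht, hx, hu⟩, h2 (t', x, u) ⟨ht', hx, hu⟩]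
    have hbase : IsOpen (Metric.ball z.1 r ×ˢ Metric.ball z.2.1 r) :=
      Metric.isOpen_ball.prod Metric.isOpen_ball
    have hd : ∀ s ∈ Metric.ball z.1 r, HasDerivAt (fun s => X (s, x)) 0 s := by
      intro s hs
      have := hasDerivAt_slice_fst (h1.smooth_X.differentiableAt_of_isOpen hbase
        (show (s, x) ∈ _ from ⟨hs, hx⟩))
      rwa [h3 _ ⟨hs, hx⟩] at this
    exact Metric.isOpen_ball.is_const_of_deriv_eq_zero (isPreconnected_ball _ _)
      (fun s hs => (hd s hs).differentiableAt.differentiableWithinAt)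
      (fun s hs => (hd s hs).deriv) ht ht'
  have htwo : ∀ ε₁ ∈ Metric.ball (0 : ℝ) r, ∀ ε₂ ∈ Metric.ball (0 : ℝ) r, ε₁ ≠ ε₂ →
      ¬ good ε₁ → good ε₂ := by
    intro ε₁ hε₁ ε₂ hε₂ hne hbad
    obtain ⟨T₁, X₁, A₁, B₁, h1, h1'⟩ := htri ε₁ hε₁
    obtain ⟨T₂, X₂, A₂, B₂, h2, h2'⟩ := htri ε₂ hε₂
    have hex : ∃ p₁ ∈ Metric.ball z.1 r ×ˢ Metric.ball z.2.1 r, dt X₁ p₁ ≠ 0 := by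
      by_contra hcon
      push Not at hcon
      exact hbad (hgood_of h1 h1' hcon)
    obtain ⟨p₁, hp₁, hp₁'⟩ := hex
    exact hgood_of h2 h2' fun p₂ hp₂ => IsTriangular.perturb_unique hS hS' hne ⟨_, hself _⟩ hm
      (hm' (θ.perturb S hS ε₁) rfl hm) (hm' (θ.perturb S hS ε₂) rfl hm) h1 h2 hp₁ hp₂ hp₁'
  -- At most one parameter is bad. If a nonzero one is, a smaller punctured neighbourhood avoids it.
  have hev : ∀ᶠ ε in 𝓝[≠] (0 : ℝ), good ε := by
    have hball : ∀ᶠ ε in 𝓝[≠] (0 : ℝ), ε ∈ Metric.ball (0 : ℝ) r :=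
      nhdsWithin_le_nhds (Metric.ball_mem_nhds _ hr)
    by_cases hall : ∀ ε ∈ Metric.ball (0 : ℝ) r, ε ≠ 0 → good ε
    · filter_upwards [hball, self_mem_nhdsWithin] with ε h1 h2 using hall ε h1 h2
    · push Not at hall
      obtain ⟨ε', h1, h2, h3⟩ := hall
      have h4 : ∀ᶠ ε in 𝓝[≠] (0 : ℝ), ε ≠ ε' :=
        nhdsWithin_le_nhds (isOpen_ne.mem_nhds h2.symm)
      filter_upwards [hball, h4] with ε h5 h6 using htwo ε' h1 ε h5 h6.symm h3
  -- `good` is phrased as an equality of values of `φ` rather than through `X_t`, since only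
  -- continuity of `φ` in `ε` is available and equalities of values pass to the limit.
  have hzero : good 0 := by
    intro t ht t' ht' x hx u hu
    have hlim : ∀ w ∈ cube z r, Tendsto (fun ε => (φ (θ.perturb S hS ε) w).2.1) (𝓝[≠] 0)
        (𝓝 (φ (θ.perturb S hS 0) w).2.1) := by
      intro w hw
      have h1 := (hr' 0 (Metric.mem_ball_self hr) w hw).2
      have h2 : ContinuousAt (fun ε : ℝ => (ε, w)) 0 := by fun_prop
      have h3 : ContinuousAt (fun ε : ℝ => φ (θ.perturb S hS ε) w) 0 :=
        ContinuousAt.comp (f := fun ε : ℝ => (ε, w)) h1 h2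
      exact (h3.snd.fst.tendsto).mono_left nhdsWithin_le_nhds
    refine tendsto_nhds_unique_of_eventuallyEq (hlim (t, x, u) ⟨ht, hx, hu⟩)
      (hlim (t', x, u) ⟨ht', hx, hu⟩) ?_
    filter_upwards [hev] with ε hε using hε t ht t' ht' x hx u hu
  obtain ⟨T, X, A, B, h1, h2⟩ := htri 0 (Metric.mem_ball_self hr)
  simp only [hgood] at hzero
  rw [θ.perturb_zero] at h1 h2 hzero
  refine ⟨r, hr, T, X, A, B, h1, h2, fun p hp => ?_⟩
  have hbase : IsOpen (Metric.ball z.1 r ×ˢ Metric.ball z.2.1 r) :=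
    Metric.isOpen_ball.prod Metric.isOpen_ball
  have h3 := hasDerivAt_slice_fst (h1.smooth_X.differentiableAt_of_isOpen hbase hp)
  refine HasDerivAt.eq_of_eqOn (Metric.isOpen_ball.mem_nhds hp.1) h3
    (hasDerivAt_const p.1 (X p)) fun t ht => ?_
  have h4 := hzero t ht p.1 hp.1 p.2 hp.2 z.2.2 (hself _)
  rw [h2 (t, p.2, z.2.2) ⟨ht, hp.2, hself _⟩, h2 (p.1, p.2, z.2.2) ⟨hp.1, hp.2, hself _⟩] at h4
  exact h4

/-! ### The reduced system for `ψ` and `χ` -/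

/-- The explicit form of a transformation with the fourth-order equation for `ψ` replaced by the
equivalent system of second order for `ψ` and `χ`. -/
structure HasReducedForm (θ θ' : ArbElt) (φ : Pt → Pt) (D : Box) (δ₀ δ₁ δ₂ : ℝ) (ξ ψ χ : ℝ → ℝ) :
    Prop where
  m_eq : θ.m = 2
  m_eq' : θ'.m = 2
  subset_dom : D.I ⊆ θ.dom
  δ₀_ne : δ₀ ≠ 0
  δ₁_ne : δ₁ ≠ 0
  smooth_ξ : ContDiffOn ℝ ∞ ξ D.I
  ξ_ne : ∀ x ∈ D.I, deriv ξ x ≠ 0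
  smooth_ψ : ContDiffOn ℝ ∞ ψ D.I
  ψ_ne : ∀ x ∈ D.I, ψ x ≠ 0
  smooth_χ : ContDiffOn ℝ ∞ χ D.I
  eq_ψ : ∀ x ∈ D.I, HasDerivAt (fun y => θ.g y * deriv ψ y / ψ y ^ 2)
    (-(2 * θ.h x * χ x / ψ x ^ 2)) x
  eq_χ : ∀ x ∈ D.I, HasDerivAt (fun y => θ.g y * deriv χ y / ψ y ^ 2)
    (-(θ.h x * χ x ^ 2 / ψ x ^ 3)) x
  eq_φ : ∀ z ∈ D.pts, φ z = (δ₁ * z.1 + δ₂, ξ z.2.1, ψ z.2.1 * z.2.2 + χ z.2.1)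
  mem_dom : ∀ x ∈ D.I, ξ x ∈ θ'.dom
  eq_f : ∀ x ∈ D.I, θ'.f (ξ x) = δ₀ * δ₁ / (deriv ξ x * ψ x ^ 2) * θ.f x
  eq_g : ∀ x ∈ D.I, θ'.g (ξ x) = δ₀ * deriv ξ x / ψ x ^ 2 * θ.g x
  eq_h : ∀ x ∈ D.I, θ'.h (ξ x) = δ₀ / (deriv ξ x * ψ x ^ 3) * θ.h x

theorem deriv_eq_of_eqOn {F G : ℝ → ℝ} {I : Set ℝ} (hI : IsOpen I) (h : Set.EqOn F G I) :
    Set.EqOn (deriv F) (deriv G) I := fun x hx =>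
  Filter.EventuallyEq.deriv_eq (by filter_upwards [hI.mem_nhds hx] with y hy using h hy)

/-- The first equation of the system, solved for `χ`, is the stated formula for `χ`; inserted into
the second it becomes the fourth-order equation. -/
theorem HasReducedForm.hasExplicitForm {θ θ' : ArbElt} {φ : Pt → Pt} {D : Box} {δ₀ δ₁ δ₂ : ℝ}
    {ξ ψ χ : ℝ → ℝ} (h : HasReducedForm θ θ' φ D δ₀ δ₁ δ₂ ξ ψ χ) :
    HasExplicitForm θ θ' φ D := by
  have hQ : ∀ x ∈ D.I, Qexpr θ.g ψ x = -(2 * θ.h x * χ x / ψ x ^ 2) :=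
    fun x hx => (h.eq_ψ x hx).deriv
  refine ⟨h.m_eq, h.m_eq', h.subset_dom, δ₀, δ₁, δ₂, ξ, ψ, χ, mul_ne_zero h.δ₀_ne h.δ₁_ne,
    h.smooth_ξ, h.ξ_ne, h.smooth_ψ, h.ψ_ne, fun x hx => ?_, fun x hx => ?_, h.eq_φ,
    fun x hx => ⟨h.mem_dom x hx, h.eq_f x hx, h.eq_g x hx, h.eq_h x hx⟩⟩
  · have i1 := h.ψ_ne x hx
    have i2 := θ.h_ne_zero x (h.subset_dom hx)
    have e1 : Set.EqOn (fun w => ψ w ^ 2 / (2 * θ.h w) * Qexpr θ.g ψ w) (fun w => -χ w) D.I := by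
      intro w hw
      have j1 := h.ψ_ne w hw
      have j2 := θ.h_ne_zero w (h.subset_dom hw)
      simp only [hQ w hw]
      field_simp
    have e2 : Set.EqOn (fun y => θ.g y / ψ y ^ 2 *
        deriv (fun w => ψ w ^ 2 / (2 * θ.h w) * Qexpr θ.g ψ w) y)
        (fun y => -(θ.g y * deriv χ y / ψ y ^ 2)) D.I := by
      intro y hy
      simp only [deriv_eq_of_eqOn D.isOpen_I e1 hy, deriv.fun_neg]
      ring
    unfold FourthOrderODE
    rw [deriv_eq_of_eqOn D.isOpen_I e2 hx, (h.eq_χ x hx).fun_neg.deriv, hQ x hx]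
    field_simp
    ring
  · have i1 := h.ψ_ne x hx
    have i2 := θ.h_ne_zero x (h.subset_dom hx)
    rw [hQ x hx]
    field_simp

/-- The formula for `χ` both makes `χ` smooth and turns into the first equation of the system; the
fourth-order equation is then the second one with `-χ` in place of the inner expression. -/
theorem HasExplicitForm.exists_hasReducedForm {θ θ' : ArbElt} {φ : Pt → Pt} {D : Box}
    (h : HasExplicitForm θ θ' φ D) :
    ∃ (δ₀ δ₁ δ₂ : ℝ) (ξ ψ χ : ℝ → ℝ), HasReducedForm θ θ' φ D δ₀ δ₁ δ₂ ξ ψ χ := by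
  obtain ⟨hm, hm', hdom, δ₀, δ₁, δ₂, ξ, ψ, χ, hδ, hξ, hξ', hψ, hψ', hode, hχ, hφ, hθ'⟩ := h
  have hg := θ.smooth_g.mono hdom
  have hh := θ.smooth_h.mono hdom
  have hψd : ContDiffOn ℝ ∞ (fun y => θ.g y * deriv ψ y / ψ y ^ 2) D.I :=
    (hg.mul (hψ.deriv_of_isOpen D.isOpen_I (m := ∞) (by simp))).div (hψ.pow 2)
      fun x hx => pow_ne_zero 2 (hψ' x hx)
  have hQs : ContDiffOn ℝ ∞ (Qexpr θ.g ψ) D.I := hψd.deriv_of_isOpen D.isOpen_I (by simp)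
  have hχs : ContDiffOn ℝ ∞ χ D.I := by
    refine ContDiffOn.congr ?_ hχ
    exact (((hψ.pow 2).div (contDiffOn_const.mul hh) fun x hx =>
      mul_ne_zero two_ne_zero (θ.h_ne_zero x (hdom hx))).neg).mul hQs
  have hQ : ∀ x ∈ D.I, Qexpr θ.g ψ x = -(2 * θ.h x * χ x / ψ x ^ 2) := by
    intro x hx
    have i1 := hψ' x hx
    have i2 := θ.h_ne_zero x (hdom hx)
    rw [hχ x hx]
    field_simp
  refine ⟨δ₀, δ₁, δ₂, ξ, ψ, χ, hm, hm', hdom, left_ne_zero_of_mul hδ, right_ne_zero_of_mul hδ,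
    hξ, hξ', hψ, hψ', hχs, fun x hx => ?_, fun x hx => ?_, hφ, fun x hx => (hθ' x hx).1,
    fun x hx => (hθ' x hx).2.1, fun x hx => (hθ' x hx).2.2.1, fun x hx => (hθ' x hx).2.2.2⟩
  · rw [← hQ x hx]
    exact (hψd.differentiableAt_of_isOpen D.isOpen_I hx).hasDerivAt
  · have i1 := hψ' x hx
    have i2 := θ.h_ne_zero x (hdom hx)
    have e1 : Set.EqOn (fun w => ψ w ^ 2 / (2 * θ.h w) * Qexpr θ.g ψ w) (fun w => -χ w) D.I := by
      intro w hw
      simp only [hχ w hw]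
      ring
    have e2 : Set.EqOn (fun y => θ.g y * deriv χ y / ψ y ^ 2) (fun y => -(θ.g y / ψ y ^ 2 *
        deriv (fun w => ψ w ^ 2 / (2 * θ.h w) * Qexpr θ.g ψ w) y)) D.I := by
      intro y hy
      simp only [deriv_eq_of_eqOn D.isOpen_I e1 hy, deriv.fun_neg]
      ring
    have hχd : ContDiffOn ℝ ∞ (fun y => θ.g y * deriv χ y / ψ y ^ 2) D.I :=
      (hg.mul (hχs.deriv_of_isOpen D.isOpen_I (m := ∞) (by simp))).div (hψ.pow 2)
        fun x hx => pow_ne_zero 2 (hψ' x hx)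
    have e3 := (hχd.differentiableAt_of_isOpen D.isOpen_I hx).hasDerivAt
    have e4 : deriv (fun y => θ.g y * deriv χ y / ψ y ^ 2) x = -(θ.h x * χ x ^ 2 / ψ x ^ 3) := by
      rw [deriv_eq_of_eqOn D.isOpen_I e2 hx, deriv.fun_neg]
      have := hode x hx
      unfold FourthOrderODE at this
      rw [this, hQ x hx]
      field_simp
      ring
    rwa [e4] at e3

/-- The box of radius `r` around `z`. -/
def Box.cube (z : Pt) {r : ℝ} (hr : 0 < r) : Box where
  J := Metric.ball z.1 r
  I := Metric.ball z.2.1 r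
  K := Metric.ball z.2.2 r
  isOpen_J := Metric.isOpen_ball
  isOpen_I := Metric.isOpen_ball
  isOpen_K := Metric.isOpen_ball
  ordConnected_J := (convex_ball _ _).ordConnected
  ordConnected_I := (convex_ball _ _).ordConnected
  ordConnected_K := (convex_ball _ _).ordConnected
  nonempty_J := ⟨_, Metric.mem_ball_self hr⟩
  nonempty_I := ⟨_, Metric.mem_ball_self hr⟩
  nonempty_K := ⟨_, Metric.mem_ball_self hr⟩

theorem Box.self_mem_cube (z : Pt) {r : ℝ} (hr : 0 < r) : z ∈ (Box.cube z hr).pts :=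
  ⟨Metric.mem_ball_self hr, Metric.mem_ball_self hr, Metric.mem_ball_self hr⟩

theorem Box.isOpen_pts (D : Box) : IsOpen D.pts :=
  D.isOpen_J.prod (D.isOpen_I.prod D.isOpen_K)

theorem Box.isPreconnected_I (D : Box) : IsPreconnected D.I := D.ordConnected_I.isPreconnected

theorem Box.isPreconnected_J (D : Box) : IsPreconnected D.J := D.ordConnected_J.isPreconnected

/-- A triangular transformation with `X` independent of `t` is of the explicit form. -/
theorem IsTriangular.exists_hasReducedForm {θ θ' : ArbElt} {D : Box} {T : ℝ → ℝ}
    {X A B : ℝ × ℝ → ℝ} {φ : Pt → Pt} (h : IsTriangular θ θ' D.J D.I D.K T X A B) (hm : θ.m = 2)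
    (hm' : θ'.m = 2)
    (hφ : ∀ z ∈ D.pts, φ z = (T z.1, X (z.1, z.2.1), A (z.1, z.2.1) * z.2.2 + B (z.1, z.2.1)))
    (hX : ∀ p ∈ D.J ×ˢ D.I, dt X p = 0) :
    ∃ (δ₀ δ₁ δ₂ : ℝ) (ξ ψ χ : ℝ → ℝ), HasReducedForm θ θ' φ D δ₀ δ₁ δ₂ ξ ψ χ := by
  obtain ⟨t₀, ht₀⟩ := D.nonempty_J
  obtain ⟨x₀, hx₀⟩ := D.nonempty_I
  have hbase : IsOpen (D.J ×ˢ D.I) := D.isOpen_J.prod D.isOpen_I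
  have hslice : ∀ {F : ℝ × ℝ → ℝ}, ContDiffOn ℝ ∞ F (D.J ×ˢ D.I) →
      ContDiffOn ℝ ∞ (fun x => F (t₀, x)) D.I := fun hF =>
    hF.comp (contDiff_const.prodMk contDiff_id).contDiffOn fun x hx => ⟨ht₀, hx⟩
  -- derivatives of functions that do not depend on `t`
  have hdx : ∀ {F : ℝ × ℝ → ℝ}, ContDiffOn ℝ ∞ F (D.J ×ˢ D.I) →
      (∀ t ∈ D.J, ∀ x ∈ D.I, F (t, x) = F (t₀, x)) →
      (∀ t ∈ D.J, ∀ x ∈ D.I, dx F (t, x) = deriv (fun y => F (t₀, y)) x) ∧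
      ∀ t ∈ D.J, ∀ x ∈ D.I, dx (dx F) (t, x) = deriv (deriv fun y => F (t₀, y)) x := by
    intro F hF hc
    have h1 : ∀ t ∈ D.J, ∀ x ∈ D.I, dx F (t, x) = deriv (fun y => F (t₀, y)) x := by
      intro t ht x hx
      rw [← (hasDerivAt_slice_snd (hF.differentiableAt_of_isOpen hbase
        (show (t, x) ∈ _ from ⟨ht, hx⟩))).deriv]
      exact deriv_eq_of_eqOn D.isOpen_I (fun y hy => hc t ht y hy) hx
    refine ⟨h1, fun t ht x hx => ?_⟩
    rw [← (hasDerivAt_slice_snd ((hF.dx hbase).differentiableAt_of_isOpen hbase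
        (show (t, x) ∈ _ from ⟨ht, hx⟩))).deriv]
    exact deriv_eq_of_eqOn D.isOpen_I (fun y hy => h1 t ht y hy) hx
  have hdt : ∀ {F : ℝ × ℝ → ℝ}, ContDiffOn ℝ ∞ F (D.J ×ˢ D.I) →
      (∀ t ∈ D.J, ∀ x ∈ D.I, F (t, x) = F (t₀, x)) → ∀ t ∈ D.J, ∀ x ∈ D.I, dt F (t, x) = 0 := by
    intro F hF hc t ht x hx
    exact HasDerivAt.eq_of_eqOn (D.isOpen_J.mem_nhds ht) (hasDerivAt_slice_fst
      (hF.differentiableAt_of_isOpen hbase (show (t, x) ∈ _ from ⟨ht, hx⟩)))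
      (hasDerivAt_const t (F (t₀, x))) fun s hs => hc s hs x hx
  have hXc : ∀ t ∈ D.J, ∀ x ∈ D.I, X (t, x) = X (t₀, x) := by
    intro t ht x hx
    have hd : ∀ s ∈ D.J, HasDerivAt (fun s => X (s, x)) 0 s := by
      intro s hs
      have := hasDerivAt_slice_fst (h.smooth_X.differentiableAt_of_isOpen hbase
        (show (s, x) ∈ _ from ⟨hs, hx⟩))
      rwa [hX _ ⟨hs, hx⟩] at this
    exact D.isOpen_J.is_const_of_deriv_eq_zero D.isPreconnected_J
      (fun s hs => (hd s hs).differentiableAt.differentiableWithinAt)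
      (fun s hs => (hd s hs).deriv) ht ht₀
  obtain ⟨hXx, hXxx⟩ := hdx h.smooth_X hXc
  set ξ : ℝ → ℝ := fun x => X (t₀, x) with hξ
  set δ₁ := deriv T t₀ with hδ₁
  -- With `X` independent of `t`, everything in `eq_X` except `T_t` is independent of `t`.
  have hTc : ∀ t ∈ D.J, deriv T t = δ₁ := by
    intro t ht
    have e1 := h.eq_X (t, x₀) ⟨ht, hx₀⟩
    have e2 := h.eq_X (t₀, x₀) ⟨ht₀, hx₀⟩
    have i1 := h.T_ne (t, x₀) ⟨ht, hx₀⟩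
    have i2 := h.T_ne (t₀, x₀) ⟨ht₀, hx₀⟩
    have i3 := θ.f_ne_zero x₀ (h.subset_dom hx₀)
    have i4 := θ.g_ne_zero x₀ (h.subset_dom hx₀)
    have i5 := θ'.f_ne_zero _ (h.mem_dom (t₀, x₀) ⟨ht₀, hx₀⟩)
    rw [hXx t ht x₀ hx₀, hXc t ht x₀ hx₀, ← hXx t₀ ht₀ x₀ hx₀, ← e2] at e1
    simp only at e1 i1 i2
    field_simp at e1
    exact e1.symm
  have hT : ∀ t ∈ D.J, T t = δ₁ * t + (T t₀ - δ₁ * t₀) := by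
    intro t ht
    have hd : ∀ s ∈ D.J, HasDerivAt (fun s => T s - δ₁ * s) 0 s := by
      intro s hs
      have h1 := (h.smooth_T.differentiableAt_of_isOpen D.isOpen_J hs).hasDerivAt
      rw [hTc s hs] at h1
      refine (h1.sub ((hasDerivAt_id s).const_mul δ₁)).congr_deriv ?_
      simp
    have h1 := D.isOpen_J.is_const_of_deriv_eq_zero D.isPreconnected_J
      (fun s hs => (hd s hs).differentiableAt.differentiableWithinAt)
      (fun s hs => (hd s hs).deriv) ht ht₀
    linarith
  have hδ₁ne : δ₁ ≠ 0 := h.T_ne (t₀, x₀) ⟨ht₀, hx₀⟩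
  have hquad := fun t (ht : t ∈ D.J) x (hx : x ∈ D.I) =>
    h.quadratic D.nonempty_K hm hm' (p := (t, x)) ⟨ht, hx⟩
  -- The `u^2`-coefficient expresses `A` through `x`, `X` and `T_t`, hence without `t`.
  have hAc : ∀ t ∈ D.J, ∀ x ∈ D.I, A (t, x) = A (t₀, x) := by
    intro t ht x hx
    have e1 := (hquad t ht x hx).1
    have e2 := (hquad t₀ ht₀ x hx).1
    have i3 := θ.f_ne_zero x (h.subset_dom hx)
    have i5 := θ'.h_ne_zero _ (h.mem_dom (t₀, x) ⟨ht₀, hx⟩)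
    simp only at e1 e2
    rw [hXc t ht x hx, hTc t ht, e2] at e1
    have : θ'.h (X (t₀, x)) * θ.f x * δ₁ ≠ 0 := mul_ne_zero (mul_ne_zero i5 i3) hδ₁ne
    refine mul_left_cancel₀ this ?_
    linear_combination -e1
  obtain ⟨hAx, hAxx⟩ := hdx h.smooth_A hAc
  have hAt := hdt h.smooth_A hAc
  set ψ : ℝ → ℝ := fun x => A (t₀, x) with hψ
  have hBeq : ∀ t ∈ D.J, ∀ x ∈ D.I, deriv θ'.g (ξ x) * deriv ψ x / deriv ξ x +
      θ'.g (ξ x) / deriv ξ x ^ 2 * (deriv (deriv ψ) x - deriv ψ x * deriv (deriv ξ) x / deriv ξ x) +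
      2 * θ'.h (ξ x) * ψ x * B (t, x) = 0 := by
    intro t ht x hx
    have e1 := (hquad t ht x hx).2.1
    rw [hAt t ht x hx, hX (t, x) ⟨ht, hx⟩, hAx t ht x hx, hAxx t ht x hx, hXx t ht x hx,
      hXxx t ht x hx, hXc t ht x hx, hAc t ht x hx] at e1
    linear_combination -e1
  -- The `u`-coefficient is linear in `B` with nonzero factor `2 h' ψ`, and its other terms no
  -- longer contain `t`.
  have hBc : ∀ t ∈ D.J, ∀ x ∈ D.I, B (t, x) = B (t₀, x) := by
    intro t ht x hx
    have i1 := h.A_ne (t₀, x) ⟨ht₀, hx⟩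
    have i5 := θ'.h_ne_zero _ (h.mem_dom (t₀, x) ⟨ht₀, hx⟩)
    have : 2 * θ'.h (ξ x) * ψ x ≠ 0 := mul_ne_zero (mul_ne_zero two_ne_zero i5) i1
    refine mul_left_cancel₀ this ?_
    linear_combination hBeq t ht x hx - hBeq t₀ ht₀ x hx
  obtain ⟨hBx, hBxx⟩ := hdx h.smooth_B hBc
  have hBt := hdt h.smooth_B hBc
  set χ : ℝ → ℝ := fun x => B (t₀, x) with hχ
  have hξs : ContDiffOn ℝ ∞ ξ D.I := hslice h.smooth_X
  have hψs : ContDiffOn ℝ ∞ ψ D.I := hslice h.smooth_A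
  have hχs : ContDiffOn ℝ ∞ χ D.I := hslice h.smooth_B
  have hξne : ∀ x ∈ D.I, deriv ξ x ≠ 0 := fun x hx => by
    rw [← hXx t₀ ht₀ x hx]; exact h.X_ne _ ⟨ht₀, hx⟩
  have hψne : ∀ x ∈ D.I, ψ x ≠ 0 := fun x hx => h.A_ne _ ⟨ht₀, hx⟩
  have hmem : ∀ x ∈ D.I, ξ x ∈ θ'.dom := fun x hx => h.mem_dom _ ⟨ht₀, hx⟩
  have d1 : ∀ {F : ℝ → ℝ}, ContDiffOn ℝ ∞ F D.I → ∀ x ∈ D.I, HasDerivAt F (deriv F x) x :=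
    fun hF x hx => (hF.differentiableAt_of_isOpen D.isOpen_I hx).hasDerivAt
  have d2 : ∀ {F : ℝ → ℝ}, ContDiffOn ℝ ∞ F D.I → ∀ x ∈ D.I,
      HasDerivAt (deriv F) (deriv (deriv F) x) x :=
    fun hF x hx => d1 (hF.deriv_of_isOpen D.isOpen_I (m := ∞) (by simp)) x hx
  have dg' : ∀ x ∈ D.I, HasDerivAt (fun y => θ'.g (ξ y)) (deriv θ'.g (ξ x) * deriv ξ x) x :=
    fun x hx => HasDerivAt.comp x (h₂ := θ'.g) (θ'.differentiableAt_g (hmem x hx)).hasDerivAt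
      (d1 hξs x hx)
  have eX : ∀ x ∈ D.I, θ'.f (ξ x) * θ.g x / (θ.f x * δ₁) = θ'.g (ξ x) / deriv ξ x ^ 2 := by
    intro x hx
    have := h.eq_X (t₀, x) ⟨ht₀, hx⟩
    rwa [hXx t₀ ht₀ x hx] at this
  have eA : ∀ x ∈ D.I, θ'.f (ξ x) / δ₁ * (deriv θ.g x * ψ x / θ.f x) =
      deriv θ'.g (ξ x) * ψ x / deriv ξ x +
        θ'.g (ξ x) / deriv ξ x ^ 2 * (2 * deriv ψ x - ψ x * deriv (deriv ξ) x / deriv ξ x) := by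
    intro x hx
    have := h.eq_A (t₀, x) ⟨ht₀, hx⟩
    rw [hXx t₀ ht₀ x hx, hXxx t₀ ht₀ x hx, hAx t₀ ht₀ x hx, hX _ ⟨ht₀, hx⟩] at this
    simpa using this
  -- the constant `δ₀`
  set q : ℝ → ℝ := fun x => θ'.g (ξ x) * ψ x ^ 2 / (deriv ξ x * θ.g x) with hq
  -- The equation `q_x = 0` is `eq_A` after `f'` has been eliminated by `eq_X`; the constant value
  -- of `q` is `δ₀`.
  have hqc : ∀ x ∈ D.I, q x = q x₀ := by
    intro x hx
    have hd : ∀ y ∈ D.I, HasDerivAt q 0 y := by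
      intro y hy
      have i1 := hξne y hy
      have i2 := hψne y hy
      have i3 := θ.g_ne_zero y (h.subset_dom hy)
      have i4 := θ.f_ne_zero y (h.subset_dom hy)
      have dg := (θ.differentiableAt_g (h.subset_dom hy)).hasDerivAt
      have e1 := ((dg' y hy).mul ((d1 hψs y hy).pow 2)).div ((d2 hξs y hy).mul dg)
        (mul_ne_zero i1 i3)
      refine e1.congr_deriv ?_
      have e2 := eA y hy
      have e3 := eX y hy
      have e4 : θ'.f (ξ y) = θ'.g (ξ y) / deriv ξ y ^ 2 * (θ.f y * δ₁) / θ.g y := by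
        rw [← e3]; field_simp
      rw [e4] at e2
      have e5 : θ'.g (ξ y) * deriv θ.g y * ψ y * deriv ξ y =
          deriv θ'.g (ξ y) * ψ y * deriv ξ y ^ 2 * θ.g y +
            θ'.g (ξ y) * θ.g y * (2 * deriv ψ y * deriv ξ y - ψ y * deriv (deriv ξ) y) := by
        field_simp at e2
        linear_combination e2
      simp only [Pi.pow_apply, Pi.mul_apply, Nat.cast_ofNat, Nat.add_one_sub_one, pow_one]
      rw [div_eq_zero_iff]
      left
      linear_combination (-ψ y) * e5
    exact D.isOpen_I.is_const_of_deriv_eq_zero D.isPreconnected_I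
      (fun s hs => (hd s hs).differentiableAt.differentiableWithinAt)
      (fun s hs => (hd s hs).deriv) hx hx₀
  set δ₀ := q x₀ with hδ₀
  have hδ₀ne : δ₀ ≠ 0 := by
    rw [hδ₀]
    exact _root_.div_ne_zero (mul_ne_zero (θ'.g_ne_zero _ (hmem _ hx₀)) (pow_ne_zero 2 (hψne _ hx₀)))
      (mul_ne_zero (hξne _ hx₀) (θ.g_ne_zero _ (h.subset_dom hx₀)))
  have eg : ∀ x ∈ D.I, θ'.g (ξ x) = δ₀ * deriv ξ x / ψ x ^ 2 * θ.g x := by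
    intro x hx
    have i1 := hξne x hx
    have i2 := hψne x hx
    have i3 := θ.g_ne_zero x (h.subset_dom hx)
    rw [← hqc x hx]
    simp only [hq]
    field_simp
  have ef : ∀ x ∈ D.I, θ'.f (ξ x) = δ₀ * δ₁ / (deriv ξ x * ψ x ^ 2) * θ.f x := by
    intro x hx
    have i1 := hξne x hx
    have i2 := hψne x hx
    have i3 := θ.g_ne_zero x (h.subset_dom hx)
    have i4 := θ.f_ne_zero x (h.subset_dom hx)
    have e3 := eX x hx
    rw [eg x hx] at e3
    field_simp at e3 ⊢
    linear_combination e3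
  have eh : ∀ x ∈ D.I, θ'.h (ξ x) = δ₀ / (deriv ξ x * ψ x ^ 3) * θ.h x := by
    intro x hx
    have i1 := hξne x hx
    have i2 := hψne x hx
    have i4 := θ.f_ne_zero x (h.subset_dom hx)
    have e1 := (hquad t₀ ht₀ x hx).1
    have e2 : θ'.f (ξ x) * θ.h x = θ'.h (ξ x) * (θ.f x * ψ x * δ₁) := e1
    rw [ef x hx] at e2
    field_simp at e2 ⊢
    linear_combination -e2
  have hBeq' := hBeq t₀ ht₀
  have hCeq : ∀ x ∈ D.I, deriv θ'.g (ξ x) * deriv χ x / deriv ξ x +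
      θ'.g (ξ x) / deriv ξ x ^ 2 * (deriv (deriv χ) x - deriv χ x * deriv (deriv ξ) x / deriv ξ x) +
      θ'.h (ξ x) * χ x ^ 2 = 0 := by
    intro x hx
    have e1 := (hquad t₀ ht₀ x hx).2.2
    rw [hBt t₀ ht₀ x hx, hX (t₀, x) ⟨ht₀, hx⟩, hBx t₀ ht₀ x hx, hBxx t₀ ht₀ x hx, hXx t₀ ht₀ x hx,
      hXxx t₀ ht₀ x hx] at e1
    linear_combination -e1
  -- Using `eg`, the flux `g F_x/ψ^2` equals `g'(ξ) F_x/(δ₀ ξ_x)`; its derivative is the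
  -- second-order expression common to the equations for `ψ` and `χ`, up to the factor `ξ_x/δ₀`.
  have hflux : ∀ {F : ℝ → ℝ}, ContDiffOn ℝ ∞ F D.I → ∀ x ∈ D.I,
      HasDerivAt (fun y => θ.g y * deriv F y / ψ y ^ 2) (deriv ξ x / δ₀ *
        (deriv θ'.g (ξ x) * deriv F x / deriv ξ x + θ'.g (ξ x) / deriv ξ x ^ 2 *
          (deriv (deriv F) x - deriv F x * deriv (deriv ξ) x / deriv ξ x))) x := by
    intro F hF x hx
    have i1 := hξne x hx
    have e1 := (((dg' x hx).mul (d2 hF x hx)).div (d2 hξs x hx) i1).div_const δ₀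
    have e2 := e1.congr_of_eventuallyEq (f₁ := fun y => θ.g y * deriv F y / ψ y ^ 2) (by
      filter_upwards [D.isOpen_I.mem_nhds hx] with y hy
      have j1 := hξne y hy
      have j2 := hψne y hy
      simp only [Pi.div_apply, Pi.mul_apply]
      rw [eg y hy]
      field_simp)
    refine e2.congr_deriv ?_
    simp only [Pi.mul_apply]
    field_simp
    ring
  refine ⟨δ₀, δ₁, T t₀ - δ₁ * t₀, ξ, ψ, χ, hm, hm', h.subset_dom, hδ₀ne, hδ₁ne, hξs, hξne, hψs, hψne,
    hχs, fun x hx => ?_, fun x hx => ?_, fun z hz => ?_, hmem, ef, eg, eh⟩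
  · refine (hflux hψs x hx).congr_deriv ?_
    have i1 := hξne x hx
    have i2 := hψne x hx
    have e1 : ∀ a : ℝ, a + 2 * θ'.h (ξ x) * ψ x * χ x = 0 → deriv ξ x / δ₀ * a =
        -(2 * θ.h x * χ x / ψ x ^ 2) := by
      intro a ha
      rw [eh x hx] at ha
      have : a = -(2 * (δ₀ / (deriv ξ x * ψ x ^ 3) * θ.h x) * ψ x * χ x) := by linarith
      rw [this]
      field_simp
    exact e1 _ (hBeq' x hx)
  · refine (hflux hχs x hx).congr_deriv ?_
    have i1 := hξne x hx
    have i2 := hψne x hx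
    have e1 : ∀ a : ℝ, a + θ'.h (ξ x) * χ x ^ 2 = 0 → deriv ξ x / δ₀ * a =
        -(θ.h x * χ x ^ 2 / ψ x ^ 3) := by
      intro a ha
      rw [eh x hx] at ha
      have : a = -((δ₀ / (deriv ξ x * ψ x ^ 3) * θ.h x) * χ x ^ 2) := by linarith
      rw [this]
      field_simp
    exact e1 _ (hCeq x hx)
  · rw [hφ z hz, hT z.1 hz.1, hXc z.1 hz.1 _ hz.2.1, hAc z.1 hz.1 _ hz.2.1, hBc z.1 hz.1 _ hz.2.1]

theorem HasReducedForm.congr {θ θ' : ArbElt} {φ φ' : Pt → Pt} {D : Box} {δ₀ δ₁ δ₂ : ℝ}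
    {ξ ψ χ : ℝ → ℝ} (h : HasReducedForm θ θ' φ D δ₀ δ₁ δ₂ ξ ψ χ) (hφ : Set.EqOn φ φ' D.pts) :
    HasReducedForm θ θ' φ' D δ₀ δ₁ δ₂ ξ ψ χ :=
  { h with eq_φ := fun z hz => by rw [← hφ hz]; exact h.eq_φ z hz }

theorem HasReducedForm.mono {θ θ' : ArbElt} {φ : Pt → Pt} {D D' : Box} {δ₀ δ₁ δ₂ : ℝ}
    {ξ ψ χ : ℝ → ℝ} (h : HasReducedForm θ θ' φ D δ₀ δ₁ δ₂ ξ ψ χ) (hI : D'.I ⊆ D.I)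
    (hpts : D'.pts ⊆ D.pts) : HasReducedForm θ θ' φ D' δ₀ δ₁ δ₂ ξ ψ χ where
  m_eq := h.m_eq
  m_eq' := h.m_eq'
  subset_dom := hI.trans h.subset_dom
  δ₀_ne := h.δ₀_ne
  δ₁_ne := h.δ₁_ne
  smooth_ξ := h.smooth_ξ.mono hI
  ξ_ne x hx := h.ξ_ne x (hI hx)
  smooth_ψ := h.smooth_ψ.mono hI
  ψ_ne x hx := h.ψ_ne x (hI hx)
  smooth_χ := h.smooth_χ.mono hI
  eq_ψ x hx := h.eq_ψ x (hI hx)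
  eq_χ x hx := h.eq_χ x (hI hx)
  eq_φ z hz := h.eq_φ z (hpts hz)
  mem_dom x hx := h.mem_dom x (hI hx)
  eq_f x hx := h.eq_f x (hI hx)
  eq_g x hx := h.eq_g x (hI hx)
  eq_h x hx := h.eq_h x (hI hx)

theorem Box.exists_cube_subset {D : Box} {z : Pt} {s : Set Pt} (hz : z ∈ D.pts) (hs : s ∈ 𝓝 z) :
    ∃ D' : Box, z ∈ D'.pts ∧ D'.I ⊆ D.I ∧ D'.pts ⊆ D.pts ∧ D'.pts ⊆ s := by
  obtain ⟨r, hr, hsub⟩ := _root_.exists_cube_subset (inter_mem hs (D.isOpen_pts.mem_nhds hz))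
  refine ⟨Box.cube z hr, Box.self_mem_cube z hr, fun x hx => ?_, fun w hw => (hsub hw).2,
    fun w hw => (hsub hw).1⟩
  exact (hsub (show ((z.1, x, z.2.2) : Pt) ∈ _ from
    ⟨Metric.mem_ball_self hr, hx, Metric.mem_ball_self hr⟩)).2.2.1

/-- Necessity: membership excludes `X_t ≠ 0`, and the triangular form then integrates to the reduced
one. Shrinking the box accounts for `φ` being prescribed only as a germ at `z`. -/
theorem exists_hasReducedForm_of_mem_conditionalGroup {θ θ' : ArbElt} {z : Pt} {φ : Pt → Pt}
    (h : (θ, θ', z, φ) ∈ conditionalGroup) : ∃ D : Box, z ∈ D.pts ∧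
      ∃ (δ₀ δ₁ δ₂ : ℝ) (ξ ψ χ : ℝ → ℝ), HasReducedForm θ θ' φ D δ₀ δ₁ δ₂ ξ ψ χ := by
  obtain ⟨hm, Φ, φ₁, hG, hΦ, hφ⟩ := h
  simp only [Set.mem_singleton_iff] at hm hG hΦ hφ ⊢
  subst hΦ
  obtain ⟨hm', r, hr, T, X, A, B, h1, h2, h3⟩ := hG.exists_isTriangular hm
  obtain ⟨δ₀, δ₁, δ₂, ξ, ψ, χ, h4⟩ := IsTriangular.exists_hasReducedForm (D := Box.cube z hr) h1 hm
    hm' h2 h3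
  obtain ⟨D', hz, hI, hD, hs⟩ := Box.exists_cube_subset (Box.self_mem_cube z hr) hφ
  exact ⟨D', hz, δ₀, δ₁, δ₂, ξ, ψ, χ, (h4.mono hI hD).congr fun w hw => hs hw⟩

/-! ### Explicit transformations are admissible -/

theorem ContDiffAt.differentiableAt_deriv_of_two {w : ℝ → ℝ} {x : ℝ} (h : ContDiffAt ℝ 2 w x) :
    (∀ᶠ y in 𝓝 x, DifferentiableAt ℝ w y) ∧ DifferentiableAt ℝ (deriv w) x := by
  refine ⟨?_, ?_⟩
  · filter_upwards [h.eventually (by simp)] with y hy using hy.differentiableAt (by simp)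
  · have h1 : ContDiffAt ℝ 1 (fderiv ℝ w) x := h.fderiv_right (by norm_num)
    exact ((h1.clm_apply (contDiffAt_const (c := (1 : ℝ)))).differentiableAt (by simp))

/-- A transformation of the explicit form maps the equation of `θ` to the one of `θ'`. -/
theorem HasReducedForm.satisfiesAt_iff {θ θ' : ArbElt} {φ : Pt → Pt} {D : Box} {δ₀ δ₁ δ₂ : ℝ}
    {ξ ψ χ : ℝ → ℝ} (h : HasReducedForm θ θ' φ D δ₀ δ₁ δ₂ ξ ψ χ) {t x : ℝ} (hx : x ∈ D.I)
    {v v' : ℝ × ℝ → ℝ} (hv : ContDiffAt ℝ 2 v (t, x))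
    (hv' : ContDiffAt ℝ 2 v' (δ₁ * t + δ₂, ξ x))
    (hvv' : ∀ᶠ p in 𝓝 (t, x), v' (δ₁ * p.1 + δ₂, ξ p.2) = ψ p.2 * v p + χ p.2) :
    SatisfiesAt θ v (t, x) ↔ SatisfiesAt θ' v' (δ₁ * t + δ₂, ξ x) := by
  rw [satisfiesAt_iff_of_m_eq_two θ h.m_eq, satisfiesAt_iff_of_m_eq_two θ' h.m_eq']
  have d1 : ∀ {F : ℝ → ℝ}, ContDiffOn ℝ ∞ F D.I → ∀ x ∈ D.I, HasDerivAt F (deriv F x) x :=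
    fun hF x hx => (hF.differentiableAt_of_isOpen D.isOpen_I hx).hasDerivAt
  have i1 := h.ξ_ne x hx
  have i2 := h.ψ_ne x hx
  -- the derivative with respect to `t`
  have et : δ₁ * deriv (fun s => v' (s, ξ x)) (δ₁ * t + δ₂) = ψ x * deriv (fun s => v (s, x)) t := by
    have a1 : DifferentiableAt ℝ (fun s => v (s, x)) t :=
      ((hv.comp t (contDiffAt_id.prodMk contDiffAt_const)).differentiableAt (by simp))
    have a2 : DifferentiableAt ℝ (fun s => v' (s, ξ x)) (δ₁ * t + δ₂) :=
      ((hv'.comp (δ₁ * t + δ₂) (contDiffAt_id.prodMk contDiffAt_const)).differentiableAt (by simp))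
    have a3 : HasDerivAt (fun s => δ₁ * s + δ₂) δ₁ t := by
      simpa using ((hasDerivAt_id t).const_mul δ₁).add_const δ₂
    have a4 := a2.hasDerivAt.comp t a3
    have a5 := (a1.hasDerivAt.const_mul (ψ x)).add_const (χ x)
    have a6 : ∀ᶠ s in 𝓝 t, v' (δ₁ * s + δ₂, ξ x) = ψ x * v (s, x) + χ x :=
      (Continuous.prodMk_left x).continuousAt.eventually hvv'
    have a7 := a4.unique (a5.congr_of_eventuallyEq a6)
    linarith
  -- the derivatives with respect to `x`
  set τ := δ₁ * t + δ₂ with hτ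
  have b1 : ContDiffAt ℝ 2 (fun y => v (t, y)) x :=
    hv.comp x (contDiffAt_const.prodMk contDiffAt_id)
  have b2 : ContDiffAt ℝ 2 (fun y => v' (τ, y)) (ξ x) :=
    hv'.comp (ξ x) (contDiffAt_const.prodMk contDiffAt_id)
  obtain ⟨b3, b4⟩ := b1.differentiableAt_deriv_of_two
  obtain ⟨b5, b6⟩ := b2.differentiableAt_deriv_of_two
  have hξc : ContinuousAt ξ x := (d1 h.smooth_ξ x hx).continuousAt
  have b7 : ∀ᶠ y in 𝓝 x, v' (τ, ξ y) = ψ y * v (t, y) + χ y :=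
    (Continuous.prodMk_right t).continuousAt.eventually hvv'
  -- The new flux in terms of the old one and the fluxes of `ψ` and `χ`. On differentiation the two
  -- `v_x ψ_x` terms cancel, and the reduced system contributes exactly the terms needed to complete
  -- `h v^2` to a multiple of `h' (ψ v + χ)^2`.
  have b8 : ∀ᶠ y in 𝓝 x, θ'.g (ξ y) * deriv (fun y => v' (τ, y)) (ξ y) =
      δ₀ * (θ.g y * deriv (fun y => v (t, y)) y / ψ y +
        v (t, y) * (θ.g y * deriv ψ y / ψ y ^ 2) + θ.g y * deriv χ y / ψ y ^ 2) := by
    filter_upwards [b3, hξc.eventually b5, b7.eventually_nhds, D.isOpen_I.mem_nhds hx] with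
      y c1 c2 c3 hy
    have j1 := h.ξ_ne y hy
    have j2 := h.ψ_ne y hy
    have c4 := c2.hasDerivAt.comp y (d1 h.smooth_ξ y hy)
    have c5 := ((d1 h.smooth_ψ y hy).mul c1.hasDerivAt).add (d1 h.smooth_χ y hy)
    have c6 := c4.unique (c5.congr_of_eventuallyEq c3)
    have c7 : deriv (fun y => v' (τ, y)) (ξ y) =
        (deriv ψ y * v (t, y) + ψ y * deriv (fun y => v (t, y)) y + deriv χ y) / deriv ξ y := by
      rw [← c6]; field_simp
    rw [c7, h.eq_g y hy]
    field_simp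
    ring
  have b9 : DifferentiableAt ℝ (fun y => θ'.g y * deriv (fun y => v' (τ, y)) y) (ξ x) :=
    (θ'.differentiableAt_g (h.mem_dom x hx)).mul b6
  have b10 : DifferentiableAt ℝ (fun y => θ.g y * deriv (fun y => v (t, y)) y) x :=
    (θ.differentiableAt_g (h.subset_dom hx)).mul b4
  have b11 := b9.hasDerivAt.comp x (d1 h.smooth_ξ x hx)
  have b12 := (((b10.hasDerivAt.div (d1 h.smooth_ψ x hx) i2).add
    (b3.self_of_nhds.hasDerivAt.mul (h.eq_ψ x hx))).add (h.eq_χ x hx)).const_mul δ₀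
  have b13 := b11.unique (b12.congr_of_eventuallyEq b8)
  have b14 := b7.self_of_nhds
  simp only at b13 ⊢
  rw [h.eq_f x hx, h.eq_h x hx, b14]
  set N := deriv (fun y => θ'.g y * deriv (fun y => v' (τ, y)) y) (ξ x)
  set P := deriv (fun y => θ.g y * deriv (fun y => v (t, y)) y) x
  set a := deriv (fun s => v (s, x)) t
  set b := deriv (fun s => v' (s, ξ x)) τ
  have hδ₀ := h.δ₀_ne
  have hδ₁ := h.δ₁_ne
  have e1 : deriv ξ x * (δ₀ * δ₁ / (deriv ξ x * ψ x ^ 2) * θ.f x * b) =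
      δ₀ / ψ x * (θ.f x * a) := by
    field_simp
    linear_combination θ.f x * et
  have e2 : deriv ξ x * (N + δ₀ / (deriv ξ x * ψ x ^ 3) * θ.h x * (ψ x * v (t, x) + χ x) ^ 2) =
      δ₀ / ψ x * (P + θ.h x * v (t, x) ^ 2) := by
    rw [mul_add, mul_comm _ N, b13]
    field_simp
    ring
  have hne : δ₀ / ψ x ≠ 0 := _root_.div_ne_zero hδ₀ i2
  constructor
  · intro h1
    refine mul_left_cancel₀ i1 ?_
    rw [e1, e2, h1]
  · intro h1
    refine mul_left_cancel₀ hne ?_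
    rw [← e1, ← e2, h1]

theorem HasReducedForm.contDiffAt_bijective {θ θ' : ArbElt} {φ : Pt → Pt} {D : Box} {δ₀ δ₁ δ₂ : ℝ}
    {ξ ψ χ : ℝ → ℝ} (h : HasReducedForm θ θ' φ D δ₀ δ₁ δ₂ ξ ψ χ) {z : Pt} (hz : z ∈ D.pts) :
    ContDiffAt ℝ ∞ φ z ∧ Function.Bijective (fderiv ℝ φ z) := by
  obtain ⟨t, x, u⟩ := z
  have hx : x ∈ D.I := hz.2.1
  have hev : φ =ᶠ[𝓝 (t, x, u)]
      fun w => (δ₁ * w.1 + δ₂, ξ w.2.1, ψ w.2.1 * w.2.2 + χ w.2.1) := by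
    filter_upwards [D.isOpen_pts.mem_nhds hz] with w hw using h.eq_φ w hw
  have c1 : ∀ {F : ℝ → ℝ}, ContDiffOn ℝ ∞ F D.I →
      ContDiffAt ℝ ∞ (fun w : Pt => F w.2.1) (t, x, u) := fun hF =>
    ContDiffAt.comp (t, x, u) (hF.contDiffAt (D.isOpen_I.mem_nhds hx))
      (contDiff_fst.comp contDiff_snd).contDiffAt
  have d1 : ∀ {F : ℝ → ℝ}, ContDiffOn ℝ ∞ F D.I → HasFDerivAt (fun w : Pt => F w.2.1)
      (deriv F x • (ContinuousLinearMap.fst ℝ ℝ ℝ).comp (ContinuousLinearMap.snd ℝ ℝ (ℝ × ℝ)))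
      (t, x, u) := fun {F} hF =>
    HasDerivAt.comp_hasFDerivAt (h₂ := F) (t, x, u)
      (hF.differentiableAt_of_isOpen D.isOpen_I hx).hasDerivAt
      ((ContinuousLinearMap.fst ℝ ℝ ℝ).comp (ContinuousLinearMap.snd ℝ ℝ (ℝ × ℝ))).hasFDerivAt
  refine ⟨ContDiffAt.congr_of_eventuallyEq ?_ hev, ?_⟩
  · exact ((contDiffAt_const.mul contDiffAt_fst).add contDiffAt_const).prodMk
      ((c1 h.smooth_ξ).prodMk (((c1 h.smooth_ψ).mul
        (contDiff_snd.comp contDiff_snd).contDiffAt).add (c1 h.smooth_χ)))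
  · rw [hev.fderiv_eq]
    have e1 : HasFDerivAt (fun w : Pt => δ₁ * w.1 + δ₂)
        (δ₁ • ContinuousLinearMap.fst ℝ ℝ (ℝ × ℝ)) (t, x, u) :=
      ((ContinuousLinearMap.fst ℝ ℝ (ℝ × ℝ)).hasFDerivAt.const_mul δ₁).add_const δ₂
    have e2 := e1.prodMk ((d1 h.smooth_ξ).prodMk (((d1 h.smooth_ψ).mul
      ((ContinuousLinearMap.snd ℝ ℝ ℝ).comp
        (ContinuousLinearMap.snd ℝ ℝ (ℝ × ℝ))).hasFDerivAt).add (d1 h.smooth_χ)))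
    have e3 := e2.fderiv
    have i1 := h.ξ_ne x hx
    have i2 := h.ψ_ne x hx
    have i3 := h.δ₁_ne
    set L := fderiv ℝ (fun w : Pt => (δ₁ * w.1 + δ₂, ξ w.2.1, ψ w.2.1 * w.2.2 + χ w.2.1)) (t, x, u)
      with hL
    have e4 : Function.Injective (L : Pt →ₗ[ℝ] Pt) := by
      rw [← LinearMap.ker_eq_bot, LinearMap.ker_eq_bot']
      rintro ⟨a, b, c⟩ hw
      have e3' : L = _ := e3
      rw [ContinuousLinearMap.coe_coe, e3'] at hw
      simp only [Prod.ext_iff, ContinuousLinearMap.prod_apply, add_apply,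
        smul_apply, ContinuousLinearMap.comp_apply,
        ContinuousLinearMap.coe_fst', ContinuousLinearMap.coe_snd', smul_eq_mul, Prod.fst_zero,
        Prod.snd_zero, mul_eq_zero, i1, i3, false_or] at hw
      obtain ⟨h1, h2, h3⟩ := hw
      subst h1 h2
      simp [i2] at h3
      subst h3
      rfl
    exact ⟨e4, LinearMap.injective_iff_surjective.1 e4⟩

theorem HasReducedForm.admissibleAt {θ θ' : ArbElt} {φ : Pt → Pt} {D : Box} {δ₀ δ₁ δ₂ : ℝ}
    {ξ ψ χ : ℝ → ℝ} (h : HasReducedForm θ θ' φ D δ₀ δ₁ δ₂ ξ ψ χ) {z : Pt} (hz : z ∈ D.pts) :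
    AdmissibleAt θ θ' φ z := by
  obtain ⟨h1, h2⟩ := h.contDiffAt_bijective hz
  have hx : z.2.1 ∈ D.I := hz.2.1
  have e1 := h.eq_φ z hz
  refine ⟨h.subset_dom hx, by rw [e1]; exact h.mem_dom _ hx, h1, h2, ?_⟩
  intro v v' hv hvz _ hv' hvv'
  rw [e1] at hv' ⊢
  refine h.satisfiesAt_iff hx hv hv' ?_
  have hc : ContinuousAt (fun p : ℝ × ℝ => ((p.1, p.2, v p) : Pt)) (z.1, z.2.1) :=
    continuousAt_fst.prodMk (continuousAt_snd.prodMk hv.continuousAt)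
  have h3 : ∀ᶠ p in 𝓝 (z.1, z.2.1), ((p.1, p.2, v p) : Pt) ∈ D.pts := by
    refine hc.eventually (D.isOpen_pts.mem_nhds ?_)
    simp only [hvz]
    exact hz
  filter_upwards [h3, hvv'] with p hp hp'
  rw [h.eq_φ _ hp] at hp'
  exact hp'

/-! ### Solving the reduced system with dependence on a parameter -/

section AutonomousODE

variable {E : Type*} [NormedAddCommGroup E] [NormedSpace ℝ E]

/-- Local uniqueness makes the set where the germs agree open; continuity makes it relatively
closed, so it exhausts the connected set. -/
theorem eqOn_of_hasDerivAt_of_contDiffAt {V : E → E} {γ₁ γ₂ : ℝ → E} {s : Set ℝ} (hs : IsOpen s)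
    (hsc : IsPreconnected s) (h₁ : ∀ x ∈ s, HasDerivAt γ₁ (V (γ₁ x)) x)
    (h₂ : ∀ x ∈ s, HasDerivAt γ₂ (V (γ₂ x)) x) (hV : ∀ x ∈ s, ContDiffAt ℝ 1 V (γ₁ x)) {x₀ : ℝ}
    (hx₀ : x₀ ∈ s) (h : γ₁ x₀ = γ₂ x₀) : Set.EqOn γ₁ γ₂ s := by
  have hloc : ∀ x ∈ s, γ₁ x = γ₂ x → γ₁ =ᶠ[𝓝 x] γ₂ := by
    intro x hx hxe
    obtain ⟨K, t, ht, hl⟩ := (hV x hx).exists_lipschitzOnWith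
    refine ODE_solution_unique_of_eventually (v := fun _ => V) (s := fun _ => t)
      (Eventually.of_forall fun _ => hl) ?_ ?_ hxe
    · filter_upwards [hs.mem_nhds hx, (h₁ x hx).continuousAt ht] with y hy hy'
        using ⟨h₁ y hy, hy'⟩
    · rw [hxe] at ht
      filter_upwards [hs.mem_nhds hx, (h₂ x hx).continuousAt ht] with y hy hy'
        using ⟨h₂ y hy, hy'⟩
  have hsub : s ⊆ {x | γ₁ =ᶠ[𝓝 x] γ₂} := by
    refine hsc.subset_of_closure_inter_subset isOpen_setOfPred_eventually_nhds
      ⟨x₀, hx₀, hloc x₀ hx₀ h⟩ ?_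
    rintro x ⟨hx, hxs⟩
    refine hloc x hxs ?_
    by_contra hne
    have hev : ∀ᶠ y in 𝓝 x, γ₁ y ≠ γ₂ y :=
      ((h₁ x hxs).continuousAt.ne_iff_eventually_ne (h₂ x hxs).continuousAt).1 hne
    obtain ⟨y, hy, hy'⟩ := ((mem_closure_iff_frequently.1 hx).and_eventually hev).exists
    exact hy' hy.self_of_nhds
  exact fun x hx => (hsub hx).self_of_nhds

/-- Bootstrapping: a solution of class `C^n` has derivative `V ∘ γ` of class `C^n`, hence is of
class `C^(n+1)`. -/
theorem contDiffOn_of_hasDerivAt_of_contDiffOn {V : E → E} {γ : ℝ → E} {s : Set ℝ} {U : Set E}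
    (hs : IsOpen s) (h : ∀ x ∈ s, HasDerivAt γ (V (γ x)) x) (hV : ContDiffOn ℝ ∞ V U)
    (hγ : Set.MapsTo γ s U) : ContDiffOn ℝ ∞ γ s := by
  refine contDiffOn_infty.2 fun n => ?_
  induction n with
  | zero => exact contDiffOn_zero.2 fun x hx => (h x hx).continuousAt.continuousWithinAt
  | succ n ih =>
    push_cast
    rw [contDiffOn_succ_iff_deriv_of_isOpen hs]
    refine ⟨fun x hx => (h x hx).differentiableAt.differentiableWithinAt, by simp, ?_⟩
    exact ((hV.of_le (by exact_mod_cast le_top)).comp ih hγ).congr fun x hx => (h x hx).deriv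

theorem exists_continuousOn_flow [CompleteSpace E] {V : E → E} {c : E} (hV : ContDiffAt ℝ 1 V c)
    (t₀ : ℝ) : ∃ r > 0, ∃ α : E × ℝ → E, ContinuousOn α (Metric.ball c r ×ˢ Metric.ball t₀ r) ∧
      ∀ a ∈ Metric.ball c r, α (a, t₀) = a ∧
        ∀ t ∈ Metric.ball t₀ r, HasDerivAt (fun s => α (a, s)) (V (α (a, t))) t := by
  obtain ⟨ε, hε, a, r, L, K, hr, hpl⟩ := IsPicardLindelof.of_contDiffAt_one hV
  obtain ⟨α, h1, h2⟩ := (hpl t₀).exists_forall_mem_closedBall_eq_hasDerivWithinAt_continuousOn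
  have hsub : Metric.ball t₀ (min r ε) ⊆ Set.Ioo (t₀ - ε) (t₀ + ε) := by
    rw [← Real.ball_eq_Ioo]
    exact Metric.ball_subset_ball (min_le_right _ _)
  have hsub' : Metric.ball c (min r ε) ⊆ Metric.closedBall c r :=
    (Metric.ball_subset_ball (min_le_left _ _)).trans Metric.ball_subset_closedBall
  refine ⟨min r ε, lt_min (by exact_mod_cast hr) hε, α,
    h2.mono (Set.prod_mono hsub' (hsub.trans Set.Ioo_subset_Icc_self)), fun a ha => ?_⟩
  refine ⟨(h1 a (hsub' ha)).1, fun t ht => ?_⟩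
  have := hsub ht
  exact ((h1 a (hsub' ha)).2 t (Set.Ioo_subset_Icc_self this)).hasDerivAt
    (Icc_mem_nhds this.1 this.2)

end AutonomousODE

/-- The system of second order for `ψ` and `χ` equivalent to the fourth-order equation. -/
structure IsReducedSol (θ : ArbElt) (s : Set ℝ) (ψ χ : ℝ → ℝ) : Prop where
  smooth_ψ : ContDiffOn ℝ ∞ ψ s
  ψ_ne : ∀ x ∈ s, ψ x ≠ 0
  smooth_χ : ContDiffOn ℝ ∞ χ s
  eq_ψ : ∀ x ∈ s, HasDerivAt (fun y => θ.g y * deriv ψ y / ψ y ^ 2)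
    (-(2 * θ.h x * χ x / ψ x ^ 2)) x
  eq_χ : ∀ x ∈ s, HasDerivAt (fun y => θ.g y * deriv χ y / ψ y ^ 2)
    (-(θ.h x * χ x ^ 2 / ψ x ^ 3)) x

/-- The Cauchy data at `x` of a solution of the system for `ψ` and `χ`. -/
noncomputable def cauchyData (θ : ArbElt) (ψ χ : ℝ → ℝ) (x : ℝ) : ℝ × ℝ × ℝ × ℝ :=
  (ψ x, θ.g x * deriv ψ x / ψ x ^ 2, χ x, θ.g x * deriv χ x / ψ x ^ 2)

/-- The system for `ψ` and `χ` as an autonomous system of first order, with a parameter. -/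
noncomputable def reducedField (g h : ℝ × ℝ → ℝ) :
    ℝ × ℝ × ℝ × ℝ × ℝ × ℝ → ℝ × ℝ × ℝ × ℝ × ℝ × ℝ :=
  fun ⟨ε, x, p, P, q, Q⟩ => (0, 1, p ^ 2 * P / g (ε, x), -(2 * h (ε, x) * q / p ^ 2),
    p ^ 2 * Q / g (ε, x), -(h (ε, x) * q ^ 2 / p ^ 3))

theorem contDiffOn_reducedField {g h : ℝ × ℝ → ℝ} {I : Set ℝ}
    (hg : ContDiffOn ℝ ∞ g (Set.univ ×ˢ I)) (hh : ContDiffOn ℝ ∞ h (Set.univ ×ˢ I))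
    (hg0 : ∀ p ∈ Set.univ ×ˢ I, g p ≠ 0) :
    ContDiffOn ℝ ∞ (reducedField g h) {Y | Y.2.1 ∈ I ∧ Y.2.2.1 ≠ 0} := by
  have hmaps : Set.MapsTo (fun Y : ℝ × ℝ × ℝ × ℝ × ℝ × ℝ => (Y.1, Y.2.1))
      {Y | Y.2.1 ∈ I ∧ Y.2.2.1 ≠ 0} (Set.univ ×ˢ I) := fun Y hY => ⟨Set.mem_univ _, hY.1⟩
  have hπ : ContDiff ℝ ∞ (fun Y : ℝ × ℝ × ℝ × ℝ × ℝ × ℝ => (Y.1, Y.2.1)) := by fun_prop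
  have hg' := hg.comp hπ.contDiffOn hmaps
  have hh' := hh.comp hπ.contDiffOn hmaps
  have hp : ContDiffOn ℝ ∞ (fun Y : ℝ × ℝ × ℝ × ℝ × ℝ × ℝ => Y.2.2.1)
    {Y | Y.2.1 ∈ I ∧ Y.2.2.1 ≠ 0} := ContDiff.contDiffOn (by fun_prop)
  have hP : ContDiffOn ℝ ∞ (fun Y : ℝ × ℝ × ℝ × ℝ × ℝ × ℝ => Y.2.2.2.1)
    {Y | Y.2.1 ∈ I ∧ Y.2.2.1 ≠ 0} := ContDiff.contDiffOn (by fun_prop)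
  have hq : ContDiffOn ℝ ∞ (fun Y : ℝ × ℝ × ℝ × ℝ × ℝ × ℝ => Y.2.2.2.2.1)
    {Y | Y.2.1 ∈ I ∧ Y.2.2.1 ≠ 0} := ContDiff.contDiffOn (by fun_prop)
  have hQ : ContDiffOn ℝ ∞ (fun Y : ℝ × ℝ × ℝ × ℝ × ℝ × ℝ => Y.2.2.2.2.2)
    {Y | Y.2.1 ∈ I ∧ Y.2.2.1 ≠ 0} := ContDiff.contDiffOn (by fun_prop)
  have i1 : ∀ Y ∈ {Y : ℝ × ℝ × ℝ × ℝ × ℝ × ℝ | Y.2.1 ∈ I ∧ Y.2.2.1 ≠ 0}, g (Y.1, Y.2.1) ≠ 0 :=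
    fun Y hY => hg0 _ (hmaps hY)
  exact contDiffOn_const.prodMk (contDiffOn_const.prodMk
    ((((hp.pow 2).mul hP).div hg' i1).prodMk
    ((((contDiffOn_const.mul hh').mul hq).div (hp.pow 2) fun Y hY => pow_ne_zero 2 hY.2).neg.prodMk
    ((((hp.pow 2).mul hQ).div hg' i1).prodMk
    ((hh'.mul (hq.pow 2)).div (hp.pow 3) fun Y hY => pow_ne_zero 3 hY.2).neg))))

theorem isOpen_domain_reducedField {I : Set ℝ} (hI : IsOpen I) :
    IsOpen {Y : ℝ × ℝ × ℝ × ℝ × ℝ × ℝ | Y.2.1 ∈ I ∧ Y.2.2.1 ≠ 0} :=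
  (hI.preimage (by fun_prop)).inter (isOpen_ne_fun (by fun_prop) (by fun_prop))

theorem IsReducedSol.hasDerivAt {θ : ArbElt} {s : Set ℝ} {ψ χ : ℝ → ℝ} (h : IsReducedSol θ s ψ χ)
    (hs : IsOpen s) (hsd : s ⊆ θ.dom) {x : ℝ} (hx : x ∈ s) :
    HasDerivAt (fun y => ((0, y, cauchyData θ ψ χ y) : ℝ × ℝ × ℝ × ℝ × ℝ × ℝ))
      (reducedField (fun p => θ.g p.2) (fun p => θ.h p.2) (0, x, cauchyData θ ψ χ x)) x := by
  have d1 : ∀ {F : ℝ → ℝ}, ContDiffOn ℝ ∞ F s → HasDerivAt F (deriv F x) x :=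
    fun hF => (hF.differentiableAt_of_isOpen hs hx).hasDerivAt
  have i1 := h.ψ_ne x hx
  have i2 := θ.g_ne_zero x (hsd hx)
  refine ((hasDerivAt_const x (0 : ℝ)).prodMk ((hasDerivAt_id x).prodMk ((d1 h.smooth_ψ).prodMk
    ((h.eq_ψ x hx).prodMk ((d1 h.smooth_χ).prodMk (h.eq_χ x hx)))))).congr_deriv ?_
  simp only [reducedField, cauchyData, Prod.mk.injEq, true_and, and_true]
  constructor <;> field_simp

theorem IsReducedSol.eqOn {θ : ArbElt} {s : Set ℝ} {ψ₁ χ₁ ψ₂ χ₂ : ℝ → ℝ}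
    (h₁ : IsReducedSol θ s ψ₁ χ₁) (h₂ : IsReducedSol θ s ψ₂ χ₂) (hs : IsOpen s)
    (hsc : IsPreconnected s) (hsd : s ⊆ θ.dom) {x₀ : ℝ} (hx₀ : x₀ ∈ s)
    (h : cauchyData θ ψ₁ χ₁ x₀ = cauchyData θ ψ₂ χ₂ x₀) : Set.EqOn ψ₁ ψ₂ s ∧ Set.EqOn χ₁ χ₂ s := by
  have h3 := eqOn_of_hasDerivAt_of_contDiffAt hs hsc (fun x hx => h₁.hasDerivAt hs hsd hx)
    (fun x hx => h₂.hasDerivAt hs hsd hx) (fun x hx => ?_) hx₀ (by rw [h])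
  · exact ⟨fun x hx => congrArg (fun Y => Y.2.2.1) (h3 hx),
      fun x hx => congrArg (fun Y => Y.2.2.2.2.1) (h3 hx)⟩
  · refine ((contDiffOn_reducedField (I := θ.dom) ?_ ?_ ?_).contDiffAt
      ((isOpen_domain_reducedField θ.isOpen_dom).mem_nhds ?_)).of_le (by exact_mod_cast le_top)
    · exact θ.smooth_g.comp contDiff_snd.contDiffOn fun p hp => hp.2
    · exact θ.smooth_h.comp contDiff_snd.contDiffOn fun p hp => hp.2
    · exact fun p hp => θ.g_ne_zero _ hp.2
    · exact ⟨hsd hx, h₁.ψ_ne x hx⟩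

theorem IsReducedSol.mono {θ : ArbElt} {s s' : Set ℝ} {ψ χ : ℝ → ℝ} (h : IsReducedSol θ s ψ χ)
    (hs : s' ⊆ s) : IsReducedSol θ s' ψ χ :=
  ⟨h.smooth_ψ.mono hs, fun x hx => h.ψ_ne x (hs hx), h.smooth_χ.mono hs,
    fun x hx => h.eq_ψ x (hs hx), fun x hx => h.eq_χ x (hs hx)⟩

theorem HasReducedForm.isReducedSol {θ θ' : ArbElt} {φ : Pt → Pt} {D : Box} {δ₀ δ₁ δ₂ : ℝ}
    {ξ ψ χ : ℝ → ℝ} (h : HasReducedForm θ θ' φ D δ₀ δ₁ δ₂ ξ ψ χ) : IsReducedSol θ D.I ψ χ :=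
  ⟨h.smooth_ψ, h.ψ_ne, h.smooth_χ, h.eq_ψ, h.eq_χ⟩

/-- What matters is that one interval serves all parameters near `ε₀` and that the solutions are
jointly continuous there. Both follow from local flow theory because the parameter is itself a state
variable with zero velocity. -/
theorem IsSmoothFamily.exists_isReducedSol {M I : Set ℝ} {θ : ℝ → ArbElt}
    (hθ : IsSmoothFamily M I θ) {x₀ : ℝ} (hx₀ : x₀ ∈ I) {c : ℝ × ℝ × ℝ × ℝ} (hc : c.1 ≠ 0)
    (ε₀ : ℝ) : ∃ r > 0, ∃ Ψ Χ : ℝ × ℝ → ℝ, Metric.ball x₀ r ⊆ I ∧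
      ContinuousOn Ψ (Metric.ball ε₀ r ×ˢ Metric.ball x₀ r) ∧
      ContinuousOn Χ (Metric.ball ε₀ r ×ˢ Metric.ball x₀ r) ∧
      ∀ ε ∈ Metric.ball ε₀ r, IsReducedSol (θ ε) (Metric.ball x₀ r) (fun x => Ψ (ε, x))
        (fun x => Χ (ε, x)) ∧ cauchyData (θ ε) (fun x => Ψ (ε, x)) (fun x => Χ (ε, x)) x₀ = c := by
  have hI : IsOpen I := hθ.dom_eq 0 ▸ (θ 0).isOpen_dom
  set V := reducedField (fun p => (θ p.1).g p.2) (fun p => (θ p.1).h p.2) with hVdef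
  set U : Set (ℝ × ℝ × ℝ × ℝ × ℝ × ℝ) := {Y | Y.2.1 ∈ I ∧ Y.2.2.1 ≠ 0} with hU
  have hgne : ∀ p ∈ Set.univ ×ˢ I, (θ p.1).g p.2 ≠ 0 := fun p hp =>
    (θ p.1).g_ne_zero _ (by rw [hθ.dom_eq]; exact hp.2)
  have hV : ContDiffOn ℝ ∞ V U := contDiffOn_reducedField hθ.smooth_g hθ.smooth_h hgne
  have hUo : IsOpen U := isOpen_domain_reducedField hI
  have hc0 : ((ε₀, x₀, c) : ℝ × ℝ × ℝ × ℝ × ℝ × ℝ) ∈ U := ⟨hx₀, hc⟩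
  -- The independent variable is also a state variable, with unit velocity, so the nonautonomous
  -- parametric system becomes autonomous and varying `ε` means varying the initial point.
  obtain ⟨r₁, hr₁, α, hα, hsol⟩ := exists_continuousOn_flow (V := V) (c := (ε₀, x₀, c))
    ((hV.contDiffAt (hUo.mem_nhds hc0)).of_le (by exact_mod_cast le_top)) x₀
  set γ : ℝ × ℝ → ℝ × ℝ × ℝ × ℝ × ℝ × ℝ := fun q => α ((q.1, x₀, c), q.2) with hγ
  have hball : ∀ ε ∈ Metric.ball ε₀ r₁,
      ((ε, x₀, c) : ℝ × ℝ × ℝ × ℝ × ℝ × ℝ) ∈ Metric.ball (ε₀, x₀, c) r₁ := by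
    intro ε hε
    simpa [Prod.dist_eq, hr₁] using hε
  have hγc : ContinuousOn γ (Metric.ball ε₀ r₁ ×ˢ Metric.ball x₀ r₁) :=
    hα.comp (by fun_prop) fun q hq => ⟨hball _ hq.1, hq.2⟩
  have hγ₀ : γ (ε₀, x₀) = (ε₀, x₀, c) := (hsol _ (hball _ (Metric.mem_ball_self hr₁))).1
  have hev : ∀ᶠ q in 𝓝 (ε₀, x₀), γ q ∈ U := by
    refine (hγc.continuousAt (prod_mem_nhds (Metric.ball_mem_nhds _ hr₁)
      (Metric.ball_mem_nhds _ hr₁))).eventually (hUo.mem_nhds ?_)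
    rwa [hγ₀]
  obtain ⟨r₂, hr₂, hsub⟩ := Metric.eventually_nhds_iff_ball.1 hev
  rw [← ball_prod_same] at hsub
  have hmin : ∀ a : ℝ, Metric.ball a (min r₁ r₂) ⊆ Metric.ball a r₁ := fun a =>
    Metric.ball_subset_ball (min_le_left _ _)
  have hmin' : ∀ a : ℝ, Metric.ball a (min r₁ r₂) ⊆ Metric.ball a r₂ := fun a =>
    Metric.ball_subset_ball (min_le_right _ _)
  have hr : 0 < min r₁ r₂ := lt_min hr₁ hr₂
  have hmem : ∀ ε ∈ Metric.ball ε₀ (min r₁ r₂), ∀ x ∈ Metric.ball x₀ (min r₁ r₂), γ (ε, x) ∈ U :=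
    fun ε hε x hx => hsub (ε, x) ⟨hmin' _ hε, hmin' _ hx⟩
  have hder : ∀ ε ∈ Metric.ball ε₀ (min r₁ r₂), ∀ x ∈ Metric.ball x₀ (min r₁ r₂),
      HasDerivAt (fun y => γ (ε, y)) (V (γ (ε, x))) x :=
    fun ε hε x hx => (hsol _ (hball _ (hmin _ hε))).2 x (hmin _ hx)
  have hini : ∀ ε ∈ Metric.ball ε₀ (min r₁ r₂), γ (ε, x₀) = (ε, x₀, c) :=
    fun ε hε => (hsol _ (hball _ (hmin _ hε))).1
  have hx₀r : x₀ ∈ Metric.ball x₀ (min r₁ r₂) := Metric.mem_ball_self hr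
  -- the parameter and the independent variable
  have hfst : ∀ ε ∈ Metric.ball ε₀ (min r₁ r₂), ∀ x ∈ Metric.ball x₀ (min r₁ r₂),
      (γ (ε, x)).1 = ε ∧ (γ (ε, x)).2.1 = x := by
    intro ε hε x hx
    constructor
    · have hd : ∀ y ∈ Metric.ball x₀ (min r₁ r₂), HasDerivAt (fun y => (γ (ε, y)).1) 0 y :=
        fun y hy => (hder ε hε y hy).fst_comp
      have := Metric.isOpen_ball.is_const_of_deriv_eq_zero (isPreconnected_ball x₀ _)
        (fun y hy => (hd y hy).differentiableAt.differentiableWithinAt)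
        (fun y hy => (hd y hy).deriv) hx hx₀r
      rw [this, hini ε hε]
    · have hd : ∀ y ∈ Metric.ball x₀ (min r₁ r₂), HasDerivAt (fun y => (γ (ε, y)).2.1 - y) 0 y := by
        intro y hy
        have := ((hder ε hε y hy).snd_comp.fst_comp).sub (hasDerivAt_id y)
        refine this.congr_deriv ?_
        simp [hVdef, reducedField]
      have := Metric.isOpen_ball.is_const_of_deriv_eq_zero (isPreconnected_ball x₀ _)
        (fun y hy => (hd y hy).differentiableAt.differentiableWithinAt)
        (fun y hy => (hd y hy).deriv) hx hx₀r
      rw [hini ε hε] at this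
      simp only [sub_self] at this
      linarith
  have hcont := hγc.mono (Set.prod_mono (hmin ε₀) (hmin x₀))
  refine ⟨min r₁ r₂, hr, fun q => (γ q).2.2.1, fun q => (γ q).2.2.2.2.1, fun x hx => ?_,
    (by fun_prop : Continuous fun Y : ℝ × ℝ × ℝ × ℝ × ℝ × ℝ => Y.2.2.1).comp_continuousOn hcont,
    (by fun_prop : Continuous fun Y : ℝ × ℝ × ℝ × ℝ × ℝ × ℝ => Y.2.2.2.2.1).comp_continuousOn hcont,
    fun ε hε => ?_⟩
  · rw [← (hfst ε₀ (Metric.mem_ball_self hr) x hx).2]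
    exact (hmem ε₀ (Metric.mem_ball_self hr) x hx).1
  · have hsm : ContDiffOn ℝ ∞ (fun x => γ (ε, x)) (Metric.ball x₀ (min r₁ r₂)) :=
      contDiffOn_of_hasDerivAt_of_contDiffOn Metric.isOpen_ball (hder ε hε) hV (hmem ε hε)
    have hVγ : ∀ x ∈ Metric.ball x₀ (min r₁ r₂), V (γ (ε, x)) = (0, 1,
        (γ (ε, x)).2.2.1 ^ 2 * (γ (ε, x)).2.2.2.1 / (θ ε).g x,
        -(2 * (θ ε).h x * (γ (ε, x)).2.2.2.2.1 / (γ (ε, x)).2.2.1 ^ 2),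
        (γ (ε, x)).2.2.1 ^ 2 * (γ (ε, x)).2.2.2.2.2 / (θ ε).g x,
        -((θ ε).h x * (γ (ε, x)).2.2.2.2.1 ^ 2 / (γ (ε, x)).2.2.1 ^ 3)) := by
      intro x hx
      obtain ⟨h1, h2⟩ := hfst ε hε x hx
      conv_lhs => rw [hVdef]
      simp only [reducedField, h1, h2]
    have hne : ∀ x ∈ Metric.ball x₀ (min r₁ r₂), (γ (ε, x)).2.2.1 ≠ 0 := fun x hx =>
      (hmem ε hε x hx).2
    have hgn : ∀ x ∈ Metric.ball x₀ (min r₁ r₂), (θ ε).g x ≠ 0 := fun x hx => by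
      have := (hmem ε hε x hx).1
      rw [(hfst ε hε x hx).2] at this
      exact hgne (ε, x) ⟨Set.mem_univ _, this⟩
    have hd : ∀ x ∈ Metric.ball x₀ (min r₁ r₂), HasDerivAt (fun y => γ (ε, y)) _ x :=
      fun x hx => (hder ε hε x hx).congr_deriv (hVγ x hx)
    have eP : Set.EqOn (fun x => (θ ε).g x * deriv (fun y => (γ (ε, y)).2.2.1) x /
        (γ (ε, x)).2.2.1 ^ 2) (fun x => (γ (ε, x)).2.2.2.1) (Metric.ball x₀ (min r₁ r₂)) := by
      intro x hx
      have i1 := hne x hx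
      have i2 := hgn x hx
      simp only [(hd x hx).snd_comp.snd_comp.fst_comp.deriv]
      field_simp
    have eQ : Set.EqOn (fun x => (θ ε).g x * deriv (fun y => (γ (ε, y)).2.2.2.2.1) x /
        (γ (ε, x)).2.2.1 ^ 2) (fun x => (γ (ε, x)).2.2.2.2.2) (Metric.ball x₀ (min r₁ r₂)) := by
      intro x hx
      have i1 := hne x hx
      have i2 := hgn x hx
      simp only [(hd x hx).snd_comp.snd_comp.snd_comp.snd_comp.fst_comp.deriv]
      field_simp
    refine ⟨⟨?_, hne, ?_, fun x hx => ?_, fun x hx => ?_⟩, ?_⟩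
    · exact (by fun_prop : ContDiff ℝ ∞ fun Y : ℝ × ℝ × ℝ × ℝ × ℝ × ℝ => Y.2.2.1).comp_contDiffOn hsm
    · exact (by fun_prop : ContDiff ℝ ∞ fun Y : ℝ × ℝ × ℝ × ℝ × ℝ × ℝ =>
        Y.2.2.2.2.1).comp_contDiffOn hsm
    · exact (hd x hx).snd_comp.snd_comp.snd_comp.fst_comp.congr_of_eventuallyEq
        (eP.eventuallyEq_of_mem (Metric.isOpen_ball.mem_nhds hx))
    · exact (hd x hx).snd_comp.snd_comp.snd_comp.snd_comp.snd_comp.congr_of_eventuallyEq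
        (eQ.eventuallyEq_of_mem (Metric.isOpen_ball.mem_nhds hx))
    · have e1 : cauchyData (θ ε) (fun x => (γ (ε, x)).2.2.1) (fun x => (γ (ε, x)).2.2.2.2.1) x₀ =
          (γ (ε, x₀)).2.2 := Prod.ext rfl (Prod.ext (eP hx₀r) (Prod.ext rfl (eQ hx₀r)))
      rw [hini ε hε] at e1
      exact e1

/-! ### Inverse functions and transformed arbitrary elements -/

theorem exists_contDiffOn_inverse {B : Set ℝ} {ξ : ℝ → ℝ} (hB : IsOpen B) (hBc : B.OrdConnected)
    (hξ : ContDiffOn ℝ ∞ ξ B) (hξ' : ∀ x ∈ B, deriv ξ x ≠ 0) :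
    ∃ η : ℝ → ℝ, IsOpen (ξ '' B) ∧ (ξ '' B).OrdConnected ∧ ContDiffOn ℝ ∞ η (ξ '' B) ∧
      ∀ x ∈ B, η (ξ x) = x := by
  have hinj : Set.InjOn ξ B := by
    have key : ∀ x ∈ B, ∀ y ∈ B, x < y → ξ x ≠ ξ y := by
      intro x hx y hy hxy he
      obtain ⟨w, hw, hw'⟩ := exists_deriv_eq_zero hxy (hξ.continuousOn.mono (hBc.out hx hy)) he
      exact hξ' w (hBc.out hx hy (Set.Ioo_subset_Icc_self hw)) hw'
    intro x hx y hy he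
    rcases lt_trichotomy x y with h | h | h
    · exact absurd he (key x hx y hy h)
    · exact h
    · exact absurd he.symm (key y hy x hx h)
  have hca : ∀ x ∈ B, ContDiffAt ℝ ∞ ξ x := fun x hx => hξ.contDiffAt (hB.mem_nhds hx)
  have hsd : ∀ x ∈ B, HasStrictDerivAt ξ (deriv ξ x) x := fun x hx =>
    (hca x hx).hasStrictDerivAt (by simp)
  have hleft : ∀ x ∈ B, Function.invFunOn ξ B (ξ x) = x := fun x hx =>
    hinj.leftInvOn_invFunOn hx
  refine ⟨Function.invFunOn ξ B, ?_, ?_, ?_, hleft⟩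
  · refine isOpen_iff_mem_nhds.2 ?_
    rintro _ ⟨x, hx, rfl⟩
    rw [← (hsd x hx).map_nhds_eq (hξ' x hx)]
    exact image_mem_map (hB.mem_nhds hx)
  · exact (hBc.isPreconnected.image ξ hξ.continuousOn).ordConnected
  · rintro _ ⟨x, hx, rfl⟩
    refine ContDiffAt.contDiffWithinAt ?_
    have hf' : HasFDerivAt ξ ((ContinuousLinearEquiv.unitsEquivAut ℝ
        (Units.mk0 (deriv ξ x) (hξ' x hx)) : ℝ ≃L[ℝ] ℝ) : ℝ →L[ℝ] ℝ) x :=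
      (hsd x hx).hasDerivAt.hasFDerivAt_equiv (hξ' x hx)
    have h1 := (hca x hx).to_localInverse hf' (by simp)
    refine h1.congr_of_eventuallyEq ?_
    have h2 := ((hca x hx).hasStrictFDerivAt' hf' (by simp)).eventually_right_inverse
    have h3 : (hca x hx).localInverse hf' (by simp) (ξ x) = x :=
      (hca x hx).localInverse_apply_image hf' (by simp)
    have h4 : ∀ᶠ y in 𝓝 (ξ x), (hca x hx).localInverse hf' (by simp) y ∈ B :=
      h1.continuousAt.eventually (by rw [h3]; exact hB.mem_nhds hx)
    filter_upwards [h2, h4] with y hy hy'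
    conv_lhs => rw [← hy]
    exact hleft _ hy'

/-- The new arbitrary elements defined by the formulas of the explicit form. -/
theorem ArbElt.exists_transformed (θ : ArbElt) {B : Set ℝ} (hB : IsOpen B) (hBc : B.OrdConnected)
    (hBn : B.Nonempty) (hBd : B ⊆ θ.dom) {ξ ψ : ℝ → ℝ} (hξ : ContDiffOn ℝ ∞ ξ B)
    (hξ' : ∀ x ∈ B, deriv ξ x ≠ 0) (hψ : ContDiffOn ℝ ∞ ψ B) (hψ' : ∀ x ∈ B, ψ x ≠ 0)
    {δ₀ δ₁ : ℝ} (hδ₀ : δ₀ ≠ 0) (hδ₁ : δ₁ ≠ 0) : ∃ θ' : ArbElt, θ'.m = 2 ∧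
      ∀ x ∈ B, ξ x ∈ θ'.dom ∧ θ'.f (ξ x) = δ₀ * δ₁ / (deriv ξ x * ψ x ^ 2) * θ.f x ∧
        θ'.g (ξ x) = δ₀ * deriv ξ x / ψ x ^ 2 * θ.g x ∧
        θ'.h (ξ x) = δ₀ / (deriv ξ x * ψ x ^ 3) * θ.h x := by
  obtain ⟨η, hio, hic, hη, hηξ⟩ := exists_contDiffOn_inverse hB hBc hξ hξ'
  have hmaps : Set.MapsTo η (ξ '' B) B := by
    rintro _ ⟨x, hx, rfl⟩
    rwa [hηξ x hx]
  have hdξ : ContDiffOn ℝ ∞ (deriv ξ) B := hξ.deriv_of_isOpen hB (by simp)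
  have hne2 : ∀ x ∈ B, ψ x ^ 2 ≠ 0 := fun x hx => pow_ne_zero 2 (hψ' x hx)
  have hne3 : ∀ x ∈ B, ψ x ^ 3 ≠ 0 := fun x hx => pow_ne_zero 3 (hψ' x hx)
  have hf : ContDiffOn ℝ ∞ (fun x => δ₀ * δ₁ / (deriv ξ x * ψ x ^ 2) * θ.f x) B :=
    (contDiffOn_const.div (hdξ.mul (hψ.pow 2)) fun x hx => mul_ne_zero (hξ' x hx) (hne2 x hx)).mul
      (θ.smooth_f.mono hBd)
  have hg : ContDiffOn ℝ ∞ (fun x => δ₀ * deriv ξ x / ψ x ^ 2 * θ.g x) B :=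
    ((contDiffOn_const.mul hdξ).div (hψ.pow 2) hne2).mul (θ.smooth_g.mono hBd)
  have hh : ContDiffOn ℝ ∞ (fun x => δ₀ / (deriv ξ x * ψ x ^ 3) * θ.h x) B :=
    (contDiffOn_const.div (hdξ.mul (hψ.pow 3)) fun x hx => mul_ne_zero (hξ' x hx) (hne3 x hx)).mul
      (θ.smooth_h.mono hBd)
  refine ⟨{
    dom := ξ '' B
    f := (fun x => δ₀ * δ₁ / (deriv ξ x * ψ x ^ 2) * θ.f x) ∘ η
    g := (fun x => δ₀ * deriv ξ x / ψ x ^ 2 * θ.g x) ∘ η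
    h := (fun x => δ₀ / (deriv ξ x * ψ x ^ 3) * θ.h x) ∘ η
    m := 2
    isOpen_dom := hio
    ordConnected_dom := hic
    nonempty_dom := hBn.image ξ
    smooth_f := hf.comp hη hmaps
    smooth_g := hg.comp hη hmaps
    smooth_h := hh.comp hη hmaps
    f_ne_zero := fun y hy => mul_ne_zero (_root_.div_ne_zero (mul_ne_zero hδ₀ hδ₁)
      (mul_ne_zero (hξ' _ (hmaps hy)) (hne2 _ (hmaps hy)))) (θ.f_ne_zero _ (hBd (hmaps hy)))
    g_ne_zero := fun y hy => mul_ne_zero (_root_.div_ne_zero (mul_ne_zero hδ₀ (hξ' _ (hmaps hy)))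
      (hne2 _ (hmaps hy))) (θ.g_ne_zero _ (hBd (hmaps hy)))
    h_ne_zero := fun y hy => mul_ne_zero (_root_.div_ne_zero hδ₀
      (mul_ne_zero (hξ' _ (hmaps hy)) (hne3 _ (hmaps hy)))) (θ.h_ne_zero _ (hBd (hmaps hy))) },
    rfl, fun x hx => ⟨⟨x, hx, rfl⟩, ?_, ?_, ?_⟩⟩ <;> simp only [Function.comp_apply, hηξ x hx]

theorem isSmoothFamily_const {M : Set ℝ} (θ : ArbElt) (hm : θ.m ∈ M) :
    IsSmoothFamily M θ.dom (fun _ => θ) where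
  dom_eq _ := rfl
  m_mem _ := hm
  smooth_f := θ.smooth_f.comp contDiff_snd.contDiffOn fun _ hp => hp.2
  smooth_g := θ.smooth_g.comp contDiff_snd.contDiffOn fun _ hp => hp.2
  smooth_h := θ.smooth_h.comp contDiff_snd.contDiffOn fun _ hp => hp.2
  smooth_m := contDiff_const

/-! ### Extending one explicit transformation to the whole subclass -/

/-- Every transformation of the explicit form belongs to the equivalence group. -/
theorem HasReducedForm.mem_conditionalGroup {θ θ' : ArbElt} {φ : Pt → Pt} {D : Box} {δ₀ δ₁ δ₂ : ℝ}
    {ξ ψ χ : ℝ → ℝ} (h : HasReducedForm θ θ' φ D δ₀ δ₁ δ₂ ξ ψ χ) {z : Pt} (hz : z ∈ D.pts) :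
    (θ, θ', z, φ) ∈ conditionalGroup := by
  set x₀ := z.2.1 with hx₀def
  have hx₀ : x₀ ∈ D.I := hz.2.1
  set c := cauchyData θ ψ χ x₀ with hc
  have hc1 : c.1 ≠ 0 := h.ψ_ne x₀ hx₀
  obtain ⟨r₀, hr₀, hr₀D⟩ := Metric.isOpen_iff.1 D.isOpen_I x₀ hx₀
  -- A discrete scale of radii lets each tuple choose a largest admissible one.
  set R : ℕ → ℝ := fun n => (1 / 2 : ℝ) ^ n with hR
  have hRpos : ∀ n, 0 < R n := fun n => by positivity
  have hRanti : ∀ {n k}, n ≤ k → R k ≤ R n := fun hnk =>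
    pow_le_pow_of_le_one (by norm_num) (by norm_num) hnk
  have hRsmall : ∀ ρ > 0, ∃ n, R n < ρ := fun ρ hρ =>
    exists_pow_lt_of_lt_one hρ (by norm_num)
  set IsSol : ArbElt → ℕ → (ℝ → ℝ) × (ℝ → ℝ) → Prop := fun θ₁ n s =>
    Metric.ball x₀ (R n) ⊆ D.I ∧ IsReducedSol θ₁ (Metric.ball x₀ (R n)) s.1 s.2 ∧
      cauchyData θ₁ s.1 s.2 x₀ = c with hIsSol
  -- solutions for a whole family
  have hfam : ∀ θs : ℝ → ArbElt, IsSmoothFamily {2} θ.dom θs → ∀ ε₀ : ℝ, ∃ r > 0, ∃ N : ℕ,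
      ∃ Ψ Χ : ℝ × ℝ → ℝ,
      ContinuousOn Ψ (Metric.ball ε₀ r ×ˢ Metric.ball x₀ (R N)) ∧
      ContinuousOn Χ (Metric.ball ε₀ r ×ˢ Metric.ball x₀ (R N)) ∧
      ∀ ε ∈ Metric.ball ε₀ r, IsSol (θs ε) N (fun x => Ψ (ε, x), fun x => Χ (ε, x)) := by
    intro θs hθs ε₀
    obtain ⟨r, hr, Ψ, Χ, -, hΨ, hΧ, hsol⟩ := hθs.exists_isReducedSol (h.subset_dom hx₀) hc1 ε₀
    obtain ⟨N, hN⟩ := hRsmall (min r r₀) (lt_min hr hr₀)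
    have hsub : Metric.ball x₀ (R N) ⊆ Metric.ball x₀ r :=
      Metric.ball_subset_ball (hN.le.trans (min_le_left _ _))
    exact ⟨r, hr, N, Ψ, Χ, hΨ.mono (Set.prod_mono subset_rfl hsub),
      hΧ.mono (Set.prod_mono subset_rfl hsub), fun ε hε =>
      ⟨(Metric.ball_subset_ball (hN.le.trans (min_le_right _ _))).trans hr₀D,
        (hsol ε hε).1.mono hsub, (hsol ε hε).2⟩⟩
  -- For each tuple the minimal `n`, thus the largest radius, is taken. Hence the domain for each
  -- member of a family is at least any radius common to the nearby members, although the choices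
  -- are made separately; this is what gives openness along families.
  have hchoice : ∀ θ₁ : ArbElt, ∃ n s, θ₁.dom = θ.dom → θ₁.m = 2 →
      IsSol θ₁ n s ∧ ∀ k s', IsSol θ₁ k s' → n ≤ k := by
    intro θ₁
    by_cases hθ₁ : θ₁.dom = θ.dom ∧ θ₁.m = 2
    · have hex : ∃ n, ∃ s, IsSol θ₁ n s := by
        obtain ⟨r, hr, N, Ψ, Χ, -, -, h1⟩ := hfam (fun _ => θ₁)
          (hθ₁.1 ▸ isSmoothFamily_const θ₁ hθ₁.2) 0
        exact ⟨N, _, h1 0 (Metric.mem_ball_self hr)⟩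
      classical
      obtain ⟨s, hs⟩ := Nat.find_spec hex
      exact ⟨Nat.find hex, s, fun _ _ => ⟨hs, fun k s' hk => Nat.find_min' hex ⟨s', hk⟩⟩⟩
    · exact ⟨0, 0, fun h1 h2 => absurd ⟨h1, h2⟩ hθ₁⟩
  choose n s hns using hchoice
  -- Uniqueness for the Cauchy problem identifies the separately chosen solutions with those of the
  -- continuous family, so arbitrary choices do not spoil continuity.
  have huniq : ∀ {θ₁ : ArbElt}, θ₁.dom = θ.dom → ∀ {k l : ℕ} {s₁ s₂ : (ℝ → ℝ) × (ℝ → ℝ)},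
      IsSol θ₁ k s₁ → IsSol θ₁ l s₂ → k ≤ l →
      Set.EqOn s₁.1 s₂.1 (Metric.ball x₀ (R l)) ∧ Set.EqOn s₁.2 s₂.2 (Metric.ball x₀ (R l)) := by
    intro θ₁ hdom k l s₁ s₂ h1 h2 hkl
    exact (h1.2.1.mono (Metric.ball_subset_ball (hRanti hkl))).eqOn h2.2.1 Metric.isOpen_ball
      (isPreconnected_ball _ _) (by rw [hdom]; exact h2.1.trans h.subset_dom)
      (Metric.mem_ball_self (hRpos l)) (h1.2.2.trans h2.2.2.symm)
  set φ₁ : ArbElt → Pt → Pt := fun θ₁ w =>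
    (δ₁ * w.1 + δ₂, ξ w.2.1, (s θ₁).1 w.2.1 * w.2.2 + (s θ₁).2 w.2.1) with hφ₁
  -- the solution chosen for `θ` is the given one
  have hself : IsSol θ (n θ) (s θ) := (hns θ rfl h.m_eq).1
  have hselfeq : Set.EqOn (s θ).1 ψ (Metric.ball x₀ (R (n θ))) ∧
      Set.EqOn (s θ).2 χ (Metric.ball x₀ (R (n θ))) :=
    huniq rfl hself (s₂ := (ψ, χ)) ⟨hself.1, h.isReducedSol.mono hself.1, rfl⟩ le_rfl
  have htarget : ∀ θ₁ : ArbElt, ∃ θ₂ : ArbElt, (θ₁ = θ → θ₂ = θ') ∧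
      (θ₁.dom = θ.dom → θ₁.m = 2 → HasReducedForm θ₁ θ₂ (φ₁ θ₁) (Box.cube z (hRpos (n θ₁)))
        δ₀ δ₁ δ₂ ξ (s θ₁).1 (s θ₁).2) := by
    intro θ₁
    by_cases hθ₁ : θ₁.dom = θ.dom ∧ θ₁.m = 2
    · obtain ⟨⟨h1, h2, h3⟩, -⟩ := hns θ₁ hθ₁.1 hθ₁.2
      have hsub : Metric.ball x₀ (R (n θ₁)) ⊆ θ₁.dom := by
        rw [hθ₁.1]; exact h1.trans h.subset_dom
      have hform : ∀ θ₂ : ArbElt, θ₂.m = 2 → (∀ x ∈ Metric.ball x₀ (R (n θ₁)), ξ x ∈ θ₂.dom ∧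
          θ₂.f (ξ x) = δ₀ * δ₁ / (deriv ξ x * (s θ₁).1 x ^ 2) * θ₁.f x ∧
          θ₂.g (ξ x) = δ₀ * deriv ξ x / (s θ₁).1 x ^ 2 * θ₁.g x ∧
          θ₂.h (ξ x) = δ₀ / (deriv ξ x * (s θ₁).1 x ^ 3) * θ₁.h x) →
          HasReducedForm θ₁ θ₂ (φ₁ θ₁) (Box.cube z (hRpos (n θ₁))) δ₀ δ₁ δ₂ ξ (s θ₁).1 (s θ₁).2 :=
        fun θ₂ hm₂ h4 => ⟨hθ₁.2, hm₂, hsub, h.δ₀_ne, h.δ₁_ne, h.smooth_ξ.mono h1,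
          fun x hx => h.ξ_ne x (h1 hx), h2.smooth_ψ, h2.ψ_ne, h2.smooth_χ, h2.eq_ψ, h2.eq_χ,
          fun w _ => rfl, fun x hx => (h4 x hx).1, fun x hx => (h4 x hx).2.1,
          fun x hx => (h4 x hx).2.2.1, fun x hx => (h4 x hx).2.2.2⟩
      -- At `θ` itself the prescribed target must be returned; it may differ from the constructed
      -- one off the image of the small interval.
      by_cases he : θ₁ = θ
      · subst he
        refine ⟨θ', fun _ => rfl, fun _ _ => hform θ' h.m_eq' fun x hx => ?_⟩
        rw [hselfeq.1 hx]
        exact ⟨h.mem_dom x (h1 hx), h.eq_f x (h1 hx), h.eq_g x (h1 hx), h.eq_h x (h1 hx)⟩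
      · obtain ⟨θ₂, hm₂, h4⟩ := θ₁.exists_transformed Metric.isOpen_ball
          (convex_ball x₀ (R (n θ₁))).ordConnected ⟨x₀, Metric.mem_ball_self (hRpos _)⟩ hsub
          (h.smooth_ξ.mono h1) (fun x hx => h.ξ_ne x (h1 hx)) h2.smooth_ψ h2.ψ_ne h.δ₀_ne h.δ₁_ne
        exact ⟨θ₂, fun h5 => absurd h5 he, fun _ _ => hform θ₂ hm₂ h4⟩
    · refine ⟨θ', fun _ => rfl, fun h1 h2 => absurd ⟨h1, h2⟩ hθ₁⟩
  choose Φ hΦ using htarget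
  have hnhds : ∀ (ε₀ : ℝ) {r : ℝ} (_ : 0 < r) (N : ℕ),
      Metric.ball ε₀ r ×ˢ (Box.cube z (hRpos N)).pts ∈ 𝓝 (ε₀, z) := fun ε₀ r hr N =>
    prod_mem_nhds (Metric.ball_mem_nhds _ hr) ((Box.isOpen_pts _).mem_nhds (Box.self_mem_cube _ _))
  refine ⟨h.m_eq, Φ, φ₁, ⟨fun θ₁ hd hm => ((hΦ θ₁).2 hd hm).m_eq', fun θs hθs ε₀ => ?_,
    fun θs hθs ε₀ => ?_⟩, (hΦ θ).1 rfl, ?_⟩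
  · obtain ⟨r, hr, N, Ψ, Χ, -, -, h1⟩ := hfam θs hθs ε₀
    filter_upwards [hnhds ε₀ hr N] with q hq
    have hle := (hns (θs q.1) (hθs.dom_eq _) (hθs.m_mem _)).2 N _ (h1 q.1 hq.1)
    refine ((hΦ (θs q.1)).2 (hθs.dom_eq _) (hθs.m_mem _)).admissibleAt ?_
    obtain ⟨-, h2, h3, h4⟩ := hq
    exact ⟨Metric.ball_subset_ball (hRanti hle) h2, Metric.ball_subset_ball (hRanti hle) h3,
      Metric.ball_subset_ball (hRanti hle) h4⟩
  · obtain ⟨r, hr, N, Ψ, Χ, hΨ, hΧ, h1⟩ := hfam θs hθs ε₀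
    have hopen : IsOpen (Metric.ball ε₀ r ×ˢ (Box.cube z (hRpos N)).pts) :=
      Metric.isOpen_ball.prod (Box.isOpen_pts _)
    filter_upwards [hnhds ε₀ hr N] with q hq
    have heq : ∀ᶠ p in 𝓝 q, φ₁ (θs p.1) p.2 = (δ₁ * p.2.1 + δ₂, ξ p.2.2.1,
        Ψ (p.1, p.2.2.1) * p.2.2.2 + Χ (p.1, p.2.2.1)) := by
      filter_upwards [hopen.mem_nhds hq] with p hp
      obtain ⟨h2, h3⟩ := hns (θs p.1) (hθs.dom_eq _) (hθs.m_mem _)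
      obtain ⟨h4, h5⟩ := huniq (hθs.dom_eq _) h2 (h1 p.1 hp.1) (h3 _ _ (h1 p.1 hp.1))
      simp only [hφ₁, h4 hp.2.2.1, h5 hp.2.2.1]
    refine ContinuousAt.congr ?_ (heq.mono fun _ hp => hp.symm)
    have hopen' : IsOpen (Metric.ball ε₀ r ×ˢ Metric.ball x₀ (R N)) :=
      Metric.isOpen_ball.prod Metric.isOpen_ball
    have hmem : (q.1, q.2.2.1) ∈ Metric.ball ε₀ r ×ˢ Metric.ball x₀ (R N) := ⟨hq.1, hq.2.2.1⟩
    have hproj : ContinuousAt (fun p : ℝ × Pt => (p.1, p.2.2.1)) q := by fun_prop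
    have c1 : ContinuousAt (fun p : ℝ × Pt => Ψ (p.1, p.2.2.1)) q :=
      ContinuousAt.comp (f := fun p : ℝ × Pt => (p.1, p.2.2.1))
        (hΨ.continuousAt (hopen'.mem_nhds hmem)) hproj
    have c2 : ContinuousAt (fun p : ℝ × Pt => Χ (p.1, p.2.2.1)) q :=
      ContinuousAt.comp (f := fun p : ℝ × Pt => (p.1, p.2.2.1))
        (hΧ.continuousAt (hopen'.mem_nhds hmem)) hproj
    have hxq : q.2.2.1 ∈ D.I := by
      obtain ⟨h2, -⟩ := hns (θs q.1) (hθs.dom_eq _) (hθs.m_mem _)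
      exact (h1 q.1 hq.1).1 hq.2.2.1
    have c3 : ContinuousAt (fun p : ℝ × Pt => ξ p.2.2.1) q :=
      ContinuousAt.comp (f := fun p : ℝ × Pt => p.2.2.1)
        (h.smooth_ξ.continuousOn.continuousAt (D.isOpen_I.mem_nhds hxq)) (by fun_prop)
    have c4 : ContinuousAt (fun p : ℝ × Pt => δ₁ * p.2.1 + δ₂) q := by fun_prop
    have c5 : ContinuousAt (fun p : ℝ × Pt => p.2.2.2) q := by fun_prop
    exact c4.prodMk (c3.prodMk ((c1.mul c5).add c2))
  · filter_upwards [(Box.isOpen_pts _).mem_nhds (Box.self_mem_cube z (hRpos (n θ))),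
      D.isOpen_pts.mem_nhds hz] with w hw hwD
    rw [h.eq_φ w hwD]
    simp only [hφ₁]
    rw [hselfeq.1 hw.2.1, hselfeq.2 hw.2.1]

/-! ### Uniqueness of the data and gluing on a box -/

theorem conditionalGroup_iff {θ θ' : ArbElt} {z : Pt} {φ : Pt → Pt} :
    (θ, θ', z, φ) ∈ conditionalGroup ↔ ∃ D : Box, z ∈ D.pts ∧
      ∃ (δ₀ δ₁ δ₂ : ℝ) (ξ ψ χ : ℝ → ℝ), HasReducedForm θ θ' φ D δ₀ δ₁ δ₂ ξ ψ χ :=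
  ⟨exists_hasReducedForm_of_mem_conditionalGroup,
    fun ⟨_, hz, _, _, _, _, _, _, h⟩ => h.mem_conditionalGroup hz⟩

theorem eq_of_eventually_affine_eq {a b a' b' t₀ : ℝ}
    (h : ∀ᶠ t in 𝓝 t₀, a * t + b = a' * t + b') : a = a' ∧ b = b' := by
  have h1 : ∀ c d : ℝ, HasDerivAt (fun t => c * t + d) c t₀ := fun c d => by
    simpa using ((hasDerivAt_id t₀).const_mul c).add_const d
  have h2 : a = a' := ((h1 a b).congr_of_eventuallyEq (h.mono fun _ ht => ht.symm)).unique (h1 a' b')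
  refine ⟨h2, ?_⟩
  have := h.self_of_nhds
  rw [h2] at this
  linarith

/-- The components of `φ` determine `δ₁`, `δ₂`, `ξ`, `ψ`, `χ`, and the formula for `g'` with `g ≠ 0`
then determines `δ₀`. This makes local forms compatible. -/
theorem HasReducedForm.unique {θ θ' : ArbElt} {φ : Pt → Pt} {D D' : Box} {δ₀ δ₁ δ₂ δ₀' δ₁' δ₂' : ℝ}
    {ξ ψ χ ξ' ψ' χ' : ℝ → ℝ} (h : HasReducedForm θ θ' φ D δ₀ δ₁ δ₂ ξ ψ χ)
    (h' : HasReducedForm θ θ' φ D' δ₀' δ₁' δ₂' ξ' ψ' χ') {z : Pt} (hz : z ∈ D.pts)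
    (hz' : z ∈ D'.pts) : (δ₀ = δ₀' ∧ δ₁ = δ₁' ∧ δ₂ = δ₂') ∧
      ξ z.2.1 = ξ' z.2.1 ∧ ψ z.2.1 = ψ' z.2.1 ∧ χ z.2.1 = χ' z.2.1 := by
  have hev : ∀ᶠ w in 𝓝 z, (δ₁ * w.1 + δ₂, ξ w.2.1, ψ w.2.1 * w.2.2 + χ w.2.1) =
      (δ₁' * w.1 + δ₂', ξ' w.2.1, ψ' w.2.1 * w.2.2 + χ' w.2.1) := by
    filter_upwards [D.isOpen_pts.mem_nhds hz, D'.isOpen_pts.mem_nhds hz'] with w hw hw'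
    rw [← h.eq_φ w hw, ← h'.eq_φ w hw']
  simp only [Prod.mk.injEq] at hev
  obtain ⟨t, x, u⟩ := z
  have ct : ContinuousAt (fun s : ℝ => ((s, x, u) : Pt)) t := by fun_prop
  have cx : ContinuousAt (fun s : ℝ => ((t, s, u) : Pt)) x := by fun_prop
  have cu : ContinuousAt (fun s : ℝ => ((t, x, s) : Pt)) u := by fun_prop
  obtain ⟨e1, e2⟩ := eq_of_eventually_affine_eq ((ct.eventually hev).mono fun s hs => hs.1)
  obtain ⟨e3, e4⟩ := eq_of_eventually_affine_eq (a := ψ x) (b := χ x) (a' := ψ' x) (b' := χ' x)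
    ((cu.eventually hev).mono fun s hs => hs.2.2)
  have e5 : ξ =ᶠ[𝓝 x] ξ' := (cx.eventually hev).mono fun s hs => hs.2.1
  have hx : x ∈ D.I := hz.2.1
  have hx' : x ∈ D'.I := hz'.2.1
  have i1 := h.ξ_ne x hx
  have i2 := h.ψ_ne x hx
  have i3 := θ.g_ne_zero x (h.subset_dom hx)
  have e6 := h.eq_g x hx
  rw [e5.self_of_nhds, h'.eq_g x hx', ← e5.deriv_eq, ← e3] at e6
  refine ⟨⟨?_, e1, e2⟩, e5.self_of_nhds, e3, e4⟩
  field_simp at e6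
  exact e6.symm

theorem Box.isPreconnected_K (D : Box) : IsPreconnected D.K := D.ordConnected_K.isPreconnected

theorem Box.isPreconnected_pts (D : Box) : IsPreconnected D.pts :=
  D.isPreconnected_J.prod (D.isPreconnected_I.prod D.isPreconnected_K)

/-- The explicit form on a box follows from the explicit forms near its points. -/
theorem exists_hasReducedForm_of_forall {θ θ' : ArbElt} {φ : Pt → Pt} {D : Box}
    (h : ∀ z ∈ D.pts, ∃ D' : Box, z ∈ D'.pts ∧
      ∃ (δ₀ δ₁ δ₂ : ℝ) (ξ ψ χ : ℝ → ℝ), HasReducedForm θ θ' φ D' δ₀ δ₁ δ₂ ξ ψ χ) :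
    ∃ (δ₀ δ₁ δ₂ : ℝ) (ξ ψ χ : ℝ → ℝ), HasReducedForm θ θ' φ D δ₀ δ₁ δ₂ ξ ψ χ := by
  have h' : ∀ z : Pt, ∃ D' : Box, ∃ (δ₀ δ₁ δ₂ : ℝ) (ξ ψ χ : ℝ → ℝ), z ∈ D.pts →
      z ∈ D'.pts ∧ D'.pts ⊆ D.pts ∧ HasReducedForm θ θ' φ D' δ₀ δ₁ δ₂ ξ ψ χ := by
    intro z
    by_cases hz : z ∈ D.pts
    · obtain ⟨D₁, hz₁, δ₀, δ₁, δ₂, ξ, ψ, χ, h1⟩ := h z hz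
      obtain ⟨D₂, hz₂, hI, hD, hs⟩ := Box.exists_cube_subset hz₁ (D.isOpen_pts.mem_nhds hz)
      exact ⟨D₂, δ₀, δ₁, δ₂, ξ, ψ, χ, fun _ => ⟨hz₂, hs, h1.mono hI hD⟩⟩
    · exact ⟨D, 0, 0, 0, 0, 0, 0, fun h => absurd h hz⟩
  choose D' δ₀ δ₁ δ₂ ξ ψ χ hloc using h'
  obtain ⟨t₀, ht₀⟩ := D.nonempty_J
  obtain ⟨x₀, hx₀⟩ := D.nonempty_I
  obtain ⟨u₀, hu₀⟩ := D.nonempty_K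
  set z₀ : Pt := (t₀, x₀, u₀) with hz₀def
  have hz₀ : z₀ ∈ D.pts := ⟨ht₀, hx₀, hu₀⟩
  -- the constants
  have hδ : ∀ z ∈ D.pts, δ₀ z₀ = δ₀ z ∧ δ₁ z₀ = δ₁ z ∧ δ₂ z₀ = δ₂ z := by
    intro z hz
    refine D.isPreconnected_pts.induction₂
      (fun z w => δ₀ z = δ₀ w ∧ δ₁ z = δ₁ w ∧ δ₂ z = δ₂ w) (fun w hw => ?_)
      (fun a b c _ _ _ h1 h2 => ⟨h1.1.trans h2.1, h1.2.1.trans h2.2.1, h1.2.2.trans h2.2.2⟩)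
      (fun a b _ _ h1 => ⟨h1.1.symm, h1.2.1.symm, h1.2.2.symm⟩) hz₀ hz
    obtain ⟨h1, h2, h3⟩ := hloc w hw
    filter_upwards [mem_nhdsWithin_of_mem_nhds ((D' w).isOpen_pts.mem_nhds h1)] with v hv
    obtain ⟨h4, h5, h6⟩ := hloc v (h2 hv)
    exact (h3.unique h6 hv h4).1
  -- the functions
  have hfun : ∀ x ∈ D.I, ∀ t ∈ D.J, ∀ u ∈ D.K, ξ (t₀, x, u₀) x = ξ (t, x, u) x ∧
      ψ (t₀, x, u₀) x = ψ (t, x, u) x ∧ χ (t₀, x, u₀) x = χ (t, x, u) x := by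
    intro x hx t ht u hu
    refine (D.isPreconnected_J.prod D.isPreconnected_K).induction₂
      (fun p q => ξ (p.1, x, p.2) x = ξ (q.1, x, q.2) x ∧ ψ (p.1, x, p.2) x = ψ (q.1, x, q.2) x ∧
        χ (p.1, x, p.2) x = χ (q.1, x, q.2) x) (fun p hp => ?_)
      (fun a b c _ _ _ h1 h2 => ⟨h1.1.trans h2.1, h1.2.1.trans h2.2.1, h1.2.2.trans h2.2.2⟩)
      (fun a b _ _ h1 => ⟨h1.1.symm, h1.2.1.symm, h1.2.2.symm⟩)
      (x := (t₀, u₀)) (y := (t, u)) ⟨ht₀, hu₀⟩ ⟨ht, hu⟩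
    obtain ⟨h1, h2, h3⟩ := hloc (p.1, x, p.2) ⟨hp.1, hx, hp.2⟩
    have hc : ContinuousAt (fun q : ℝ × ℝ => ((q.1, x, q.2) : Pt)) p := by fun_prop
    filter_upwards [mem_nhdsWithin_of_mem_nhds (hc ((D' _).isOpen_pts.mem_nhds h1))] with q hq
    obtain ⟨h4, h5, h6⟩ := hloc (q.1, x, q.2) (h2 hq)
    exact (h3.unique h6 hq h4).2
  -- The function attached to a point `z` is compared over `x` first with the one attached to the
  -- point with the same `t`, `u` and base `x`, then, by connectedness in `(t, u)`, with the one on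
  -- the reference slice.
  have heq : ∀ z ∈ D.pts, ∀ x ∈ (D' z).I, ξ (t₀, x, u₀) x = ξ z x ∧ ψ (t₀, x, u₀) x = ψ z x ∧
      χ (t₀, x, u₀) x = χ z x := by
    intro z hz x hx
    obtain ⟨h1, h2, h3⟩ := hloc z hz
    have hw : ((z.1, x, z.2.2) : Pt) ∈ (D' z).pts := ⟨h1.1, hx, h1.2.2⟩
    obtain ⟨h4, h5, h6⟩ := hloc _ (h2 hw)
    obtain ⟨e1, e2, e3⟩ := (h6.unique h3 h4 hw).2
    obtain ⟨e4, e5, e6⟩ := hfun x (h2 hw).2.1 z.1 hz.1 z.2.2 hz.2.2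
    exact ⟨e4.trans e1, e5.trans e2, e6.trans e3⟩
  have hpt : ∀ x ∈ D.I, ((t₀, x, u₀) : Pt) ∈ D.pts := fun x hx => ⟨ht₀, hx, hu₀⟩
  -- the functions agree near `x` with those of a reduced form
  have hnear : ∀ x ∈ D.I, ∃ D₁ : Box, ∃ ξ₁ ψ₁ χ₁ : ℝ → ℝ, x ∈ D₁.I ∧
      HasReducedForm θ θ' φ D₁ (δ₀ z₀) (δ₁ z₀) (δ₂ z₀) ξ₁ ψ₁ χ₁ ∧
      Set.EqOn (fun x => ξ (t₀, x, u₀) x) ξ₁ D₁.I ∧ Set.EqOn (fun x => ψ (t₀, x, u₀) x) ψ₁ D₁.I ∧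
      Set.EqOn (fun x => χ (t₀, x, u₀) x) χ₁ D₁.I := by
    intro x hx
    obtain ⟨h1, h2, h3⟩ := hloc _ (hpt x hx)
    obtain ⟨e1, e2, e3⟩ := hδ _ (hpt x hx)
    rw [← e1, ← e2, ← e3] at h3
    exact ⟨_, _, _, _, h1.2.1, h3, fun y hy => (heq _ (hpt x hx) y hy).1,
      fun y hy => (heq _ (hpt x hx) y hy).2.1, fun y hy => (heq _ (hpt x hx) y hy).2.2⟩
  obtain ⟨-, -, hr₀⟩ := hloc z₀ hz₀
  have hsm : ∀ {F : ℝ → ℝ}, (∀ x ∈ D.I, ∃ s G, IsOpen s ∧ x ∈ s ∧ ContDiffOn ℝ ∞ G s ∧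
      Set.EqOn F G s) → ContDiffOn ℝ ∞ F D.I := by
    intro F hF x hx
    obtain ⟨s, G, hs, hxs, hG, he⟩ := hF x hx
    exact (((hG.congr he).contDiffAt (hs.mem_nhds hxs))).contDiffWithinAt
  refine ⟨δ₀ z₀, δ₁ z₀, δ₂ z₀, fun x => ξ (t₀, x, u₀) x, fun x => ψ (t₀, x, u₀) x,
    fun x => χ (t₀, x, u₀) x, hr₀.m_eq, hr₀.m_eq', fun x hx => ?_, hr₀.δ₀_ne, hr₀.δ₁_ne,
    hsm fun x hx => ?_, fun x hx => ?_, hsm fun x hx => ?_, fun x hx => ?_, hsm fun x hx => ?_,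
    fun x hx => ?_, fun x hx => ?_, fun z hz => ?_, fun x hx => ?_, fun x hx => ?_, fun x hx => ?_,
    fun x hx => ?_⟩
  on_goal 9 =>
    obtain ⟨h1, h2, h3⟩ := hloc z hz
    obtain ⟨e1, e2, e3⟩ := hδ z hz
    obtain ⟨e4, e5, e6⟩ := heq z hz _ h1.2.1
    simp only [h3.eq_φ z h1, e2, e3, e4, e5, e6]
  all_goals obtain ⟨D₁, ξ₁, ψ₁, χ₁, hxD, h1, e1, e2, e3⟩ := hnear x hx
  · exact h1.subset_dom hxD
  · exact ⟨_, _, D₁.isOpen_I, hxD, h1.smooth_ξ, e1⟩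
  · rw [deriv_eq_of_eqOn D₁.isOpen_I e1 hxD]
    exact h1.ξ_ne x hxD
  · exact ⟨_, _, D₁.isOpen_I, hxD, h1.smooth_ψ, e2⟩
  · exact (e2 hxD).trans_ne (h1.ψ_ne x hxD)
  · exact ⟨_, _, D₁.isOpen_I, hxD, h1.smooth_χ, e3⟩
  · have e4 := h1.eq_ψ x hxD
    rw [← e2 hxD, ← e3 hxD] at e4
    refine e4.congr_of_eventuallyEq ?_
    filter_upwards [D₁.isOpen_I.mem_nhds hxD] with y hy
    rw [deriv_eq_of_eqOn D₁.isOpen_I e2 hy, ← e2 hy]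
  · have e4 := h1.eq_χ x hxD
    rw [← e2 hxD, ← e3 hxD] at e4
    refine e4.congr_of_eventuallyEq ?_
    filter_upwards [D₁.isOpen_I.mem_nhds hxD] with y hy
    rw [deriv_eq_of_eqOn D₁.isOpen_I e3 hy, ← e2 hy]
  · exact (congrArg (· ∈ θ'.dom) (e1 hxD)).mpr (h1.mem_dom x hxD)
  · rw [deriv_eq_of_eqOn D₁.isOpen_I e1 hxD]
    exact (congrArg θ'.f (e1 hxD)).trans ((h1.eq_f x hxD).trans (by rw [← e2 hxD]))
  · rw [deriv_eq_of_eqOn D₁.isOpen_I e1 hxD]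
    exact (congrArg θ'.g (e1 hxD)).trans ((h1.eq_g x hxD).trans (by rw [← e2 hxD]))
  · rw [deriv_eq_of_eqOn D₁.isOpen_I e1 hxD]
    exact (congrArg θ'.h (e1 hxD)).trans ((h1.eq_h x hxD).trans (by rw [← e2 hxD]))

/-! ### Identity, composition and inversion -/

theorem id_mem_conditionalGroup {θ : ArbElt} {z : Pt} (hm : θ.m = 2) (hz : z.2.1 ∈ θ.dom) :
    (θ, θ, z, id) ∈ conditionalGroup := by
  let D : Box := ⟨Set.univ, θ.dom, Set.univ, isOpen_univ, θ.isOpen_dom, isOpen_univ,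
    Set.ordConnected_univ, θ.ordConnected_dom, Set.ordConnected_univ, Set.univ_nonempty,
    θ.nonempty_dom, Set.univ_nonempty⟩
  have h : HasReducedForm θ θ id D 1 1 0 id (fun _ => 1) (fun _ => 0) := by
    refine ⟨hm, hm, subset_rfl, one_ne_zero, one_ne_zero, contDiffOn_id, fun x _ => by simp,
      contDiffOn_const, fun x _ => one_ne_zero, contDiffOn_const, fun x _ => ?_, fun x _ => ?_,
      fun z _ => by simp, fun x hx => hx, fun x _ => by simp, fun x _ => by simp,
      fun x _ => by simp⟩
    · simpa using hasDerivAt_const x (0 : ℝ)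
    · simpa using hasDerivAt_const x (0 : ℝ)
  exact h.mem_conditionalGroup (D := D) ⟨Set.mem_univ _, hz, Set.mem_univ _⟩

theorem HasReducedForm.comp {θ θ' θ'' : ArbElt} {φ φ' : Pt → Pt} {D D' : Box}
    {δ₀ δ₁ δ₂ δ₀' δ₁' δ₂' : ℝ} {ξ ψ χ ξ' ψ' χ' : ℝ → ℝ}
    (h : HasReducedForm θ θ' φ D δ₀ δ₁ δ₂ ξ ψ χ)
    (h' : HasReducedForm θ' θ'' φ' D' δ₀' δ₁' δ₂' ξ' ψ' χ') (hD : Set.MapsTo φ D.pts D'.pts) :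
    HasReducedForm θ θ'' (φ' ∘ φ) D (δ₀ * δ₀') (δ₁ * δ₁') (δ₁' * δ₂ + δ₂') (ξ' ∘ ξ)
      (fun x => ψ' (ξ x) * ψ x) (fun x => ψ' (ξ x) * χ x + χ' (ξ x)) := by
  obtain ⟨t₀, ht₀⟩ := D.nonempty_J
  obtain ⟨u₀, hu₀⟩ := D.nonempty_K
  have hmaps : Set.MapsTo ξ D.I D'.I := by
    intro x hx
    have hz : ((t₀, x, u₀) : Pt) ∈ D.pts := ⟨ht₀, hx, hu₀⟩
    have := hD hz
    rw [h.eq_φ _ hz] at this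
    exact this.2.1
  have d1 : ∀ {F : ℝ → ℝ}, ContDiffOn ℝ ∞ F D.I → ∀ x ∈ D.I, HasDerivAt F (deriv F x) x :=
    fun hF x hx => (hF.differentiableAt_of_isOpen D.isOpen_I hx).hasDerivAt
  have d2 : ∀ {F : ℝ → ℝ}, ContDiffOn ℝ ∞ F D'.I → ∀ x ∈ D.I,
      HasDerivAt (fun y => F (ξ y)) (deriv F (ξ x) * deriv ξ x) x := fun {F} hF x hx =>
    HasDerivAt.comp x (h₂ := F) (hF.differentiableAt_of_isOpen D'.isOpen_I (hmaps hx)).hasDerivAt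
      (d1 h.smooth_ξ x hx)
  have dξ : ∀ x ∈ D.I, deriv (ξ' ∘ ξ) x = deriv ξ' (ξ x) * deriv ξ x := fun x hx =>
    (d2 h'.smooth_ξ x hx).deriv
  have dψ : ∀ x ∈ D.I, HasDerivAt (fun y => ψ' (ξ y) * ψ y)
      (deriv ψ' (ξ x) * deriv ξ x * ψ x + ψ' (ξ x) * deriv ψ x) x := fun x hx =>
    (d2 h'.smooth_ψ x hx).mul (d1 h.smooth_ψ x hx)
  have dχ : ∀ x ∈ D.I, HasDerivAt (fun y => ψ' (ξ y) * χ y + χ' (ξ y))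
      (deriv ψ' (ξ x) * deriv ξ x * χ x + ψ' (ξ x) * deriv χ x +
        deriv χ' (ξ x) * deriv ξ x) x := fun x hx =>
    ((d2 h'.smooth_ψ x hx).mul (d1 h.smooth_χ x hx)).add (d2 h'.smooth_χ x hx)
  have hδ₀ := h.δ₀_ne
  have cs : ∀ {F : ℝ → ℝ}, ContDiffOn ℝ ∞ F D'.I → ContDiffOn ℝ ∞ (fun x => F (ξ x)) D.I :=
    fun hF => hF.comp h.smooth_ξ hmaps
  refine ⟨h.m_eq, h'.m_eq', h.subset_dom, mul_ne_zero h.δ₀_ne h'.δ₀_ne,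
    mul_ne_zero h.δ₁_ne h'.δ₁_ne, cs h'.smooth_ξ, fun x hx => ?_, (cs h'.smooth_ψ).mul h.smooth_ψ,
    fun x hx => mul_ne_zero (h'.ψ_ne _ (hmaps hx)) (h.ψ_ne x hx),
    ((cs h'.smooth_ψ).mul h.smooth_χ).add (cs h'.smooth_χ), fun x hx => ?_, fun x hx => ?_,
    fun z hz => ?_, fun x hx => h'.mem_dom _ (hmaps hx), fun x hx => ?_, fun x hx => ?_,
    fun x hx => ?_⟩
  · rw [dξ x hx]
    exact mul_ne_zero (h'.ξ_ne _ (hmaps hx)) (h.ξ_ne x hx)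
  on_goal 3 =>
    have hz' := hD hz
    rw [Function.comp_apply, h'.eq_φ _ hz', h.eq_φ z hz]
    simp only [Prod.mk.injEq, Function.comp_apply, true_and]
    constructor <;> ring
  all_goals
    have i1 := h.ξ_ne x hx
    have i2 := h.ψ_ne x hx
    have i3 := h'.ψ_ne _ (hmaps hx)
    have i4 := h'.ξ_ne _ (hmaps hx)
  on_goal 3 =>
    rw [Function.comp_apply, dξ x hx, h'.eq_f _ (hmaps hx), h.eq_f x hx]
    field_simp
  on_goal 3 =>
    rw [Function.comp_apply, dξ x hx, h'.eq_g _ (hmaps hx), h.eq_g x hx]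
    field_simp
  on_goal 3 =>
    rw [Function.comp_apply, dξ x hx, h'.eq_h _ (hmaps hx), h.eq_h x hx]
    field_simp
  all_goals
    have eψ : HasDerivAt (fun y => θ'.g (ξ y) * deriv ψ' (ξ y) / ψ' (ξ y) ^ 2)
        (-(2 * θ'.h (ξ x) * χ' (ξ x) / ψ' (ξ x) ^ 2) * deriv ξ x) x :=
      HasDerivAt.comp x (h₂ := fun y => θ'.g y * deriv ψ' y / ψ' y ^ 2) (h'.eq_ψ _ (hmaps hx))
        (d1 h.smooth_ξ x hx)
    have eχ : HasDerivAt (fun y => θ'.g (ξ y) * deriv χ' (ξ y) / ψ' (ξ y) ^ 2)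
        (-(θ'.h (ξ x) * χ' (ξ x) ^ 2 / ψ' (ξ x) ^ 3) * deriv ξ x) x :=
      HasDerivAt.comp x (h₂ := fun y => θ'.g y * deriv χ' y / ψ' y ^ 2) (h'.eq_χ _ (hmaps hx))
        (d1 h.smooth_ξ x hx)
  · have e1 := (((d1 h.smooth_ψ x hx).div_const δ₀).mul eψ).add
      (((d2 h'.smooth_ψ x hx).inv i3).mul (h.eq_ψ x hx))
    refine (e1.congr_of_eventuallyEq ?_).congr_deriv ?_
    · filter_upwards [D.isOpen_I.mem_nhds hx] with y hy
      have j1 := h.ξ_ne y hy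
      have j2 := h.ψ_ne y hy
      have j3 := h'.ψ_ne _ (hmaps hy)
      simp only [(dψ y hy).deriv, Pi.add_apply, Pi.mul_apply, Pi.inv_apply, h.eq_g y hy]
      field_simp
    · simp only [Pi.inv_apply, h.eq_g x hx, h.eq_h x hx]
      field_simp
      ring
  · have e1 := ((((d1 h.smooth_χ x hx).div_const δ₀).mul eψ).add
      (((d2 h'.smooth_ψ x hx).inv i3).mul (h.eq_χ x hx))).add (eχ.div_const δ₀)
    refine (e1.congr_of_eventuallyEq ?_).congr_deriv ?_
    · filter_upwards [D.isOpen_I.mem_nhds hx] with y hy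
      have j1 := h.ξ_ne y hy
      have j2 := h.ψ_ne y hy
      have j3 := h'.ψ_ne _ (hmaps hy)
      simp only [(dχ y hy).deriv, Pi.add_apply, Pi.mul_apply, Pi.inv_apply, h.eq_g y hy]
      field_simp
    · simp only [Pi.inv_apply, h.eq_g x hx, h.eq_h x hx]
      field_simp
      ring

theorem comp_mem_conditionalGroup {θ θ' θ'' : ArbElt} {z : Pt} {φ φ' : Pt → Pt}
    (h : (θ, θ', z, φ) ∈ conditionalGroup) (h' : (θ', θ'', φ z, φ') ∈ conditionalGroup) :
    (θ, θ'', z, φ' ∘ φ) ∈ conditionalGroup := by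
  obtain ⟨D, hz, δ₀, δ₁, δ₂, ξ, ψ, χ, h1⟩ := conditionalGroup_iff.1 h
  obtain ⟨D', hz', δ₀', δ₁', δ₂', ξ', ψ', χ', h2⟩ := conditionalGroup_iff.1 h'
  obtain ⟨D₁, hz₁, hI, hD, hs⟩ := Box.exists_cube_subset hz
    ((h1.contDiffAt_bijective hz).1.continuousAt (D'.isOpen_pts.mem_nhds hz'))
  exact ((h1.mono hI hD).comp h2 hs).mem_conditionalGroup hz₁

/-- The inverse has data `1/δ₀`, `1/δ₁`, `-δ₂/δ₁`, `ξ⁻¹`, and `1/ψ`, `-χ/ψ` composed with `ξ⁻¹`. -/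
theorem inverse_mem_conditionalGroup {θ θ' : ArbElt} {z : Pt} {φ φ' : Pt → Pt}
    (h : (θ, θ', z, φ) ∈ conditionalGroup) (hφ' : ∀ᶠ w in 𝓝 z, φ' (φ w) = w) :
    (θ', θ, φ z, φ') ∈ conditionalGroup := by
  obtain ⟨D, hz, δ₀, δ₁, δ₂, ξ, ψ, χ, h⟩ := conditionalGroup_iff.1 h
  obtain ⟨η, hio, hic, hη, hηξ⟩ := exists_contDiffOn_inverse D.isOpen_I D.ordConnected_I h.smooth_ξ
    h.ξ_ne
  have hδ₀ := h.δ₀_ne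
  have hδ₁ := h.δ₁_ne
  set ι : Pt → Pt := fun y =>
    ((y.1 - δ₂) / δ₁, η y.2.1, (y.2.2 - χ (η y.2.1)) / ψ (η y.2.1)) with hι
  have hηI : Set.MapsTo η (ξ '' D.I) D.I := by
    rintro _ ⟨x, hx, rfl⟩
    rwa [hηξ x hx]
  have hξη : ∀ y ∈ ξ '' D.I, ξ (η y) = y := by
    rintro _ ⟨x, hx, rfl⟩
    rw [hηξ x hx]
  have hx₀ : z.2.1 ∈ D.I := hz.2.1
  have hzI : (φ z).2.1 ∈ ξ '' D.I := by
    rw [h.eq_φ z hz]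
    exact ⟨_, hx₀, rfl⟩
  have hιz : ι (φ z) = z := by
    have i2 := h.ψ_ne _ hx₀
    simp only [hι, h.eq_φ z hz, hηξ _ hx₀]
    refine Prod.ext ?_ (Prod.ext rfl ?_) <;> simp only <;> field_simp <;> ring
  have hιc : ContinuousAt ι (φ z) := by
    have c0 : ContinuousAt (fun y : Pt => y.2.1) (φ z) := by fun_prop
    have c1 : ContinuousAt (fun y : Pt => η y.2.1) (φ z) :=
      ContinuousAt.comp (f := fun y : Pt => y.2.1)
        (hη.continuousOn.continuousAt (hio.mem_nhds hzI)) c0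
    have c2 : ∀ {F : ℝ → ℝ}, ContDiffOn ℝ ∞ F D.I →
        ContinuousAt (fun y : Pt => F (η y.2.1)) (φ z) := fun {F} hF =>
      ContinuousAt.comp (f := fun y : Pt => η y.2.1) (g := F)
        (hF.continuousOn.continuousAt (D.isOpen_I.mem_nhds (hηI hzI))) c1
    have c3 : ContinuousAt (fun y : Pt => (y.1 - δ₂) / δ₁) (φ z) := by fun_prop
    have c4 : ContinuousAt (fun y : Pt => y.2.2) (φ z) := by fun_prop
    exact c3.prodMk (c1.prodMk ((c4.sub (c2 h.smooth_χ)).div (c2 h.smooth_ψ)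
      (h.ψ_ne _ (hηI hzI))))
  have hφι : ∀ y : Pt, y.2.1 ∈ ξ '' D.I → ι y ∈ D.pts → φ (ι y) = y := by
    intro y hy hιy
    have i2 := h.ψ_ne _ (hηI hy)
    rw [h.eq_φ _ hιy]
    simp only [hι, hξη _ hy]
    refine Prod.ext ?_ (Prod.ext rfl ?_) <;> simp only <;> field_simp <;> ring
  -- `φ'` is only assumed to be a left inverse near `z`. As `ι` is a continuous local right inverse
  -- of `φ` with `ι (φ z) = z`, this forces `φ' = ι` near `φ z`.
  have hev : ∀ᶠ y in 𝓝 (φ z), y.2.1 ∈ ξ '' D.I ∧ ι y ∈ D.pts ∧ φ' (φ (ι y)) = ι y := by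
    refine ((by fun_prop : Continuous fun y : Pt => y.2.1).continuousAt.eventually
      (hio.mem_nhds hzI)).and ((hιc.eventually ?_).and
      (hιc.eventually (p := fun w => φ' (φ w) = w) ?_))
    · rw [hιz]
      exact D.isOpen_pts.mem_nhds hz
    · rwa [hιz]
  obtain ⟨r, hr, hsub⟩ := exists_cube_subset hev
  set E := Box.cube (φ z) hr with hE
  have hEpts : ∀ y ∈ E.pts, y.2.1 ∈ ξ '' D.I ∧ φ' y = ι y := by
    intro y hy
    obtain ⟨h1, h2, h3⟩ := hsub hy
    rw [hφι y h1 h2] at h3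
    exact ⟨h1, h3⟩
  have hEI : E.I ⊆ ξ '' D.I := by
    obtain ⟨t, ht⟩ := E.nonempty_J
    obtain ⟨u, hu⟩ := E.nonempty_K
    exact fun x hx => (hEpts (t, x, u) ⟨ht, hx, hu⟩).1
  have d1 : ∀ {F : ℝ → ℝ}, ContDiffOn ℝ ∞ F D.I → ∀ x ∈ D.I, HasDerivAt F (deriv F x) x :=
    fun hF x hx => (hF.differentiableAt_of_isOpen D.isOpen_I hx).hasDerivAt
  have dη : ∀ x ∈ D.I, HasDerivAt η (deriv ξ x)⁻¹ (ξ x) := by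
    intro x hx
    have e1 := (hη.differentiableAt_of_isOpen hio ⟨x, hx, rfl⟩).hasDerivAt
    have e2 : HasDerivAt (η ∘ ξ) (deriv η (ξ x) * deriv ξ x) x := e1.comp x (d1 h.smooth_ξ x hx)
    have e3 : deriv η (ξ x) * deriv ξ x = 1 :=
      HasDerivAt.eq_of_eqOn (D.isOpen_I.mem_nhds hx) e2 (hasDerivAt_id x) fun y hy => hηξ y hy
    rwa [eq_inv_of_mul_eq_one_left e3] at e1
  have dcomp : ∀ {F : ℝ → ℝ} {F' x : ℝ}, x ∈ D.I → HasDerivAt F F' x →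
      HasDerivAt (fun y => F (η y)) (F' * (deriv ξ x)⁻¹) (ξ x) := by
    intro F F' x hx hF
    rw [← hηξ x hx] at hF
    exact HasDerivAt.comp (ξ x) (h₂ := F) hF (dη x hx)
  have cs : ∀ {F : ℝ → ℝ}, ContDiffOn ℝ ∞ F D.I → ContDiffOn ℝ ∞ (fun y => F (η y)) E.I :=
    fun hF => (hF.comp hη hηI).mono hEI
  have dψ : ∀ x ∈ D.I, HasDerivAt (fun y => (ψ (η y))⁻¹)
      (-(deriv ψ x * (deriv ξ x)⁻¹) / ψ x ^ 2) (ξ x) := by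
    intro x hx
    have i2 := h.ψ_ne x hx
    have := (dcomp hx (d1 h.smooth_ψ x hx)).fun_inv (by rwa [hηξ x hx])
    rwa [hηξ x hx] at this
  have dχ : ∀ x ∈ D.I, HasDerivAt (fun y => -(χ (η y) / ψ (η y)))
      (-((deriv χ x * ψ x - χ x * deriv ψ x) / ψ x ^ 2 * (deriv ξ x)⁻¹)) (ξ x) := by
    intro x hx
    exact (dcomp hx ((d1 h.smooth_χ x hx).fun_div (d1 h.smooth_ψ x hx) (h.ψ_ne x hx))).fun_neg
  have key : HasReducedForm θ' θ φ' E δ₀⁻¹ δ₁⁻¹ (-(δ₂ / δ₁)) η (fun y => (ψ (η y))⁻¹)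
      (fun y => -(χ (η y) / ψ (η y))) := by
    refine ⟨h.m_eq', h.m_eq, fun y hy => ?_, inv_ne_zero hδ₀, inv_ne_zero hδ₁, hη.mono hEI,
      fun y hy => ?_, (cs h.smooth_ψ).inv fun y hy => h.ψ_ne _ (hηI (hEI hy)),
      fun y hy => inv_ne_zero (h.ψ_ne _ (hηI (hEI hy))), ((cs h.smooth_χ).div (cs h.smooth_ψ)
      fun y hy => h.ψ_ne _ (hηI (hEI hy))).neg, fun y hy => ?_, fun y hy => ?_, fun z hz => ?_,
      fun y hy => h.subset_dom (hηI (hEI hy)), fun y hy => ?_, fun y hy => ?_, fun y hy => ?_⟩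
    on_goal 5 =>
      rw [(hEpts z hz).2]
      have i2 := h.ψ_ne _ (hηI (hEpts z hz).1)
      simp only [hι]
      refine Prod.ext ?_ (Prod.ext rfl ?_) <;> simp only <;> field_simp <;> ring
    all_goals
      have hyI := hEI hy
      obtain ⟨x, hx, rfl⟩ := hyI
      have i1 := h.ξ_ne x hx
      have i2 := h.ψ_ne x hx
    · exact h.mem_dom x hx
    · rw [(dη x hx).deriv]
      exact inv_ne_zero i1
    · refine ((dcomp hx ((h.eq_ψ x hx).const_mul (-δ₀))).congr_of_eventuallyEq ?_).congr_deriv ?_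
      · filter_upwards [hio.mem_nhds ⟨x, hx, rfl⟩] with w hw
        obtain ⟨y, hy', rfl⟩ := hw
        have j1 := h.ξ_ne y hy'
        have j2 := h.ψ_ne y hy'
        rw [(dψ y hy').deriv, hηξ y hy', h.eq_g y hy']
        field_simp
      · rw [hηξ x hx, h.eq_h x hx]
        field_simp
    -- The flux of `-χ/ψ` for the target is `-δ₀` times `ψ` (flux of `χ`) minus `χ` (flux of `ψ`), a
    -- Wronskian-type expression in whose derivative the products of first derivatives cancel.
    · refine ((dcomp hx ((((d1 h.smooth_ψ x hx).mul (h.eq_χ x hx)).sub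
        ((d1 h.smooth_χ x hx).mul (h.eq_ψ x hx))).const_mul (-δ₀))).congr_of_eventuallyEq
        ?_).congr_deriv ?_
      · filter_upwards [hio.mem_nhds ⟨x, hx, rfl⟩] with w hw
        obtain ⟨y, hy', rfl⟩ := hw
        have j1 := h.ξ_ne y hy'
        have j2 := h.ψ_ne y hy'
        simp only [Pi.sub_apply, Pi.mul_apply]
        rw [(dχ y hy').deriv, hηξ y hy', h.eq_g y hy']
        field_simp
      · rw [hηξ x hx, h.eq_h x hx]
        field_simp
        ring
    · rw [hηξ x hx, (dη x hx).deriv, h.eq_f x hx]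
      field_simp
    · rw [hηξ x hx, (dη x hx).deriv, h.eq_g x hx]
      field_simp
    · rw [hηξ x hx, (dη x hx).deriv, h.eq_h x hx]
      field_simp
  exact key.mem_conditionalGroup (Box.self_mem_cube _ hr)

/-! ### Comparison with the whole class -/

theorem exists_isTriangular_of_forall_cube {θ θ' : ArbElt} {φ : Pt → Pt} {z : Pt} {r : ℝ}
    (hr : 0 < r) (hm : 0 ≤ θ.m) (h : ∀ w ∈ cube z r, AdmissibleAt θ θ' φ w) :
    ∃ (T : ℝ → ℝ) (X A B : ℝ × ℝ → ℝ),
      IsTriangular θ θ' (Metric.ball z.1 r) (Metric.ball z.2.1 r) (Metric.ball z.2.2 r) T X A B ∧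
      ∀ w ∈ cube z r, φ w = (T w.1, X (w.1, w.2.1), A (w.1, w.2.1) * w.2.2 + B (w.1, w.2.1)) :=
  AdmissibleAt.exists_isTriangular Metric.isOpen_ball Metric.isOpen_ball Metric.isOpen_ball
    (isPreconnected_ball _ _) (isPreconnected_ball _ _) (isPreconnected_ball _ _)
    (Metric.mem_ball_self hr) (Metric.mem_ball_self hr) ⟨_, Metric.mem_ball_self hr⟩ hm h

theorem two_mem_nonlinearExponents : (2 : ℝ) ∈ nonlinearExponents :=
  ⟨two_ne_zero, by norm_num⟩

/-- A family with exponent `2` is a family of the whole class, so admissibility and continuity are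
inherited. The only point is that the target exponent stays `2` for every tuple of the subclass, and
this follows from `IsTriangular.power`. -/
theorem restrictedGroup_subset_conditionalGroup : restrictedGroup ⊆ conditionalGroup := by
  rintro ⟨θ, θ', z, φ⟩ ⟨⟨-, Φ, φ₁, hG, hΦ, hφ⟩, hm, hm'⟩
  refine ⟨hm, Φ, φ₁, ⟨fun θ₁ hd hm₁ => ?_, fun θs hθs => hG.admissible θs ?_,
    fun θs hθs => hG.continuous θs ?_⟩, hΦ, hφ⟩
  · have hm₁' : θ₁.m = 2 := hm₁
    have hfam : IsSmoothFamily nonlinearExponents θ.dom fun _ => θ₁ := by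
      have := isSmoothFamily_const (M := nonlinearExponents) θ₁
        (by rw [hm₁']; exact two_mem_nonlinearExponents)
      rwa [hd] at this
    obtain ⟨r, hr, h1⟩ := exists_cube_of_eventually (hG.admissible _ hfam 0)
    obtain ⟨T, X, A, B, h2, -⟩ := exists_isTriangular_of_forall_cube hr (by rw [hm₁']; norm_num)
      (h1 0 (Metric.mem_ball_self hr))
    have h3 := (h2.power ⟨_, Metric.mem_ball_self hr⟩ (by rw [hm₁']; norm_num)
      (by rw [hm₁']; norm_num) (p := (z.1, z.2.1))
      ⟨Metric.mem_ball_self hr, Metric.mem_ball_self hr⟩).1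
    exact h3.symm.trans hm₁'
  all_goals exact ⟨hθs.dom_eq, fun ε => (hθs.m_mem ε) ▸ two_mem_nonlinearExponents, hθs.smooth_f,
    hθs.smooth_g, hθs.smooth_h, hθs.smooth_m⟩

/-- The equations `u_t = u_xx + u ^ m` with `m = 1 + exp ε` on the half-line `x > 0`. -/
noncomputable def powerFamily (ε : ℝ) : ArbElt where
  dom := Set.Ioi 0
  f _ := 1
  g _ := 1
  h _ := 1
  m := 1 + Real.exp ε
  isOpen_dom := isOpen_Ioi
  ordConnected_dom := Set.ordConnected_Ioi
  nonempty_dom := Set.nonempty_Ioi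
  smooth_f := contDiffOn_const
  smooth_g := contDiffOn_const
  smooth_h := contDiffOn_const
  f_ne_zero _ _ := one_ne_zero
  g_ne_zero _ _ := one_ne_zero
  h_ne_zero _ _ := one_ne_zero

theorem powerFamily_m_zero : (powerFamily 0).m = 2 := by
  simp only [powerFamily, Real.exp_zero]
  norm_num

theorem isSmoothFamily_powerFamily :
    IsSmoothFamily nonlinearExponents (Set.Ioi 0) powerFamily where
  dom_eq _ := rfl
  m_mem ε := by
    have := Real.exp_pos ε
    exact ⟨by simp only [powerFamily]; positivity, by simp [powerFamily]⟩
  smooth_f := contDiffOn_const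
  smooth_g := contDiffOn_const
  smooth_h := contDiffOn_const
  smooth_m := contDiff_const.add Real.contDiff_exp

/-- A generalized extended equivalence transformation of the whole class is linear in `u` for almost
all members of `powerFamily`, hence by continuity for all of them. -/
theorem IsGenExtTransformation.linear_powerFamily {z : Pt} {Φ : ArbElt → ArbElt}
    {φ : ArbElt → Pt → Pt} (h : IsGenExtTransformation nonlinearExponents (Set.Ioi 0) z Φ φ) :
    ∀ᶠ w in 𝓝 z, (φ (powerFamily 0) w).2.2 * z.2.2 =
      (φ (powerFamily 0) (w.1, w.2.1, z.2.2)).2.2 * w.2.2 := by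
  obtain ⟨r, hr, h1⟩ := exists_cube_of_eventually
    ((h.admissible _ isSmoothFamily_powerFamily 0).and (h.continuous _ isSmoothFamily_powerFamily 0))
  filter_upwards [cube_mem_nhds z hr] with w hw
  have hw' : ((w.1, w.2.1, z.2.2) : Pt) ∈ cube z r := ⟨hw.1, hw.2.1, Metric.mem_ball_self hr⟩
  have hlin : ∀ ε ∈ Metric.ball (0 : ℝ) r, ε ≠ 0 → (φ (powerFamily ε) w).2.2 * z.2.2 =
      (φ (powerFamily ε) (w.1, w.2.1, z.2.2)).2.2 * w.2.2 := by
    intro ε hε hε0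
    have hmem := isSmoothFamily_powerFamily.m_mem ε
    obtain ⟨T, X, A, B, h2, h3⟩ := exists_isTriangular_of_forall_cube (θ := powerFamily ε)
      (θ' := Φ (powerFamily ε)) (φ := φ (powerFamily ε)) hr
      (add_pos one_pos (Real.exp_pos ε)).le fun v hv => (h1 ε hε v hv).1
    -- The exponent `1 + exp ε` avoids `0` and `1` and equals `2` only for `ε = 0`; for every other
    -- parameter `B = 0`.
    have h4 := (h2.power ⟨_, Metric.mem_ball_self hr⟩ hmem.1 hmem.2 (p := (w.1, w.2.1))
      ⟨hw.1, hw.2.1⟩).2.resolve_left fun h5 => by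
        have h6 : Real.exp ε = 1 := by
          simp only [powerFamily] at h5
          linarith
        exact hε0 (Real.exp_eq_one_iff ε |>.1 h6)
    rw [h3 w hw, h3 _ hw']
    simp only [h4]
    ring
  have hc : ∀ v ∈ cube z r, ContinuousAt (fun ε => (φ (powerFamily ε) v).2.2) 0 := by
    intro v hv
    have h2 := (h1 0 (Metric.mem_ball_self hr) v hv).2
    have h3 : ContinuousAt (fun ε : ℝ => (ε, v)) 0 := by fun_prop
    exact (ContinuousAt.comp (f := fun ε : ℝ => (ε, v)) h2 h3).snd.snd
  refine tendsto_nhds_unique_of_eventuallyEq (l := 𝓝[≠] (0 : ℝ))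
    (((hc w hw).mul continuousAt_const).tendsto.mono_left nhdsWithin_le_nhds)
    (((hc _ hw').mul continuousAt_const).tendsto.mono_left nhdsWithin_le_nhds) ?_
  filter_upwards [mem_nhdsWithin_of_mem_nhds (Metric.ball_mem_nhds (0 : ℝ) hr),
    self_mem_nhdsWithin] with ε hε hε0 using hlin ε hε hε0

/-- The separating example is `u' = x^3 u + 6 x` on `x > 0` for `u_t = u_xx + u^2`: the pair `ψ =
x^3`, `χ = 6 x` solves the reduced system with `f = g = h = 1`, with fluxes `3/x^4` and `6/x^6`, and
`χ` does not vanish. -/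
theorem restrictedGroup_ne_conditionalGroup : restrictedGroup ≠ conditionalGroup := by
  have hd : ∀ (n : ℕ) (c x : ℝ), HasDerivAt (fun y => c * y ^ n) (c * (n * x ^ (n - 1))) x :=
    fun n c x => (hasDerivAt_pow n x).const_mul c
  let D : Box := ⟨Set.univ, Set.Ioi 0, Set.univ, isOpen_univ, isOpen_Ioi, isOpen_univ,
    Set.ordConnected_univ, Set.ordConnected_Ioi, Set.ordConnected_univ, Set.univ_nonempty,
    Set.nonempty_Ioi, Set.univ_nonempty⟩
  have hψ : ∀ x ∈ Set.Ioi (0 : ℝ), x ^ 3 ≠ 0 := fun x hx => pow_ne_zero 3 (ne_of_gt hx)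
  obtain ⟨θ', hm', hθ'⟩ := (powerFamily 0).exists_transformed (B := Set.Ioi 0) isOpen_Ioi
    Set.ordConnected_Ioi Set.nonempty_Ioi subset_rfl (ξ := id) (ψ := fun x => x ^ 3)
    contDiffOn_id (fun x _ => by simp) (contDiff_id.pow 3).contDiffOn hψ one_ne_zero
    (one_ne_zero (α := ℝ))
  set φ : Pt → Pt := fun w => (w.1, w.2.1, w.2.1 ^ 3 * w.2.2 + 6 * w.2.1) with hφ
  have hform : HasReducedForm (powerFamily 0) θ' φ D 1 1 0 id (fun x => x ^ 3)
      (fun x => 6 * x) := by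
    refine ⟨powerFamily_m_zero, hm', subset_rfl, one_ne_zero, one_ne_zero, contDiffOn_id,
      fun x _ => by simp, (contDiff_id.pow 3).contDiffOn, hψ,
      (contDiff_const.mul contDiff_id).contDiffOn, fun x hx => ?_, fun x hx => ?_,
      fun z _ => by simp [hφ], fun x hx => (hθ' x hx).1, fun x hx => (hθ' x hx).2.1,
      fun x hx => (hθ' x hx).2.2.1, fun x hx => (hθ' x hx).2.2.2⟩
    all_goals have hx0 : x ≠ 0 := ne_of_gt hx
    · have e1 := ((hasDerivAt_pow 4 x).fun_inv (pow_ne_zero 4 hx0)).const_mul 3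
      refine (e1.congr_of_eventuallyEq ?_).congr_deriv ?_
      · filter_upwards [isOpen_Ioi.mem_nhds hx] with y hy
        have hy0 : y ≠ 0 := ne_of_gt hy
        simp only [powerFamily, (hasDerivAt_pow 3 y).deriv]
        push_cast
        field_simp
      · simp only [powerFamily]
        push_cast
        field_simp
        norm_num
    · have e1 := ((hasDerivAt_pow 6 x).fun_inv (pow_ne_zero 6 hx0)).const_mul 6
      refine (e1.congr_of_eventuallyEq ?_).congr_deriv ?_
      · filter_upwards [isOpen_Ioi.mem_nhds hx] with y hy
        have hy0 : y ≠ 0 := ne_of_gt hy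
        have : deriv (fun x : ℝ => 6 * x) y = 6 := by
          simp
        simp only [powerFamily, this]
        field_simp
      · simp only [powerFamily]
        push_cast
        field_simp
  have hmem : (powerFamily 0, θ', ((0 : ℝ), (1 : ℝ), (1 : ℝ)), φ) ∈ conditionalGroup :=
    hform.mem_conditionalGroup (D := D)
      ⟨Set.mem_univ _, show (0 : ℝ) < 1 from one_pos, Set.mem_univ _⟩
  intro heq
  rw [← heq] at hmem
  obtain ⟨⟨-, Φ, φ₁, hG, -, hφ₁⟩, -⟩ := hmem
  have hlin := (hG.linear_powerFamily).and hφ₁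
  have hc : ContinuousAt (fun u : ℝ => (((0 : ℝ), (1 : ℝ), u) : Pt)) 1 := by fun_prop
  -- At `x = 1` the map is `u + 6`, and proportionality to `u` would give `u + 6 = 7 u`.
  have hfalse : ∀ᶠ u in 𝓝 (1 : ℝ), u = 1 := by
    filter_upwards [hc.eventually hlin] with u hu
    obtain ⟨h1, h2⟩ := hu
    have h3 := hφ₁.self_of_nhds
    simp only [hφ] at h1 h2 h3
    rw [h2, h3] at h1
    simp only at h1
    linarith
  obtain ⟨u, hu, hu'⟩ := ((hfalse.filter_mono nhdsWithin_le_nhds).and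
    (self_mem_nhdsWithin (s := {1}ᶜ))).exists
  exact hu' hu

/-- The generalized extended equivalence group of the class `f u_t = (g u_x)_x + h u ^ 2` consists
exactly of the listed transformations (locally, and on every box), it contains the identity and is
closed under composition and inversion, and it is strictly wider than the restriction to `m = 2` of
the generalized extended equivalence group of the class `f u_t = (g u_x)_x + h u ^ m`,
`m ≠ 0, 1`. -/
theorem mainTheorem9 :
    (∀ (θ θ' : ArbElt) (z : Pt) (φ : Pt → Pt),
      (θ, θ', z, φ) ∈ conditionalGroup ↔ ∃ D : Box, z ∈ D.pts ∧ HasExplicitForm θ θ' φ D) ∧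
    (∀ (θ θ' : ArbElt) (φ : Pt → Pt) (D : Box),
      (∀ z ∈ D.pts, (θ, θ', z, φ) ∈ conditionalGroup) ↔ HasExplicitForm θ θ' φ D) ∧
    (∀ (θ : ArbElt) (z : Pt), θ.m = 2 → z.2.1 ∈ θ.dom → (θ, θ, z, id) ∈ conditionalGroup) ∧
    (∀ (θ θ' θ'' : ArbElt) (z : Pt) (φ φ' : Pt → Pt),
      (θ, θ', z, φ) ∈ conditionalGroup → (θ', θ'', φ z, φ') ∈ conditionalGroup →
        (θ, θ'', z, φ' ∘ φ) ∈ conditionalGroup) ∧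
    (∀ (θ θ' : ArbElt) (z : Pt) (φ φ' : Pt → Pt),
      (θ, θ', z, φ) ∈ conditionalGroup → (∀ᶠ w in 𝓝 z, φ' (φ w) = w) →
        (θ', θ, φ z, φ') ∈ conditionalGroup) ∧
    restrictedGroup ⊂ conditionalGroup := by
  refine ⟨fun θ θ' z φ => ?_, fun θ θ' φ D => ⟨fun h => ?_, fun h z hz => ?_⟩,
    fun θ z => id_mem_conditionalGroup, fun θ θ' θ'' z φ φ' => comp_mem_conditionalGroup,
    fun θ θ' z φ φ' => inverse_mem_conditionalGroup,
    restrictedGroup_subset_conditionalGroup.ssubset_of_ne restrictedGroup_ne_conditionalGroup⟩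
  · rw [conditionalGroup_iff]
    constructor
    · rintro ⟨D, hz, _, _, _, _, _, _, h⟩
      exact ⟨D, hz, h.hasExplicitForm⟩
    · rintro ⟨D, hz, h⟩
      exact ⟨D, hz, h.exists_hasReducedForm⟩
  · obtain ⟨_, _, _, _, _, _, h⟩ := exists_hasReducedForm_of_forall fun z hz =>
      conditionalGroup_iff.1 (h z hz)
    exact h.hasExplicitForm
  · obtain ⟨_, _, _, _, _, _, h⟩ := h.exists_hasReducedForm
    exact h.mem_conditionalGroup hz
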